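/- For $d\ge 1$ let $\mathcal C_d$ be the boundary complex of the $d$-dimensional cross-polytope, i.e. the join of $d$ pairs of disconnected vertices. For $n=kd$ with $k\ge 2$ let $\mathcal{ST}^{\times}(n,d)$ be the set of stacked cross-polytopal $(d-1)$-spheres on $n$ vertices: the simplicial complexes obtained via the connected sum of $k-1$ copies of $\mathcal C_d$, where a connected sum of two pure $(d-1)$-dimensional complexes is formed by removing a facet from each and identifying the vertices of the two facets along a bijection. (If $d\nmid n$, the set is empty.) For a field $\mathbb F$ and a simplicial complex $\Delta$ on $n$ vertices let $\mathbb F[\Delta]=S/I_\Delta$ be its Stanley–Reisner ring, $S=\mathbb F[x_1,\dots,x_n]$, and let $\beta_{i,k}(\mathbb F[\Delta])=\dim_{\mathbb F}\operatorname{Tor}_i^S(\mathbb F[\Delta],\mathbb F)_k$ be its graded Betti numbers, with $\beta_{i,k}=0$ for $i<0$. **Theorem.** Let $d\ge 3$, $n\ge 3d$, let $\mathbb F$ be any field and let $\Delta\in\mathcal{ST}^{\times}(n,d)$. Then for every $\Gamma\in\mathcal{ST}^{\times}(n-d,d)$ and every $i\ge 0$, $$\beta_{i,i+1}(\mathbb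 F[\Delta])=\sum_{\ell=0}^{d}\binom d\ell\beta_{i-\ell,i-\ell+1}(\mathbb F[\Gamma])+d\binom{n-2d}{i-1}+\sum_{\ell=1}^{\min\{i,d\}}\binom d\ell\binom{n-2d}{i+1-\ell},$$ and, for all $2\le j\le d-2$, $$\beta_{i,i+j}(\mathbb F[\Delta])=\sum_{\ell=0}^{d}\binom d\ell\beta_{i-\ell,i-\ell+j}(\mathbb F[\Gamma])+\binom dj\binom{n-2d}{i-j},$$ where binomial coefficients with negative lower index are $0$. In particular, all graded Betti numbers $\beta_{i,k}(\mathbb F[\Delta])$ depend only on $n$ and $d$ (not on $\Delta$, nor on $\mathbb F$). -/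

import Mathlib

namespace Betti

/-! ### Graded free resolutions of the residue field and graded Tor -/

/-- A graded free resolution, by finitely generated modules, of the residue field `F` over
`S = F[x_v : v ∈ V]`.  The `p`-th module is `⨁ a : ι p, S(-deg p a)`, the differential from
position `p + 1` to position `p` is a matrix with homogeneous entries (so that it preserves
degrees), and the augmentation `⨁ a : ι 0, S(-deg 0 a) → F = S / (x_v : v ∈ V)` sends the basis
vector `a` to `aug a`. -/
structure GradedFreeResolution (V F : Type*) [Field F] where
  ι : ℕ → Type*
  [fintype : ∀ p, Fintype (ι p)]
  deg : ∀ p, ι p → ℕ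
  d : ∀ p, Matrix (ι p) (ι (p + 1)) (MvPolynomial V F)
  aug : ι 0 → F
  homogeneous : ∀ p a b, d p a b = 0 ∨
    ∃ m, deg (p + 1) b = deg p a + m ∧ (d p a b).IsHomogeneous m
  aug_homogeneous : ∀ a, aug a = 0 ∨ deg 0 a = 0
  exact_succ : ∀ p (x : ι (p + 1) → MvPolynomial V F),
    (d p).mulVec x = 0 ↔ ∃ y, (d (p + 1)).mulVec y = x
  exact_zero : ∀ x : ι 0 → MvPolynomial V F,
    ∑ a, aug a * MvPolynomial.constantCoeff (x a) = 0 ↔ ∃ y, (d 0).mulVec y = x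
  aug_surjective : ∀ c : F, ∃ x : ι 0 → MvPolynomial V F,
    ∑ a, aug a * MvPolynomial.constantCoeff (x a) = c

attribute [instance] GradedFreeResolution.fintype

section Tor

variable {V F : Type*} [Field F]

/-- The degree `k` component of the graded ring `S / I` (for a homogeneous ideal `I`). -/
noncomputable def quotientPiece (I : Ideal (MvPolynomial V F)) (k : ℕ) :
    Submodule F (MvPolynomial V F ⧸ I) :=
  (MvPolynomial.homogeneousSubmodule V F k).map (Ideal.Quotient.mkₐ F I).toLinearMap

/-- The degree `k` component of `P_p ⊗ S/I = ⨁ a, (S/I)(-deg a)`. -/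
noncomputable def chainPiece (P : GradedFreeResolution V F) (I : Ideal (MvPolynomial V F))
    (p k : ℕ) : Submodule F (P.ι p → MvPolynomial V F ⧸ I) :=
  Submodule.pi Set.univ fun a => if P.deg p a ≤ k then quotientPiece I (k - P.deg p a) else ⊥

/-- The differential `P_{p+1} ⊗ S/I → P_p ⊗ S/I`, as an `F`-linear map. -/
noncomputable def chainDifferential (P : GradedFreeResolution V F)
    (I : Ideal (MvPolynomial V F)) (p : ℕ) :
    (P.ι (p + 1) → MvPolynomial V F ⧸ I) →ₗ[F] (P.ι p → MvPolynomial V F ⧸ I) :=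
  (((P.d p).map (Ideal.Quotient.mk I)).mulVecLin).restrictScalars F

/-- Cycles of degree `k` in `P_p ⊗ S/I`; in position `0` every chain is a cycle. -/
noncomputable def cyclePiece (P : GradedFreeResolution V F) (I : Ideal (MvPolynomial V F)) :
    ∀ p : ℕ, ℕ → Submodule F (P.ι p → MvPolynomial V F ⧸ I)
  | 0, k => chainPiece P I 0 k
  | p + 1, k => chainPiece P I (p + 1) k ⊓ LinearMap.ker (chainDifferential P I p)

/-- Boundaries of degree `k` in `P_p ⊗ S/I`. -/
noncomputable def boundaryPiece (P : GradedFreeResolution V F) (I : Ideal (MvPolynomial V F))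
    (p k : ℕ) : Submodule F (P.ι p → MvPolynomial V F ⧸ I) :=
  (chainPiece P I (p + 1) k).map (chainDifferential P I p)

/-- The degree `k` component of `Tor_p^S(S/I, F)`, computed from a graded free resolution `P` of
the residue field `F`: the degree `k` part of the homology of `P ⊗ S/I` in position `p`. -/
abbrev GradedTor (P : GradedFreeResolution V F) (I : Ideal (MvPolynomial V F)) (p k : ℕ) :=
  cyclePiece P I p k ⧸ (boundaryPiece P I p k).submoduleOf (cyclePiece P I p k)

end Tor

/-! ### The Koszul resolution of the residue field -/

section Koszul

set_option linter.unusedSectionVars false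

variable {V F : Type*} [Fintype V] [LinearOrder V] [Field F]

open MvPolynomial

/-- The sign of `v` in the differential of the basis element `e_{T ∪ {v}}`. -/
def koszulSign (F : Type*) [Field F] (T : Finset V) (v : V) : F :=
  (-1) ^ (T.filter (· < v)).card

/-- The Koszul differential of the sequence of variables, from the basis `(e_U)`, `|U| = p + 1`,
to the basis `(e_T)`, `|T| = p`. -/
noncomputable def koszulMatrix (V F : Type*) [Fintype V] [LinearOrder V] [Field F] (p : ℕ) :
    Matrix {T : Finset V // T.card = p} {U : Finset V // U.card = p + 1} (MvPolynomial V F) :=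
  fun T U => ∑ v ∈ T.1ᶜ, if insert v T.1 = U.1 then C (koszulSign F T.1 v) * X v else 0

/-- The Koszul differential on all chains at once. -/
noncomputable def koszulD (x : Finset V → MvPolynomial V F) (T : Finset V) : MvPolynomial V F :=
  ∑ v ∈ Tᶜ, C (koszulSign F T v) * (X v * x (insert v T))

/-- Extension by zero of a chain of length `p` to all index sets. -/
noncomputable def koszulExt {p : ℕ} (x : {T : Finset V // T.card = p} → MvPolynomial V F)
    (T : Finset V) : MvPolynomial V F :=
  if h : T.card = p then x ⟨T, h⟩ else 0

theorem koszulMatrix_mulVec (p : ℕ) (x : {U : Finset V // U.card = p + 1} → MvPolynomial V F)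
    (T : {T : Finset V // T.card = p}) :
    (koszulMatrix V F p).mulVec x T = koszulD (koszulExt x) T.1 := by
  simp only [Matrix.mulVec, dotProduct, koszulMatrix, koszulD, Finset.sum_mul]
  rw [Finset.sum_comm]
  refine Finset.sum_congr rfl fun v hv => ?_
  have hc : (insert v T.1).card = p + 1 := by
    rw [Finset.card_insert_of_notMem (by simpa using hv), T.2]
  rw [Finset.sum_eq_single ⟨insert v T.1, hc⟩]
  · simp [koszulExt, hc, mul_assoc]
  · intro U _ hU
    rw [if_neg, zero_mul]
    intro h
    exact hU (Subtype.ext h.symm)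
  · simp

theorem koszulD_ext_of_card_ne (p : ℕ) (x : {U : Finset V // U.card = p + 1} → MvPolynomial V F)
    (T : Finset V) (hT : T.card ≠ p) : koszulD (koszulExt x) T = 0 := by
  refine Finset.sum_eq_zero fun v hv => ?_
  have hc : (insert v T).card ≠ p + 1 := by
    rw [Finset.card_insert_of_notMem (by simpa using hv)]; omega
  simp [koszulExt, hc]

theorem koszulExt_mulVec (p : ℕ) (x : {U : Finset V // U.card = p + 1} → MvPolynomial V F) :
    koszulExt ((koszulMatrix V F p).mulVec x) = koszulD (koszulExt x) := by
  funext T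
  by_cases h : T.card = p
  · rw [koszulExt, dif_pos h, koszulMatrix_mulVec]
  · rw [koszulExt, dif_neg h, koszulD_ext_of_card_ne p x T h]

theorem koszulSign_insert_of_lt (T : Finset V) {u v : V} (hu : u ∉ T) (h : u < v) :
    koszulSign F (insert u T) v = - koszulSign F T v := by
  unfold koszulSign
  rw [Finset.filter_insert, if_pos h, Finset.card_insert_of_notMem (by simp [hu]), pow_succ]
  ring

theorem koszulSign_insert_of_gt (T : Finset V) {u v : V} (h : v < u) :
    koszulSign F (insert u T) v = koszulSign F T v := by
  unfold koszulSign
  rw [Finset.filter_insert, if_neg (not_lt.2 h.le)]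

theorem koszulD_koszulD (x : Finset V → MvPolynomial V F) : koszulD (koszulD x) = 0 := by
  funext T
  simp only [koszulD, Pi.zero_apply, Finset.mul_sum]
  rw [Finset.sum_sigma']
  refine Finset.sum_involution (fun a _ => ⟨a.2, a.1⟩) ?_ ?_ ?_ ?_
  · rintro ⟨u, v⟩ h
    simp only [Finset.mem_sigma, Finset.mem_compl, Finset.mem_insert, not_or] at h
    obtain ⟨hu, hvu, hv⟩ := h
    dsimp only
    rw [Finset.insert_comm v u T]
    rcases lt_or_gt_of_ne hvu with h | h
    · rw [koszulSign_insert_of_gt T h, koszulSign_insert_of_lt T hv h, C_neg]; ring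
    · rw [koszulSign_insert_of_lt T hu h, koszulSign_insert_of_gt T h, C_neg]; ring
  · rintro ⟨u, v⟩ h _ heq
    simp only [Finset.mem_sigma, Finset.mem_compl, Finset.mem_insert, not_or] at h
    exact h.2.1 (congrArg Sigma.fst heq)
  · rintro ⟨u, v⟩ h
    simp only [Finset.mem_sigma, Finset.mem_compl, Finset.mem_insert, not_or] at h ⊢
    exact ⟨h.2.2, fun e => h.2.1 e.symm, h.1⟩
  · rintro ⟨u, v⟩ h
    rfl

theorem coeff_koszulD (x : Finset V → MvPolynomial V F) (T : Finset V) (a : V →₀ ℕ) :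
    coeff a (koszulD x T) = ∑ v ∈ Tᶜ, koszulSign F T v *
      (if v ∈ a.support then coeff (a - Finsupp.single v 1) (x (insert v T)) else 0) := by
  simp only [koszulD, coeff_sum, coeff_C_mul]
  refine Finset.sum_congr rfl fun v _ => ?_
  rw [coeff_X_mul']

theorem exists_shifted_part (f : MvPolynomial V F) (u : V) :
    ∃ g : MvPolynomial V F, ∀ b, coeff b g =
      if (∀ w ∈ b.support, u ≤ w) then coeff (b + Finsupp.single u 1) f else 0 := by
  classical
  refine ⟨∑ c ∈ f.support with u ∈ c.support ∧ ∀ w ∈ (c - Finsupp.single u 1).support, u ≤ w,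
    monomial (c - Finsupp.single u 1) (coeff c f), fun b => ?_⟩
  have hsub : ∀ c : V →₀ ℕ, u ∈ c.support → c - Finsupp.single u 1 + Finsupp.single u 1 = c := by
    intro c hc
    refine tsub_add_cancel_of_le ?_
    rw [Finsupp.single_le_iff]
    exact Nat.one_le_iff_ne_zero.2 (by simpa using hc)
  simp only [coeff_sum, coeff_monomial]
  split_ifs with hb
  · rw [Finset.sum_eq_single (b + Finsupp.single u 1)]
    · simp
    · intro c hc hne
      rw [if_neg]
      rintro rfl
      exact hne (hsub c (Finset.mem_filter.1 hc).2.1).symm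
    · intro h
      by_contra h'
      simp only [add_tsub_cancel_right, if_true] at h'
      refine h (Finset.mem_filter.2 ⟨by simpa using h', by simp, by simpa using hb⟩)
  · refine Finset.sum_eq_zero fun c hc => ?_
    rw [if_neg]
    rintro rfl
    exact hb (Finset.mem_filter.1 hc).2.2

/-- Every Koszul cycle whose component of multidegree zero vanishes is a boundary: contract by
`x^a e_T ↦ x^(a - e_u) e_{T ∪ {u}}` for `u` the smallest element of `supp a ∪ T`, if `u ∉ T`. -/
theorem koszul_exact (x : Finset V → MvPolynomial V F) (hx : koszulD x = 0)
    (h0 : coeff 0 (x ∅) = 0) :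
    ∃ y : Finset V → MvPolynomial V F, koszulD y = x := by
  classical
  choose g hg using fun (f : MvPolynomial V F) (u : V) => exists_shifted_part f u
  let y : Finset V → MvPolynomial V F := fun U =>
    if h : U.Nonempty then g (x (U.erase (U.min' h))) (U.min' h) else 0
  have hy : ∀ (U : Finset V) (u : V) (b : V →₀ ℕ), u ∈ U → (∀ w ∈ U, u ≤ w) →
      coeff b (y U) = if (∀ w ∈ b.support, u ≤ w) then
        coeff (b + Finsupp.single u 1) (x (U.erase u)) else 0 := by
    intro U u b hu hmin
    have hne : U.Nonempty := ⟨u, hu⟩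
    have hm : U.min' hne = u :=
      le_antisymm (Finset.min'_le _ _ hu) (hmin _ (Finset.min'_mem _ _))
    simp only [y, dif_pos hne, hm, hg]
  refine ⟨y, ?_⟩
  · funext T
    ext a
    rw [coeff_koszulD]
    by_cases hne : (a.support ∪ T).Nonempty
    swap
    · rw [Finset.not_nonempty_iff_eq_empty, Finset.union_eq_empty] at hne
      obtain ⟨ha, rfl⟩ := hne
      rw [Finsupp.support_eq_empty] at ha
      subst ha
      simp [h0]
    obtain ⟨u, hu, hmin⟩ : ∃ u ∈ a.support ∪ T, ∀ w ∈ a.support ∪ T, u ≤ w :=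
      ⟨_, Finset.min'_mem _ hne, fun w hw => Finset.min'_le _ _ hw⟩
    have hsupp : ∀ v : V, ∀ w ∈ (a - Finsupp.single v 1).support, u ≤ w := by
      intro v w hw
      refine hmin w (Finset.mem_union_left _ ?_)
      rw [Finsupp.mem_support_iff] at hw ⊢
      intro h
      simp [Finsupp.tsub_apply, h] at hw
    by_cases huT : u ∈ T
    · -- the smallest element lies in `T`: use the cycle condition
      have hcyc := congrArg (coeff (a + Finsupp.single u 1)) (congrFun hx (T.erase u))
      rw [coeff_koszulD] at hcyc
      simp only [Pi.zero_apply, coeff_zero] at hcyc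
      have hcompl : (T.erase u)ᶜ = insert u Tᶜ := by
        ext w; simp only [Finset.mem_compl, Finset.mem_erase, Finset.mem_insert]; tauto
      rw [hcompl, Finset.sum_insert (by simpa using huT), if_pos (by simp),
        Finset.insert_erase huT, add_tsub_cancel_right] at hcyc
      have hs : koszulSign F (T.erase u) u = 1 := by
        unfold koszulSign
        rw [Finset.filter_eq_empty_iff.2, Finset.card_empty, pow_zero]
        intro w hw
        exact not_lt.2 (hmin w (Finset.mem_union_right _ (Finset.mem_of_mem_erase hw)))
      rw [hs, one_mul] at hcyc
      rw [eq_neg_of_add_eq_zero_left hcyc, ← Finset.sum_neg_distrib]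
      refine Finset.sum_congr rfl fun v hv => ?_
      have hvT : v ∉ T := by simpa using hv
      have hvu : v ≠ u := fun h => hvT (h ▸ huT)
      by_cases hva : v ∈ a.support
      · have huv : u < v := lt_of_le_of_ne (hmin v (Finset.mem_union_left _ hva)) hvu.symm
        have hva' : v ∈ (a + Finsupp.single u 1).support := by
          simp only [Finsupp.mem_support_iff] at hva ⊢
          simp only [Finsupp.add_apply]; omega
        rw [if_pos hva, if_pos hva', hy _ u _ (Finset.mem_insert_of_mem huT), if_pos (hsupp v)]
        · have hsign : koszulSign F T v = - koszulSign F (T.erase u) v := by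
            rw [← koszulSign_insert_of_lt _ (Finset.notMem_erase u T) huv, Finset.insert_erase huT]
          have hexp : a - Finsupp.single v 1 + Finsupp.single u 1
              = a + Finsupp.single u 1 - Finsupp.single v 1 := by
            refine (tsub_add_eq_add_tsub ?_)
            rw [Finsupp.single_le_iff]
            exact Nat.one_le_iff_ne_zero.2 (by simpa using hva)
          rw [hsign, hexp, Finset.erase_insert_of_ne hvu]
          ring
        · intro w hw
          rcases Finset.mem_insert.1 hw with rfl | hw
          · exact huv.le
          · exact hmin w (Finset.mem_union_right _ hw)
      · have hva' : v ∉ (a + Finsupp.single u 1).support := by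
          simp only [Finsupp.mem_support_iff, not_not] at hva ⊢
          simp [Finsupp.add_apply, hva, hvu.symm]
        rw [if_neg hva, if_neg hva']
        simp
    · -- the smallest element is a variable not in `T`
      have hua : u ∈ a.support := (Finset.mem_union.1 hu).resolve_right huT
      rw [Finset.sum_eq_single u]
      · rw [if_pos hua, hy _ u _ (Finset.mem_insert_self _ _), if_pos (hsupp u),
          Finset.erase_insert huT]
        · have hs : koszulSign F T u = 1 := by
            unfold koszulSign
            rw [Finset.filter_eq_empty_iff.2, Finset.card_empty, pow_zero]
            intro w hw
            exact not_lt.2 (hmin w (Finset.mem_union_right _ hw))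
          rw [hs, one_mul, tsub_add_cancel_of_le]
          rw [Finsupp.single_le_iff]
          exact Nat.one_le_iff_ne_zero.2 (by simpa using hua)
        · intro w hw
          rcases Finset.mem_insert.1 hw with rfl | hw
          · exact le_rfl
          · exact hmin w (Finset.mem_union_right _ hw)
      · intro v hv hvu
        have hvT : v ∉ T := by simpa using hv
        by_cases hva : v ∈ a.support
        swap
        · rw [if_neg hva, mul_zero]
        rw [if_pos hva]
        have hlt : u < v := lt_of_le_of_ne (hmin v (Finset.mem_union_left _ hva)) hvu.symm
        have hne' : (insert v T).Nonempty := Finset.insert_nonempty _ _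
        have hmlt : u < (insert v T).min' hne' := by
          rw [Finset.lt_min'_iff]
          intro w hw
          rcases Finset.mem_insert.1 hw with rfl | hw
          · exact hlt
          · exact lt_of_le_of_ne (hmin w (Finset.mem_union_right _ hw))
              (fun h => huT (h ▸ hw))
        rw [hy _ _ _ (Finset.min'_mem _ hne') (fun w hw => Finset.min'_le _ _ hw), if_neg,
          mul_zero]
        intro hall
        refine absurd (hall u ?_) (not_le.2 hmlt)
        simp only [Finsupp.mem_support_iff] at hua ⊢
        simpa [Finsupp.tsub_apply, Finsupp.single_apply, hvu] using hua
      · intro h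
        exact absurd (by simpa using huT) h

theorem koszulExt_of_card {p : ℕ} (x : {T : Finset V // T.card = p} → MvPolynomial V F)
    (T : {T : Finset V // T.card = p}) : koszulExt x T.1 = x T := by
  simp [koszulExt, T.2]

/-- A chain of length `p` without component of multidegree zero is a boundary as soon as it is a
cycle. -/
theorem koszul_boundary (p : ℕ) (x : {T : Finset V // T.card = p} → MvPolynomial V F)
    (hx : koszulD (koszulExt x) = 0) (h0 : coeff 0 (koszulExt x ∅) = 0) :
    ∃ y, (koszulMatrix V F p).mulVec y = x := by
  obtain ⟨y, hy⟩ := koszul_exact (koszulExt x) hx h0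
  refine ⟨fun U => y U.1, ?_⟩
  funext T
  rw [koszulMatrix_mulVec, ← koszulExt_of_card x T, ← hy]
  simp only [koszulD]
  refine Finset.sum_congr rfl fun v hv => ?_
  have hc : (insert v T.1).card = p + 1 := by
    rw [Finset.card_insert_of_notMem (by simpa using hv), T.2]
  simp [koszulExt, hc]

/-- The Koszul complex of the variables, a graded free resolution of the residue field. -/
noncomputable def koszulResolution (V F : Type*) [Fintype V] [LinearOrder V] [Field F] :
    GradedFreeResolution V F where
  ι p := {T : Finset V // T.card = p}
  deg p _ := p
  d := koszulMatrix V F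
  aug _ := 1
  homogeneous p T U := by
    by_cases h : koszulMatrix V F p T U = 0
    · exact Or.inl h
    refine Or.inr ⟨1, rfl, IsHomogeneous.sum _ _ _ fun v _ => ?_⟩
    split_ifs
    · simpa using (isHomogeneous_C V (koszulSign F T.1 v)).mul (isHomogeneous_X F v)
    · exact isHomogeneous_zero _ _ _
  aug_homogeneous _ := Or.inr rfl
  exact_succ p x := by
    constructor
    · intro h
      refine koszul_boundary (p + 1) x ?_ ?_
      · rw [← koszulExt_mulVec, h]
        funext T
        simp [koszulExt]
      · simp [koszulExt]
    · rintro ⟨y, rfl⟩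
      funext T
      rw [koszulMatrix_mulVec, koszulExt_mulVec, koszulD_koszulD]
      rfl
  exact_zero x := by
    have hsum : ∑ a, (1 : F) * constantCoeff (x a) = coeff 0 (koszulExt x ∅) := by
      rw [Fintype.sum_eq_single (⟨∅, rfl⟩ : {T : Finset V // T.card = 0})]
      · simp [koszulExt, constantCoeff_eq]
      · intro T hT
        exact absurd (Subtype.ext (Finset.card_eq_zero.1 T.2)) hT
    rw [hsum]
    constructor
    · intro h
      refine koszul_boundary 0 x ?_ h
      funext T
      refine Finset.sum_eq_zero fun v _ => ?_
      simp [koszulExt]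
    · rintro ⟨y, rfl⟩
      rw [koszulExt_mulVec, coeff_koszulD]
      simp
  aug_surjective c := by
    refine ⟨fun _ => C c, ?_⟩
    rw [Fintype.sum_eq_single (⟨∅, rfl⟩ : {T : Finset V // T.card = 0})]
    · simp
    · intro T hT
      exact absurd (Subtype.ext (Finset.card_eq_zero.1 T.2)) hT

end Koszul

/-! ### Stanley-Reisner rings and their graded Betti numbers -/

section StanleyReisner

/-- The Stanley-Reisner ideal: generated by the squarefree monomials of the non-faces.  (The empty
set is a face of every simplicial complex; Mathlib's convention lists nonempty faces only.) -/
noncomputable def stanleyReisnerIdeal {V : Type*} (F : Type*) [Field F]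
    (Δ : AbstractSimplicialComplex V) : Ideal (MvPolynomial V F) :=
  Ideal.span {f | ∃ T : Finset V, T.Nonempty ∧ T ∉ Δ.faces ∧ f = ∏ v ∈ T, MvPolynomial.X v}

/-- `gradedBetti F Δ i k` is `β_{i,k}(F[Δ]) = dim_F Tor_i^S(F[Δ], F)_k`, where
`S = F[x_v : v ∈ V]` and `F[Δ] = S / I_Δ`. -/
noncomputable def gradedBetti {V : Type*} [Fintype V] [LinearOrder V] (F : Type*) [Field F]
    (Δ : AbstractSimplicialComplex V) (i k : ℕ) : ℕ :=
  Module.finrank F (GradedTor (koszulResolution V F) (stanleyReisnerIdeal F Δ) i k)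

end StanleyReisner

/-! ### Stacked cross-polytopal spheres -/

section Stacked

/-- The boundary complex `C_d` of the `d`-dimensional cross-polytope, the join of the `d` pairs of
disconnected vertices `(i, true)`, `(i, false)`. -/
def crossPolytope (d : ℕ) : AbstractSimplicialComplex (Fin d × Bool) where
  faces := {T | T.Nonempty ∧ ∀ i, ¬ ((i, true) ∈ T ∧ (i, false) ∈ T)}
  isRelLowerSet_faces := fun _ hT =>
    ⟨hT.1, fun _ hle hne => ⟨hne, fun i h => hT.2 i ⟨hle h.1, hle h.2⟩⟩⟩
  singleton_mem := fun v => ⟨Finset.singleton_nonempty v, fun i h => by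
    have h1 := Finset.mem_singleton.1 h.1
    have h2 := Finset.mem_singleton.1 h.2
    exact absurd (h1.trans h2.symm) (by simp)⟩

/-- A facet is an inclusion-maximal face. -/
def IsFacet {V : Type*} (K : PreAbstractSimplicialComplex V) (G : Finset V) : Prop :=
  Maximal (· ∈ K.faces) G

/-- `Δ` is a connected sum of `K` and `L`.  The two complexes are given after the vertices of the
chosen facets have been identified by the chosen bijection: they share exactly the vertices of the
common facet `G`, which is then removed from both. -/
def IsConnectedSum {V : Type*} (Δ K L : PreAbstractSimplicialComplex V) : Prop :=
  ∃ G : Finset V, IsFacet K G ∧ IsFacet L G ∧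
    (∀ v, {v} ∈ K.faces → {v} ∈ L.faces → v ∈ G) ∧
    Δ.faces = (K.faces \ {G}) ∪ (L.faces \ {G})

/-- `IsStackedSum d m Δ`: the complex `Δ` is obtained via the connected sum of `m` copies of the
boundary complex of the `d`-dimensional cross-polytope. -/
inductive IsStackedSum {V : Type*} [DecidableEq V] (d : ℕ) :
    ℕ → PreAbstractSimplicialComplex V → Prop
  | single (e : Fin d × Bool ↪ V) :
      IsStackedSum d 1 ((crossPolytope d).toPreAbstractSimplicialComplex.map e)
  | sum {m : ℕ} {Γ Δ : PreAbstractSimplicialComplex V} (e : Fin d × Bool ↪ V)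
      (hΓ : IsStackedSum d m Γ)
      (hΔ : IsConnectedSum Δ Γ ((crossPolytope d).toPreAbstractSimplicialComplex.map e)) :
      IsStackedSum d (m + 1) Δ

/-- The set `ST^×(n, d)` of stacked cross-polytopal `(d-1)`-spheres on the `n` vertices `Fin n`:
here `n = k d` with `k ≥ 2`, and the sphere is a connected sum of `k - 1` copies of `C_d`. -/
def ST (n d : ℕ) : Set (AbstractSimplicialComplex (Fin n)) :=
  {Δ | ∃ k, 2 ≤ k ∧ n = k * d ∧ IsStackedSum d (k - 1) Δ.toPreAbstractSimplicialComplex}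

end Stacked

end Betti

/-! By Hochster's formula (`gradedBetti_eq_sum`), $\beta_{i,i+j}(\mathbb F[\Delta])$ is the sum of
$\dim\tilde H^{j-1}(\Delta_W;\mathbb F)$ over the vertex sets $W$ with $|W|=i+j$. It therefore
suffices to understand how the cohomology of induced subcomplexes changes under one connected sum
$\Delta=\Gamma\# C$ with a cross-polytope $C$ along a facet $G$. Let $N$ be the set of the $d$ new
vertices; $\Gamma$ has $n-2d$ vertices outside $G$.

The complexes $\Gamma_W$ and $C_W$ meet in the simplex on $W\cap G$, and $\Delta_W$ is their union,
with the cell $G$ removed if $G\subseteq W$. Hence, for $1\le j<d$, the dimension for $\Delta_W$ is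
the sum of those for $\Gamma_W$ and $C_W$ with two corrections (`Gluing.cohomDim_induced`): one
extra class for $j=1$ if $W$ misses $G$ but meets both vertex sets, because the union is then
disjoint; and one extra class for $j=d-1$ if $W$ contains $G$ but neither whole vertex set, because
removing the cell $G$ then opens a hole.

Summing over $W$ gives the recursion (`Gluing.bettiSum_eq`). For the part from $\Gamma$, write
$W=U\cup T$ with $T\subseteq N$: the $\ell=|T|$ new vertices do not affect $\Gamma_W$, whence the
sum with weights $\binom d\ell$. The complex $C_W$ has cohomology in degree $j-1$ only if $W$ meets
$C$ in exactly $j$ antipodal pairs, and the rest of $W$ is arbitrary among $n-2d$ vertices; this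
gives $\binom dj\binom{n-2d}{i-j}$. The disconnected sets $W$ give the last sum of the row $j=1$,
and the facet correction only concerns the row $j=d-1$. The rows $j\le 0$ and $j\ge d$ are known
because $\Delta$ behaves like a homology sphere (`IsHomologySphere`, preserved by
`Gluing.isHomologySphere`). By induction on the number of copies, every entry is a number determined
by $n$ and $d$.

The cohomology used is that of an arbitrary convex family of finite sets, graded by cardinality, so
that cardinality $q$ stands for simplicial degree $q-1$. This covers complexes, complexes with cells
removed, and the multigraded strands of the Koszul complex alike. Long exact sequences are replaced
by two tools: a family stable under toggling one vertex is acyclic (`acyclic_of_toggle`), and an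
acyclic lower part may be discarded (`LowerSplit.cohomDim_eq_of_acyclic`). -/

namespace Betti

/-! ### Cohomology of convex families of finite sets -/

section Cochains

set_option linter.unusedSectionVars false

variable {V F : Type*} [LinearOrder V] [Field F]

/-- The sign of `σ.erase v` in the coboundary at `σ`. -/
def incidence (F : Type*) [Field F] (σ : Finset V) (v : V) : F :=
  (-1) ^ (σ.filter (· < v)).card

theorem incidence_mul_self (σ : Finset V) (v : V) :
    incidence F σ v * incidence F σ v = 1 := by
  unfold incidence
  rw [← mul_pow]; simp

theorem incidence_erase_of_lt {σ : Finset V} {u v : V} (hu : u ∈ σ) (h : u < v) :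
    incidence F (σ.erase u) v = - incidence F σ v := by
  unfold incidence
  rw [Finset.filter_erase, ← Finset.card_erase_add_one (s := σ.filter (· < v)) (a := u)
    (by simp [hu, h]), pow_succ]
  ring

theorem incidence_erase_of_gt (σ : Finset V) {u v : V} (h : v < u) :
    incidence F (σ.erase u) v = incidence F σ v := by
  unfold incidence
  rw [Finset.filter_erase, Finset.erase_eq_of_notMem (by simp [h.le])]

/-- Deleting the smaller element lowers the position of the larger one by one, while deleting the
larger leaves the smaller in place; so exactly one sign changes. This is the cancellation behind
$\delta^2=0$. -/
theorem incidence_erase {σ : Finset V} {u v : V} (hu : u ∈ σ) (hv : v ∈ σ) (huv : u ≠ v) :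
    incidence F σ u * incidence F (σ.erase u) v =
      -(incidence F σ v * incidence F (σ.erase v) u) := by
  rcases lt_or_gt_of_ne huv with h | h
  · rw [incidence_erase_of_lt hu h, incidence_erase_of_gt σ h]; ring
  · rw [incidence_erase_of_lt hv h, incidence_erase_of_gt σ h]; ring

open Classical in
/-- The coboundary of the family `P`. -/
noncomputable def coboundary (F : Type*) [Field F] (P : Set (Finset V)) :
    (Finset V → F) →ₗ[F] (Finset V → F) where
  toFun x σ := if σ ∈ P then ∑ v ∈ σ, incidence F σ v * x (σ.erase v) else 0
  map_add' x y := by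
    funext σ
    by_cases h : σ ∈ P <;> simp [h, mul_add, Finset.sum_add_distrib]
  map_smul' c x := by
    funext σ
    by_cases h : σ ∈ P <;> simp [h, Finset.mul_sum, mul_left_comm]

theorem coboundary_of_mem {P : Set (Finset V)} {σ : Finset V} (h : σ ∈ P) (x : Finset V → F) :
    coboundary F P x σ = ∑ v ∈ σ, incidence F σ v * x (σ.erase v) := by
  simp [coboundary, h]

theorem coboundary_of_notMem {P : Set (Finset V)} {σ : Finset V} (h : σ ∉ P)
    (x : Finset V → F) : coboundary F P x σ = 0 := by
  simp [coboundary, h]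

/-- Cochains of the family `P` supported on sets of cardinality `q`. -/
def cochains (F : Type*) [Field F] (P : Set (Finset V)) (q : ℤ) :
    Submodule F (Finset V → F) where
  carrier := {x | ∀ σ, x σ ≠ 0 → σ ∈ P ∧ (σ.card : ℤ) = q}
  zero_mem' σ h := absurd rfl h
  add_mem' {x y} hx hy σ h := by
    by_cases h' : x σ = 0
    · exact hy σ fun h'' => h (by simp [h', h''])
    · exact hx σ h'
  smul_mem' c x hx σ h := hx σ fun h' => h (by simp [h'])

theorem cochains_eq_zero {P : Set (Finset V)} {q : ℤ} {x : Finset V → F}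
    (hx : x ∈ cochains F P q) {σ : Finset V} (h : σ ∉ P) : x σ = 0 := by
  by_contra h'; exact h (hx σ h').1

theorem cochains_mono {P Q : Set (Finset V)} (h : P ⊆ Q) (q : ℤ) :
    cochains F P q ≤ cochains F Q q := fun _ hx σ hσ => ⟨h (hx σ hσ).1, (hx σ hσ).2⟩

/-- Cocycles of the family `P`. -/
noncomputable def cocycles (F : Type*) [Field F] (P : Set (Finset V)) (q : ℤ) :
    Submodule F (Finset V → F) :=
  cochains F P q ⊓ LinearMap.ker (coboundary F P)

/-- Coboundaries of the family `P`. -/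
noncomputable def coboundaries (F : Type*) [Field F] (P : Set (Finset V)) (q : ℤ) :
    Submodule F (Finset V → F) :=
  (cochains F P (q - 1)).map (coboundary F P)

/-- The dimension of the cohomology of the family `P` in cardinality `q`. -/
noncomputable def cohomDim (F : Type*) [Field F] (P : Set (Finset V)) (q : ℤ) : ℕ :=
  Module.finrank F (cocycles F P q) - Module.finrank F (coboundaries F P q)

/-- The cohomology of the family `P` vanishes. -/
def Acyclic (F : Type*) [Field F] (P : Set (Finset V)) : Prop :=
  ∀ q, cocycles F P q ≤ coboundaries F P q

theorem coboundary_mem_cochains (P : Set (Finset V)) {q : ℤ} {x : Finset V → F}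
    (hx : x ∈ cochains F P (q - 1)) : coboundary F P x ∈ cochains F P q := by
  intro σ hσ
  have hP : σ ∈ P := by
    by_contra h; exact hσ (coboundary_of_notMem h x)
  refine ⟨hP, ?_⟩
  rw [coboundary_of_mem hP] at hσ
  obtain ⟨v, hv, hne⟩ := Finset.exists_ne_zero_of_sum_ne_zero hσ
  have := (hx _ (right_ne_zero_of_mul hne)).2
  have h2 := Finset.card_erase_add_one hv
  omega

/-- The usual pairwise cancellation needs both intermediate sets between $\sigma\setminus\{u,v\}$
and $\sigma$ to be present. Convexity provides them whenever the two ends lie in `P`; otherwise the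
cochain vanishes at the lower end. -/
theorem coboundary_coboundary {P : Set (Finset V)} (hP : P.OrdConnected) {q : ℤ}
    {x : Finset V → F} (hx : x ∈ cochains F P q) : coboundary F P (coboundary F P x) = 0 := by
  funext σ
  by_cases hσ : σ ∈ P
  swap
  · exact coboundary_of_notMem hσ _
  rw [coboundary_of_mem hσ]
  have key : ∀ v ∈ σ, incidence F σ v * coboundary F P x (σ.erase v) =
      ∑ u ∈ σ.erase v, incidence F σ v * (incidence F (σ.erase v) u *
        x ((σ.erase v).erase u)) := by
    intro v _
    by_cases h : σ.erase v ∈ P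
    · rw [coboundary_of_mem h, Finset.mul_sum]
    · rw [coboundary_of_notMem h, mul_zero, Finset.sum_eq_zero]
      intro u _
      rw [cochains_eq_zero hx, mul_zero, mul_zero]
      exact fun h' => h (hP.out h' hσ ⟨Finset.erase_subset _ _, Finset.erase_subset _ _⟩)
  rw [Finset.sum_congr rfl key, Finset.sum_sigma']
  refine Finset.sum_involution (fun a _ => ⟨a.2, a.1⟩) ?_ ?_ ?_ ?_
  · rintro ⟨u, v⟩ h
    simp only [Finset.mem_sigma, Finset.mem_erase] at h
    dsimp only
    rw [Finset.erase_right_comm, ← mul_assoc, ← mul_assoc, incidence_erase h.1 h.2.2 (Ne.symm h.2.1)]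
    ring
  · rintro ⟨u, v⟩ h _ heq
    simp only [Finset.mem_sigma, Finset.mem_erase] at h
    exact h.2.1 (congrArg Sigma.fst heq)
  · rintro ⟨u, v⟩ h
    simp only [Finset.mem_sigma, Finset.mem_erase] at h ⊢
    exact ⟨h.2.2, Ne.symm h.2.1, h.1⟩
  · rintro ⟨u, v⟩ h
    rfl

theorem coboundaries_le_cocycles {P : Set (Finset V)} (hP : P.OrdConnected) (q : ℤ) :
    coboundaries F P q ≤ cocycles F P q := by
  rintro _ ⟨x, hx, rfl⟩
  exact ⟨coboundary_mem_cochains P hx, coboundary_coboundary hP hx⟩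

/-- A family which is stable under adding and removing a fixed element is acyclic. -/
theorem acyclic_of_toggle {P : Set (Finset V)} (v : V)
    (h : ∀ σ, v ∉ σ → (insert v σ ∈ P ↔ σ ∈ P)) : Acyclic F P := by
  rintro q x ⟨hx, hd⟩
  have hd : coboundary F P x = 0 := hd
  -- The cone contraction with apex `v`, applied to the cocycle, is a primitive.
  refine ⟨fun σ => if v ∈ σ then 0 else incidence F (insert v σ) v * x (insert v σ), ?_, ?_⟩
  · intro σ hσ
    have hv : v ∉ σ := fun hv => hσ (by simp [hv])
    simp only [if_neg hv] at hσ
    obtain ⟨h1, h2⟩ := hx _ (right_ne_zero_of_mul hσ)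
    refine ⟨(h σ hv).1 h1, ?_⟩
    rw [Finset.card_insert_of_notMem hv] at h2
    push_cast at h2
    omega
  · funext σ
    by_cases hσ : σ ∈ P
    swap
    · rw [coboundary_of_notMem hσ, cochains_eq_zero hx hσ]
    rw [coboundary_of_mem hσ]
    by_cases hv : v ∈ σ
    · rw [Finset.sum_eq_single v]
      · simp only [Finset.notMem_erase, if_false, Finset.insert_erase hv]
        rw [← mul_assoc, incidence_mul_self, one_mul]
      · intro u _ huv
        simp [Finset.mem_erase, hv, huv.symm]
      · exact fun h' => absurd hv h'
    -- For `v ∉ σ` the identity comes from the cocycle condition at `insert v σ`, solved for `x σ`.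
    · have hi := (h σ hv).2 hσ
      have h0 := congrFun hd (insert v σ)
      rw [coboundary_of_mem hi, Finset.sum_insert hv, Finset.erase_insert hv] at h0
      have h1 : x σ = - (incidence F (insert v σ) v * ∑ u ∈ σ, incidence F (insert v σ) u *
          x ((insert v σ).erase u)) := by
        rw [Pi.zero_apply] at h0
        linear_combination incidence F (insert v σ) v * h0 -
          x σ * incidence_mul_self (F := F) (insert v σ) v
      rw [h1, Finset.mul_sum, ← Finset.sum_neg_distrib]
      refine Finset.sum_congr rfl fun u hu => ?_
      have huv : u ≠ v := fun e => hv (e ▸ hu)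
      rw [if_neg (by simp [hv]), ← Finset.erase_insert_of_ne huv.symm]
      have e := incidence_erase (F := F) (Finset.mem_insert_of_mem hu)
        (Finset.mem_insert_self v σ) huv
      rw [Finset.erase_insert hv] at e
      have e4 := incidence_mul_self (F := F) ((insert v σ).erase u) v
      have e3 := incidence_mul_self (F := F) (insert v σ) v
      set a := incidence F (insert v σ) u
      set b := incidence F (insert v σ) v
      set c := incidence F ((insert v σ).erase u) v
      set s := incidence F σ u
      have : s * c = - (b * a) := by
        linear_combination c * b * e - c * s * e3 - b * a * e4
      linear_combination x ((insert v σ).erase u) * this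

end Cochains

/-! ### Splitting a family into a lower and an upper part. -/

section Cohomology

set_option linter.unusedSectionVars false

/-- Rank–nullity on a subspace. Applied once to cocycles and once to coboundaries, it does the work
of a long exact sequence after subtraction. -/
theorem finrank_eq_finrank_map_add {F M N : Type*} [Field F] [AddCommGroup M] [Module F M]
    [AddCommGroup N] [Module F N] [FiniteDimensional F M] (W : Submodule F M) (f : M →ₗ[F] N) :
    Module.finrank F W = Module.finrank F (W.map f) +
      Module.finrank F (W ⊓ LinearMap.ker f : Submodule F M) := by
  rw [← LinearMap.finrank_range_add_finrank_ker (f.domRestrict W), LinearMap.range_domRestrict]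
  have : LinearMap.ker (f.domRestrict W) = (W ⊓ LinearMap.ker f).submoduleOf W := by
    ext x
    simp [Submodule.submoduleOf]
  rw [this, LinearEquiv.finrank_eq (Submodule.submoduleOfEquivOfLe
    (inf_le_left : W ⊓ LinearMap.ker f ≤ W))]

variable {V F : Type*} [LinearOrder V] [Fintype V] [Field F]

open Classical in
/-- Restriction of cochains to the family `Q`. -/
noncomputable def restrictTo (F : Type*) [Field F] (Q : Set (Finset V)) :
    (Finset V → F) →ₗ[F] (Finset V → F) where
  toFun x σ := if σ ∈ Q then x σ else 0
  map_add' x y := by funext σ; by_cases h : σ ∈ Q <;> simp [h]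
  map_smul' c x := by funext σ; by_cases h : σ ∈ Q <;> simp [h]

theorem restrictTo_of_mem {Q : Set (Finset V)} {σ : Finset V} (h : σ ∈ Q) (x : Finset V → F) :
    restrictTo F Q x σ = x σ := by simp [restrictTo, h]

theorem restrictTo_of_notMem {Q : Set (Finset V)} {σ : Finset V} (h : σ ∉ Q) (x : Finset V → F) :
    restrictTo F Q x σ = 0 := by simp [restrictTo, h]

theorem restrictTo_eq_self {Q : Set (Finset V)} {q : ℤ} {x : Finset V → F}
    (hx : x ∈ cochains F Q q) : restrictTo F Q x = x := by
  funext σ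
  by_cases h : σ ∈ Q
  · rw [restrictTo_of_mem h]
  · rw [restrictTo_of_notMem h, cochains_eq_zero hx h]

theorem restrictTo_mem_cochains {P Q : Set (Finset V)} {q : ℤ} {x : Finset V → F}
    (hx : x ∈ cochains F P q) : restrictTo F Q x ∈ cochains F Q q := by
  intro σ hσ
  have h : σ ∈ Q := by by_contra h; exact hσ (restrictTo_of_notMem h x)
  rw [restrictTo_of_mem h] at hσ
  exact ⟨h, (hx σ hσ).2⟩

/-- The disjoint decomposition of a convex family `P` into a lower part `Q` and an upper
part `R`. -/
structure LowerSplit (P Q R : Set (Finset V)) : Prop where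
  convex : P.OrdConnected
  union : ∀ σ, σ ∈ P ↔ σ ∈ Q ∨ σ ∈ R
  lower : ∀ σ ∈ R, ∀ τ ∈ Q, ¬ σ ⊆ τ

namespace LowerSplit

variable {P Q R : Set (Finset V)}

theorem left_subset (h : LowerSplit P Q R) : Q ⊆ P := fun σ hσ => (h.union σ).2 (Or.inl hσ)

theorem right_subset (h : LowerSplit P Q R) : R ⊆ P := fun σ hσ => (h.union σ).2 (Or.inr hσ)

theorem notMem_left (h : LowerSplit P Q R) {σ : Finset V} (hσ : σ ∈ R) : σ ∉ Q :=
  fun hQ => h.lower σ hσ σ hQ subset_rfl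

theorem convex_left (h : LowerSplit P Q R) : Q.OrdConnected := by
  refine ⟨fun σ hσ τ hτ ρ hρ => ?_⟩
  exact ((h.union ρ).1 (h.convex.out (h.left_subset hσ) (h.left_subset hτ) hρ)).resolve_right
    fun hR => h.lower ρ hR τ hτ hρ.2

theorem convex_right (h : LowerSplit P Q R) : R.OrdConnected := by
  refine ⟨fun σ hσ τ hτ ρ hρ => ?_⟩
  exact ((h.union ρ).1 (h.convex.out (h.right_subset hσ) (h.right_subset hτ) hρ)).resolve_left
    fun hQ => h.lower σ hσ ρ hQ hρ.1

/-- No subset of a set in `Q` lies in `R`, so the values on `Q` determine the coboundary on `Q`: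
cochains of `Q` form a quotient complex. -/
theorem restrict_coboundary (h : LowerSplit P Q R) {q : ℤ} {x : Finset V → F}
    (hx : x ∈ cochains F P q) :
    restrictTo F Q (coboundary F P x) = coboundary F Q (restrictTo F Q x) := by
  funext σ
  by_cases hσ : σ ∈ Q
  swap
  · rw [restrictTo_of_notMem hσ, coboundary_of_notMem hσ]
  rw [restrictTo_of_mem hσ, coboundary_of_mem hσ, coboundary_of_mem (h.left_subset hσ)]
  refine Finset.sum_congr rfl fun v _ => ?_
  by_cases hv : σ.erase v ∈ Q
  · rw [restrictTo_of_mem hv]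
  · rw [restrictTo_of_notMem hv, cochains_eq_zero hx]
    intro hP
    rcases (h.union _).1 hP with hQ | hR
    · exact hv hQ
    · exact h.lower _ hR _ hσ (Finset.erase_subset _ _)

/-- Dually, cochains of `R` form a subcomplex, the kernel of restriction to `Q`. -/
theorem coboundary_right (h : LowerSplit P Q R) {q : ℤ} {x : Finset V → F}
    (hx : x ∈ cochains F R q) : coboundary F P x = coboundary F R x := by
  funext σ
  by_cases hσ : σ ∈ R
  · rw [coboundary_of_mem hσ, coboundary_of_mem (h.right_subset hσ)]
  rw [coboundary_of_notMem hσ]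
  by_cases hP : σ ∈ P
  swap
  · rw [coboundary_of_notMem hP]
  rw [coboundary_of_mem hP]
  refine Finset.sum_eq_zero fun v _ => ?_
  rw [cochains_eq_zero hx, mul_zero]
  exact fun hR => h.lower _ hR _ (((h.union σ).1 hP).resolve_right hσ) (Finset.erase_subset _ _)

theorem mem_cochains_right (h : LowerSplit P Q R) {q : ℤ} {x : Finset V → F} :
    x ∈ cochains F R q ↔ x ∈ cochains F P q ∧ restrictTo F Q x = 0 := by
  constructor
  · refine fun hx => ⟨cochains_mono h.right_subset q hx, ?_⟩
    funext σ
    by_cases hσ : σ ∈ Q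
    · rw [restrictTo_of_mem hσ, cochains_eq_zero hx fun hR => h.notMem_left hR hσ]; rfl
    · rw [restrictTo_of_notMem hσ]; rfl
  · rintro ⟨hx, h0⟩ σ hσ
    obtain ⟨hP, hc⟩ := hx σ hσ
    refine ⟨((h.union σ).1 hP).resolve_left fun hQ => hσ ?_, hc⟩
    rw [← restrictTo_of_mem hQ x, h0]; rfl

theorem cocycles_inf_ker (h : LowerSplit P Q R) (q : ℤ) :
    cocycles F P q ⊓ LinearMap.ker (restrictTo F Q) = cocycles F R q := by
  ext x
  simp only [cocycles, Submodule.mem_inf, LinearMap.mem_ker]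
  constructor
  · rintro ⟨⟨h1, h2⟩, h3⟩
    have h4 := h.mem_cochains_right.2 ⟨h1, h3⟩
    exact ⟨h4, by rw [← h.coboundary_right h4, h2]⟩
  · rintro ⟨h1, h2⟩
    obtain ⟨h3, h4⟩ := h.mem_cochains_right.1 h1
    exact ⟨⟨h3, by rw [h.coboundary_right h1, h2]⟩, h4⟩

theorem map_cocycles_le (h : LowerSplit P Q R) (q : ℤ) :
    (cocycles F P q).map (restrictTo F Q) ≤ cocycles F Q q := by
  rintro _ ⟨x, ⟨hx, hd⟩, rfl⟩
  refine ⟨restrictTo_mem_cochains hx, ?_⟩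
  rw [SetLike.mem_coe, LinearMap.mem_ker, ← h.restrict_coboundary hx, LinearMap.mem_ker.1 hd,
    map_zero]

theorem map_coboundaries (h : LowerSplit P Q R) (q : ℤ) :
    (coboundaries F P q).map (restrictTo F Q) = coboundaries F Q q := by
  apply le_antisymm
  · rintro _ ⟨_, ⟨x, hx, rfl⟩, rfl⟩
    exact ⟨restrictTo F Q x, restrictTo_mem_cochains hx, (h.restrict_coboundary hx).symm⟩
  · rintro _ ⟨x, hx, rfl⟩
    have hx' := cochains_mono (F := F) h.left_subset _ hx
    refine ⟨coboundary F P x, ⟨x, hx', rfl⟩, ?_⟩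
    rw [h.restrict_coboundary hx', restrictTo_eq_self hx]

/-- Removing an acyclic lower part does not change the cohomology. -/
theorem cohomDim_eq_of_acyclic (h : LowerSplit P Q R) (hQ : Acyclic F Q) (q : ℤ) :
    cohomDim F P q = cohomDim F R q := by
  have hZ : (cocycles F P q).map (restrictTo F Q) = coboundaries F Q q := by
    apply le_antisymm ((h.map_cocycles_le q).trans (hQ q))
    rw [← h.map_coboundaries]
    exact Submodule.map_mono (coboundaries_le_cocycles h.convex q)
  have hB : coboundaries F P q ⊓ LinearMap.ker (restrictTo F Q) = coboundaries F R q := by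
    apply le_antisymm
    · rintro _ ⟨⟨y, hy, rfl⟩, h0⟩
      rw [SetLike.mem_coe, LinearMap.mem_ker, h.restrict_coboundary hy] at h0
      -- Acyclicity of `Q` makes the restriction of `y` a coboundary. Subtracting the coboundary of
      -- `w` extended by zero moves `y` into the cochains of `R` without changing its own
      -- coboundary.
      obtain ⟨w, hw, hwy⟩ := hQ (q - 1) ⟨restrictTo_mem_cochains hy, h0⟩
      have hw' := cochains_mono (F := F) h.left_subset _ hw
      have hz : y - coboundary F P w ∈ cochains F R (q - 1) := by
        refine h.mem_cochains_right.2
          ⟨Submodule.sub_mem _ hy (coboundary_mem_cochains P hw'), ?_⟩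
        rw [map_sub, h.restrict_coboundary hw', restrictTo_eq_self hw, hwy, sub_self]
      refine ⟨_, hz, ?_⟩
      rw [← h.coboundary_right hz, map_sub, coboundary_coboundary h.convex hw', sub_zero]
    · rintro _ ⟨y, hy, rfl⟩
      refine ⟨⟨y, cochains_mono h.right_subset _ hy, h.coboundary_right hy⟩, ?_⟩
      exact (h.mem_cochains_right.1 (coboundary_mem_cochains R hy)).2
  have e1 := finrank_eq_finrank_map_add (cocycles F P q) (restrictTo F Q)
  have e2 := finrank_eq_finrank_map_add (coboundaries F P q) (restrictTo F Q)
  rw [hZ, h.cocycles_inf_ker] at e1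
  rw [h.map_coboundaries, hB] at e2
  unfold cohomDim
  omega

/-- The cohomology of a family without incidences between its two parts. -/
theorem cohomDim_eq_add (h : LowerSplit P Q R) (h' : LowerSplit P R Q) (q : ℤ) :
    cohomDim F P q = cohomDim F Q q + cohomDim F R q := by
  have hZ : (cocycles F P q).map (restrictTo F Q) = cocycles F Q q := by
    apply le_antisymm (h.map_cocycles_le q)
    rintro x ⟨hx, hd⟩
    exact ⟨x, ⟨cochains_mono h.left_subset _ hx,
      LinearMap.mem_ker.2 ((h'.coboundary_right hx).trans hd)⟩, restrictTo_eq_self hx⟩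
  have hB : coboundaries F P q ⊓ LinearMap.ker (restrictTo F Q) = coboundaries F R q := by
    apply le_antisymm
    · rintro _ ⟨⟨y, hy, rfl⟩, h0⟩
      refine ⟨restrictTo F R y, restrictTo_mem_cochains hy, ?_⟩
      rw [← h'.restrict_coboundary hy]
      exact restrictTo_eq_self (h.mem_cochains_right.2 ⟨coboundary_mem_cochains P hy, h0⟩)
    · rintro _ ⟨y, hy, rfl⟩
      refine ⟨⟨y, cochains_mono h.right_subset _ hy, h.coboundary_right hy⟩, ?_⟩
      exact (h.mem_cochains_right.1 (coboundary_mem_cochains R hy)).2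
  have e1 := finrank_eq_finrank_map_add (cocycles F P q) (restrictTo F Q)
  have e2 := finrank_eq_finrank_map_add (coboundaries F P q) (restrictTo F Q)
  rw [hZ, h.cocycles_inf_ker] at e1
  rw [h.map_coboundaries, hB] at e2
  have l1 := Submodule.finrank_mono (coboundaries_le_cocycles (F := F) h.convex_left q)
  have l2 := Submodule.finrank_mono (coboundaries_le_cocycles (F := F) h.convex_right q)
  unfold cohomDim
  omega

end LowerSplit

theorem cohomDim_eq_zero_of_le {P : Set (Finset V)} {q : ℤ}
    (h : cocycles F P q ≤ coboundaries F P q) : cohomDim F P q = 0 := by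
  have := Submodule.finrank_mono h
  unfold cohomDim
  omega

/-- `cohomDim` is a truncated difference, so its vanishing alone only bounds the rank of cocycles;
convexity supplies the opposite inclusion. -/
theorem cocycles_le_of_cohomDim_eq_zero {P : Set (Finset V)} (hP : P.OrdConnected) {q : ℤ}
    (h : cohomDim F P q = 0) : cocycles F P q ≤ coboundaries F P q := by
  have hle := coboundaries_le_cocycles (F := F) hP q
  refine (Submodule.eq_of_le_of_finrank_le hle ?_).ge
  unfold cohomDim at h
  omega

theorem Acyclic.cohomDim_eq_zero {P : Set (Finset V)} (h : Acyclic F P) (q : ℤ) :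
    cohomDim F P q = 0 := cohomDim_eq_zero_of_le (h q)

theorem acyclic_iff {P : Set (Finset V)} (hP : P.OrdConnected) :
    Acyclic F P ↔ ∀ q, cohomDim F P q = 0 :=
  ⟨fun h q => h.cohomDim_eq_zero q, fun h q => cocycles_le_of_cohomDim_eq_zero hP (h q)⟩

theorem cohomDim_eq_zero_of_card_ne {P : Set (Finset V)} {q : ℤ}
    (h : ∀ σ ∈ P, (σ.card : ℤ) ≠ q) : cohomDim F P q = 0 := by
  refine cohomDim_eq_zero_of_le ?_
  rintro x ⟨hx, _⟩
  have : x = 0 := by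
    funext σ
    by_contra h'
    exact h σ (hx σ h').1 (hx σ h').2
  rw [this]
  exact zero_mem _

theorem cohomDim_empty (q : ℤ) : cohomDim F (∅ : Set (Finset V)) q = 0 :=
  cohomDim_eq_zero_of_card_ne fun _ h => h.elim

theorem coboundary_eq_zero_of_card {P : Set (Finset V)} {q : ℤ}
    (h : ∀ σ ∈ P, (σ.card : ℤ) ≠ q + 1) {x : Finset V → F} (hx : x ∈ cochains F P q) :
    coboundary F P x = 0 := by
  have h1 : coboundary F P x ∈ cochains F P (q + 1) :=
    coboundary_mem_cochains P (by simpa using hx)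
  funext σ
  by_contra h'
  exact h σ (h1 σ h').1 (h1 σ h').2

theorem cochains_singleton (τ : Finset V) :
    cochains F {τ} (τ.card : ℤ) = Submodule.span F {Pi.single τ 1} := by
  ext x
  rw [Submodule.mem_span_singleton]
  constructor
  · intro hx
    refine ⟨x τ, ?_⟩
    funext σ
    by_cases h : σ = τ
    · subst h; simp
    · rw [cochains_eq_zero hx (show σ ∉ ({τ} : Set (Finset V)) from h)]; simp [h]
  · rintro ⟨a, rfl⟩ σ hσ
    by_cases h : σ = τ
    · subst h; simp
    · simp [h] at hσ

theorem cohomDim_singleton (τ : Finset V) (q : ℤ) :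
    cohomDim F {τ} q = if (τ.card : ℤ) = q then 1 else 0 := by
  split_ifs with h
  swap
  · exact cohomDim_eq_zero_of_card_ne (by simpa using h)
  subst h
  have hZ : cocycles F {τ} (τ.card : ℤ) = cochains F {τ} (τ.card : ℤ) := by
    refine inf_eq_left.2 fun x hx => coboundary_eq_zero_of_card ?_ hx
    rintro _ rfl; omega
  have hB : coboundaries F {τ} (τ.card : ℤ) = ⊥ := by
    rw [eq_bot_iff]
    rintro _ ⟨x, hx, rfl⟩
    have : x = 0 := by
      funext σ
      by_contra h'
      obtain ⟨h1, h2⟩ := hx σ h'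
      obtain rfl : σ = τ := h1
      omega
    rw [this, map_zero]
    exact zero_mem _
  unfold cohomDim
  rw [hZ, hB, finrank_bot, cochains_singleton, finrank_span_singleton]
  simp

end Cohomology

/-! ### Removing the empty set or one cell of top dimension. -/

section SingleCell

set_option linter.unusedSectionVars false

variable {V F : Type*} [LinearOrder V] [Fintype V] [Field F] {P : Set (Finset V)}

theorem cochains_diff_singleton {τ : Finset V} {q : ℤ} (hq : (τ.card : ℤ) ≠ q) :
    cochains F (P \ {τ}) q = cochains F P q := by
  refine le_antisymm (cochains_mono Set.sdiff_subset q) fun x hx σ hσ => ?_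
  refine ⟨⟨(hx σ hσ).1, ?_⟩, (hx σ hσ).2⟩
  rintro rfl
  exact hq (hx _ hσ).2

theorem coboundary_diff_empty : coboundary F (P \ {∅}) = coboundary F P := by
  refine LinearMap.ext fun x => funext fun σ => ?_
  by_cases h : σ = ∅
  · subst h
    rw [coboundary_of_notMem (by simp)]
    by_cases h' : ∅ ∈ P
    · rw [coboundary_of_mem h', Finset.sum_empty]
    · rw [coboundary_of_notMem h']
  · by_cases h' : σ ∈ P
    · rw [coboundary_of_mem h', coboundary_of_mem (show σ ∈ P \ {∅} from ⟨h', h⟩)]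
    · rw [coboundary_of_notMem h', coboundary_of_notMem fun h'' => h' h''.1]

/-- The empty set only enters the cochains in cardinality 0 and the coboundaries in cardinality 1.
Removing it is the passage from reduced to unreduced cohomology. -/
theorem cohomDim_diff_empty_of_ne {q : ℤ} (h0 : q ≠ 0) (h1 : q ≠ 1) :
    cohomDim F (P \ {∅}) q = cohomDim F P q := by
  unfold cohomDim cocycles coboundaries
  rw [coboundary_diff_empty, cochains_diff_singleton (by simpa using h0.symm),
    cochains_diff_singleton (by simp; omega)]

theorem coboundary_single_empty_ne_zero {v : V} (hv : {v} ∈ P) :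
    coboundary F P (Pi.single ∅ 1) ≠ 0 := by
  intro h
  have := congrFun h {v}
  rw [coboundary_of_mem hv, Finset.sum_singleton] at this
  simp [incidence] at this

theorem cochains_zero_eq_span (h : ∅ ∈ P) :
    cochains F P 0 = Submodule.span F {Pi.single ∅ 1} := by
  have e := cochains_singleton (F := F) (∅ : Finset V)
  rw [← e]
  refine le_antisymm (fun x hx σ hσ => ?_) (cochains_mono (by simpa using h) _)
  have := (hx σ hσ).2
  have h0 : σ = ∅ := by simpa using this
  exact ⟨h0, by simp [h0]⟩

/-- Removing the empty set from a nonvoid complex increases the cohomology in cardinality one. -/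
theorem cohomDim_diff_empty (hP : P.OrdConnected) (h : ∅ ∈ P) {v : V} (hv : {v} ∈ P) :
    cohomDim F (P \ {∅}) 1 = cohomDim F P 1 + 1 := by
  have hZ : cocycles F (P \ {∅}) 1 = cocycles F P 1 := by
    unfold cocycles
    rw [coboundary_diff_empty, cochains_diff_singleton (by simp)]
  -- With the empty set present, the coboundaries in cardinality 1 are the line spanned by the
  -- constant function on vertices, up to sign conventions; without it they vanish. The cocycles are
  -- the same in both cases.
  have hB : Module.finrank F (coboundaries F P 1) = 1 := by
    unfold coboundaries
    rw [sub_self, cochains_zero_eq_span h, Submodule.map_span, Set.image_singleton]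
    exact finrank_span_singleton (coboundary_single_empty_ne_zero hv)
  have hB' : coboundaries F (P \ {∅}) 1 = ⊥ := by
    rw [eq_bot_iff]
    rintro _ ⟨x, hx, rfl⟩
    have : x = 0 := by
      funext σ
      by_contra h'
      obtain ⟨h1, h2⟩ := hx σ h'
      exact h1.2 (by simpa using h2)
    rw [this, map_zero]
    exact zero_mem _
  have := Submodule.finrank_mono (coboundaries_le_cocycles (F := F) hP 1)
  unfold cohomDim
  rw [hZ, hB', finrank_bot]
  omega

theorem cohomDim_zero_eq_zero (h : ∅ ∈ P) {v : V} (hv : {v} ∈ P) : cohomDim F P 0 = 0 := by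
  refine cohomDim_eq_zero_of_le ?_
  rintro x ⟨hx, hd⟩
  rw [cochains_zero_eq_span h] at hx
  obtain ⟨a, rfl⟩ := Submodule.mem_span_singleton.1 hx
  rw [SetLike.mem_coe, LinearMap.mem_ker, map_smul, smul_eq_zero] at hd
  rw [hd.resolve_right (coboundary_single_empty_ne_zero hv), zero_smul]
  exact zero_mem _

theorem lowerSplit_top (hP : P.OrdConnected) {G : Finset V} (hG : G ∈ P)
    (hmax : ∀ σ ∈ P, σ.card ≤ G.card) : LowerSplit P (P \ {G}) {G} := by
  refine ⟨hP, fun σ => ?_, ?_⟩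
  · by_cases h : σ = G
    · subst h; simp [hG]
    · simp [h]
  · rintro σ rfl τ ⟨hτ, hne⟩ hsub
    exact hne (Finset.eq_of_subset_of_card_le hsub (hmax τ hτ)).symm

theorem cocycles_top {d : ℕ} (hmax : ∀ σ ∈ P, σ.card ≤ d) :
    cocycles F P d = cochains F P d :=
  inf_eq_left.2 fun _ hx => coboundary_eq_zero_of_card
    (fun σ hσ => by have := hmax σ hσ; omega) hx

variable (hP : P.OrdConnected) {G : Finset V} (hG : G ∈ P) (hmax : ∀ σ ∈ P, σ.card ≤ G.card)
include hP hG hmax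

theorem coboundary_diff_top {q : ℤ} (hq : (G.card : ℤ) ≠ q) {x : Finset V → F}
    (hx : x ∈ cochains F P q) :
    coboundary F (P \ {G}) x = restrictTo F (P \ {G}) (coboundary F P x) := by
  rw [(lowerSplit_top hP hG hmax).restrict_coboundary hx, restrictTo_eq_self]
  rwa [cochains_diff_singleton hq]

theorem coboundary_diff_top_of_lt {q : ℤ} (hq : q < G.card - 1) {x : Finset V → F}
    (hx : x ∈ cochains F P q) : coboundary F (P \ {G}) x = coboundary F P x := by
  rw [coboundary_diff_top hP hG hmax (by omega) hx]
  have h1 : coboundary F P x ∈ cochains F P (q + 1) := coboundary_mem_cochains P (by simpa)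
  rw [← cochains_diff_singleton (τ := G) (by omega)] at h1
  exact restrictTo_eq_self h1

theorem coboundaries_diff_top_of_lt {q : ℤ} (hq : q < G.card) :
    coboundaries F (P \ {G}) q = coboundaries F P q := by
  unfold coboundaries
  rw [cochains_diff_singleton (by omega)]
  ext y
  simp only [Submodule.mem_map]
  refine exists_congr fun x => and_congr_right fun hx => ?_
  rw [coboundary_diff_top_of_lt hP hG hmax (by omega) hx]

theorem cohomDim_diff_top_of_lt {q : ℤ} (hq : q < G.card - 1) :
    cohomDim F (P \ {G}) q = cohomDim F P q := by
  have hZ : cocycles F (P \ {G}) q = cocycles F P q := by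
    unfold cocycles
    rw [cochains_diff_singleton (by omega)]
    ext x
    simp only [Submodule.mem_inf, LinearMap.mem_ker]
    refine and_congr_right fun hx => ?_
    rw [coboundary_diff_top_of_lt hP hG hmax hq hx]
  unfold cohomDim
  rw [hZ, coboundaries_diff_top_of_lt hP hG hmax (by omega)]

theorem cohomDim_diff_top_eq_zero (h : cohomDim F P G.card = 0) :
    cohomDim F (P \ {G}) G.card = 0 := by
  refine cohomDim_eq_zero_of_le fun x hx => ?_
  have hx1 : x ∈ cocycles F P G.card := by
    rw [cocycles_top hmax]
    exact cochains_mono Set.sdiff_subset _ hx.1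
  obtain ⟨y, hy, rfl⟩ := cocycles_le_of_cohomDim_eq_zero hP h hx1
  refine ⟨y, by rwa [cochains_diff_singleton (by omega)], ?_⟩
  rw [coboundary_diff_top hP hG hmax (by omega) hy, restrictTo_eq_self hx.1]

/-- Removing a top-dimensional cell which is a coboundary. -/
theorem cohomDim_diff_top (h : cohomDim F P G.card = 0) :
    cohomDim F (P \ {G}) (G.card - 1) = cohomDim F P (G.card - 1) + 1 := by
  have hsplit := lowerSplit_top hP hG hmax
  -- A cocycle of `P \ {G}` one step below the top fails to be a cocycle of `P` only by the value of
  -- its coboundary at `G`. Thus `f` has the cocycles of `P` as kernel there, and the new class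
  -- exists exactly when `f` is onto.
  let f : (Finset V → F) →ₗ[F] F := LinearMap.proj G ∘ₗ coboundary F P
  have e := finrank_eq_finrank_map_add (cocycles F (P \ {G}) (G.card - 1)) f
  have hker : cocycles F (P \ {G}) (G.card - 1) ⊓ LinearMap.ker f =
      cocycles F P (G.card - 1) := by
    unfold cocycles
    rw [cochains_diff_singleton (by omega)]
    ext x
    simp only [Submodule.mem_inf, LinearMap.mem_ker]
    constructor
    · rintro ⟨⟨hx, hd⟩, hf⟩
      refine ⟨hx, ?_⟩
      rw [coboundary_diff_top hP hG hmax (by omega) hx] at hd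
      funext σ
      by_cases hσ : σ = G
      · subst hσ; exact hf
      by_cases hσP : σ ∈ P
      · rw [← restrictTo_of_mem (Q := P \ {G}) ⟨hσP, hσ⟩ (coboundary F P x), hd]
      · rw [coboundary_of_notMem hσP]; rfl
    · rintro ⟨hx, hd⟩
      refine ⟨⟨hx, ?_⟩, ?_⟩
      · rw [coboundary_diff_top hP hG hmax (by omega) hx, hd, map_zero]
      · simp [f, hd]
  -- The indicator of `G` is a cocycle for reasons of dimension, hence a coboundary by `h`;
  -- multiples of a primitive realize every scalar.
  have hsurj : (cocycles F (P \ {G}) (G.card - 1)).map f = ⊤ := by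
    have hG1 : (Pi.single G 1 : Finset V → F) ∈ cocycles F P G.card := by
      rw [cocycles_top hmax]
      refine cochains_mono (P := {G}) (by simpa using hG) _ ?_
      rw [cochains_singleton]
      exact Submodule.mem_span_singleton_self _
    obtain ⟨x, hx, hxG⟩ := cocycles_le_of_cohomDim_eq_zero hP h hG1
    rw [eq_top_iff]
    rintro c -
    refine ⟨c • x, Submodule.smul_mem _ _ ⟨?_, ?_⟩, ?_⟩
    · rwa [cochains_diff_singleton (by omega)]
    · rw [SetLike.mem_coe, LinearMap.mem_ker, coboundary_diff_top hP hG hmax (by omega) hx, hxG]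
      funext σ
      by_cases hσ : σ ∈ P \ {G}
      · rw [restrictTo_of_mem hσ, Pi.single_eq_of_ne hσ.2]; rfl
      · rw [restrictTo_of_notMem hσ]; rfl
    · simp [f, hxG]
  rw [hker, hsurj, finrank_top, Module.finrank_self] at e
  have l := Submodule.finrank_mono (coboundaries_le_cocycles (F := F) hP (G.card - 1))
  unfold cohomDim
  rw [e, coboundaries_diff_top_of_lt hP hG hmax (by omega)]
  omega

end SingleCell

/-! ### The monomial basis of the Stanley–Reisner ring. -/

section FaceCoefficients

set_option linter.unusedSectionVars false

open MvPolynomial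

/-- The faces of a complex, including the empty one. -/
def allFaces {V : Type*} (Δ : PreAbstractSimplicialComplex V) : Set (Finset V) :=
  {σ | σ = ∅ ∨ σ ∈ Δ.faces}

theorem isLowerSet_allFaces {V : Type*} (Δ : PreAbstractSimplicialComplex V) :
    IsLowerSet (allFaces Δ) := by
  rintro τ σ hle (rfl | h)
  · exact Or.inl (Finset.subset_empty.1 hle)
  · rcases σ.eq_empty_or_nonempty with rfl | hne
    · exact Or.inl rfl
    · exact Or.inr ((Δ.isRelLowerSet_faces h).2 hle hne)

variable {V F : Type*} [LinearOrder V] [Fintype V] [Field F]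

/-- The exponent of the squarefree monomial with support `T`. -/
noncomputable def squarefreeExp (T : Finset V) : V →₀ ℕ := Finsupp.indicator T fun _ _ => 1

theorem squarefreeExp_apply (T : Finset V) (v : V) :
    squarefreeExp T v = if v ∈ T then 1 else 0 := by
  simp [squarefreeExp, Finsupp.indicator_apply]

theorem support_squarefreeExp (T : Finset V) : (squarefreeExp T).support = T := by
  ext v
  simp [squarefreeExp_apply]

theorem prod_X_eq_monomial (T : Finset V) :
    ∏ v ∈ T, (X v : MvPolynomial V F) = monomial (squarefreeExp T) 1 := by
  rw [monomial_eq, C_1, one_mul, Finsupp.prod, support_squarefreeExp]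
  exact Finset.prod_congr rfl fun v hv => by simp [squarefreeExp_apply, hv]

/-- Membership in a monomial ideal is tested monomial by monomial, and a monomial is divisible by a
generator exactly when its support is not a face. -/
theorem mem_stanleyReisnerIdeal (Δ : AbstractSimplicialComplex V) (f : MvPolynomial V F) :
    f ∈ stanleyReisnerIdeal F Δ ↔
      ∀ a ∈ f.support, a.support ∉ allFaces Δ.toPreAbstractSimplicialComplex := by
  have h : stanleyReisnerIdeal F Δ = Ideal.span ((fun s => monomial s (1 : F)) ''
      {s | ∃ T : Finset V, T.Nonempty ∧ T ∉ Δ.faces ∧ s = squarefreeExp T}) := by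
    unfold stanleyReisnerIdeal
    congr 1
    ext f
    constructor
    · rintro ⟨T, h1, h2, rfl⟩
      exact ⟨_, ⟨T, h1, h2, rfl⟩, (prod_X_eq_monomial T).symm⟩
    · rintro ⟨_, ⟨T, h1, h2, rfl⟩, rfl⟩
      exact ⟨T, h1, h2, (prod_X_eq_monomial T).symm⟩
  rw [h, mem_ideal_span_monomial_image]
  refine forall₂_congr fun a _ => ?_
  constructor
  · rintro ⟨_, ⟨T, h1, h2, rfl⟩, hle⟩ hmem
    have hT : T ⊆ a.support := by
      rw [← support_squarefreeExp T]
      exact Finsupp.support_mono hle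
    rcases isLowerSet_allFaces _ hT hmem with h0 | h0
    · exact h1.ne_empty h0
    · exact h2 h0
  · intro hmem
    refine ⟨_, ⟨a.support, ?_, fun h' => hmem (Or.inr h'), rfl⟩, fun v => ?_⟩
    · rw [Finset.nonempty_iff_ne_empty]
      exact fun h' => hmem (Or.inl h')
    · rw [squarefreeExp_apply]
      split_ifs with hv
      · exact Nat.one_le_iff_ne_zero.2 (by simpa using hv)
      · exact Nat.zero_le _

variable (Δ : AbstractSimplicialComplex V)

open Classical in
/-- The coefficient of a standard monomial of the Stanley-Reisner ring. -/
noncomputable def faceCoeffFun (a : V →₀ ℕ) (y : MvPolynomial V F ⧸ stanleyReisnerIdeal F Δ) : F :=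
  if a.support ∈ allFaces Δ.toPreAbstractSimplicialComplex then
    coeff a (Ideal.Quotient.mk_surjective y).choose else 0

/-- Independence of the chosen representative: elements of the ideal have no monomial supported on a
face. -/
theorem faceCoeffFun_mk {a : V →₀ ℕ}
    (ha : a.support ∈ allFaces Δ.toPreAbstractSimplicialComplex) (f : MvPolynomial V F) :
    faceCoeffFun Δ a (Ideal.Quotient.mk (stanleyReisnerIdeal F Δ) f) = coeff a f := by
  rw [faceCoeffFun, if_pos ha]
  have h := (Ideal.Quotient.mk_surjective
    (Ideal.Quotient.mk (stanleyReisnerIdeal F Δ) f)).choose_spec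
  rw [Ideal.Quotient.eq, mem_stanleyReisnerIdeal] at h
  by_contra hne
  refine h a ?_ ha
  rw [mem_support_iff, coeff_sub]
  exact sub_ne_zero.2 hne

/-- The coefficient of a standard monomial of the Stanley-Reisner ring, as a linear functional. -/
noncomputable def faceCoeff (a : V →₀ ℕ) :
    (MvPolynomial V F ⧸ stanleyReisnerIdeal F Δ) →ₗ[F] F where
  toFun := faceCoeffFun Δ a
  map_add' y z := by
    obtain ⟨f, rfl⟩ := Ideal.Quotient.mk_surjective y
    obtain ⟨g, rfl⟩ := Ideal.Quotient.mk_surjective z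
    by_cases ha : a.support ∈ allFaces Δ.toPreAbstractSimplicialComplex
    · rw [← map_add, faceCoeffFun_mk Δ ha, faceCoeffFun_mk Δ ha, faceCoeffFun_mk Δ ha, coeff_add]
    · simp [faceCoeffFun, ha]
  map_smul' c y := by
    obtain ⟨f, rfl⟩ := Ideal.Quotient.mk_surjective y
    by_cases ha : a.support ∈ allFaces Δ.toPreAbstractSimplicialComplex
    · have : c • Ideal.Quotient.mk (stanleyReisnerIdeal F Δ) f =
        Ideal.Quotient.mk (stanleyReisnerIdeal F Δ) (c • f) := rfl
      rw [this, faceCoeffFun_mk Δ ha, faceCoeffFun_mk Δ ha, coeff_smul]; rfl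
    · simp [faceCoeffFun, ha]

theorem faceCoeff_mk {a : V →₀ ℕ}
    (ha : a.support ∈ allFaces Δ.toPreAbstractSimplicialComplex) (f : MvPolynomial V F) :
    faceCoeff Δ a (Ideal.Quotient.mk (stanleyReisnerIdeal F Δ) f) = coeff a f :=
  faceCoeffFun_mk Δ ha f

theorem faceCoeff_of_notMem {a : V →₀ ℕ}
    (ha : a.support ∉ allFaces Δ.toPreAbstractSimplicialComplex)
    (y : MvPolynomial V F ⧸ stanleyReisnerIdeal F Δ) : faceCoeff Δ a y = 0 := by
  simp [faceCoeff, faceCoeffFun, ha]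

theorem eq_zero_of_faceCoeff {y : MvPolynomial V F ⧸ stanleyReisnerIdeal F Δ}
    (h : ∀ a, faceCoeff Δ a y = 0) : y = 0 := by
  obtain ⟨f, rfl⟩ := Ideal.Quotient.mk_surjective y
  rw [Ideal.Quotient.eq_zero_iff_mem, mem_stanleyReisnerIdeal]
  intro a ha hmem
  exact mem_support_iff.1 ha (by rw [← faceCoeff_mk Δ hmem, h])

theorem faceCoeff_mul (a : V →₀ ℕ) (c : F) (v : V)
    (y : MvPolynomial V F ⧸ stanleyReisnerIdeal F Δ)
    (ha : a.support ∈ allFaces Δ.toPreAbstractSimplicialComplex) :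
    faceCoeff Δ a (Ideal.Quotient.mk _ (C c * X v) * y) =
      c * if v ∈ a.support then faceCoeff Δ (a - Finsupp.single v 1) y else 0 := by
  obtain ⟨f, rfl⟩ := Ideal.Quotient.mk_surjective y
  rw [← map_mul, faceCoeff_mk Δ ha, mul_assoc, coeff_C_mul, coeff_X_mul']
  split_ifs with hv
  · rw [faceCoeff_mk]
    exact isLowerSet_allFaces _ (Finsupp.support_mono tsub_le_self) ha
  · rfl

theorem mem_quotientPiece {m : ℕ} {y : MvPolynomial V F ⧸ stanleyReisnerIdeal F Δ} :
    y ∈ quotientPiece (stanleyReisnerIdeal F Δ) m ↔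
      ∀ a, faceCoeff Δ a y ≠ 0 → a.degree = m := by
  constructor
  · rintro ⟨f, hf, rfl⟩ a ha
    have hmem : a.support ∈ allFaces Δ.toPreAbstractSimplicialComplex := by
      by_contra h; exact ha (faceCoeff_of_notMem Δ h _)
    have : faceCoeff Δ a (Ideal.Quotient.mk (stanleyReisnerIdeal F Δ) f) ≠ 0 := ha
    rw [faceCoeff_mk Δ hmem] at this
    by_contra hne
    exact this (IsHomogeneous.coeff_eq_zero hf hne)
  · intro h
    obtain ⟨f, rfl⟩ := Ideal.Quotient.mk_surjective y
    refine ⟨homogeneousComponent m f, homogeneousComponent_mem _ _, ?_⟩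
    change Ideal.Quotient.mk _ _ = _
    rw [Ideal.Quotient.eq, mem_stanleyReisnerIdeal]
    intro a ha hmem
    rw [mem_support_iff, coeff_sub, coeff_homogeneousComponent] at ha
    split_ifs at ha with hd
    · simp at ha
    · have := h a
      rw [faceCoeff_mk Δ hmem] at this
      exact hd (this (by simpa using ha))

/-- Together with `eq_zero_of_faceCoeff`, this identifies the degree `m` piece with the functions on
face-supported exponents of degree `m`. -/
theorem exists_faceCoeff_eq (m : ℕ) (c : (V →₀ ℕ) → F)
    (hc : ∀ a, c a ≠ 0 → a.support ∈ allFaces Δ.toPreAbstractSimplicialComplex ∧ a.degree = m) :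
    ∃ y ∈ quotientPiece (stanleyReisnerIdeal F Δ) m, ∀ a, faceCoeff Δ a y = c a := by
  classical
  let f : MvPolynomial V F := ∑ a ∈ Finset.finsuppAntidiag Finset.univ m, monomial a (c a)
  have hf : ∀ a, coeff a f = c a := by
    intro a
    simp only [f, coeff_sum, coeff_monomial]
    rw [Finset.sum_ite_eq' _ a]
    split_ifs with h
    · rfl
    · by_contra h'
      refine h ?_
      rw [Finset.mem_finsuppAntidiag]
      refine ⟨?_, Finset.subset_univ _⟩
      rw [← (hc a (Ne.symm h')).2, Finsupp.degree_eq_sum]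
  have hy : ∀ a, faceCoeff Δ a (Ideal.Quotient.mk (stanleyReisnerIdeal F Δ) f) = c a := by
    intro a
    by_cases ha : a.support ∈ allFaces Δ.toPreAbstractSimplicialComplex
    · rw [faceCoeff_mk Δ ha, hf]
    · rw [faceCoeff_of_notMem Δ ha]
      by_contra h'
      exact ha (hc a (Ne.symm h')).1
  exact ⟨_, (mem_quotientPiece Δ).2 fun a ha => (hc a (hy a ▸ ha)).2, hy⟩

end FaceCoefficients

/-! ### Multigraded strands of the Koszul complex as cochain complexes. -/

section Hochster

set_option linter.unusedSectionVars false

open MvPolynomial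

variable {V F : Type*} [LinearOrder V] [Fintype V] [Field F] (Δ : AbstractSimplicialComplex V)

/-- The cells of the Koszul complex of the Stanley-Reisner ring in multidegree `b`, indexed by the
complement in the support of `b`. -/
def cellFamily (b : V →₀ ℕ) : Set (Finset V) :=
  {σ | σ ⊆ b.support ∧ (b - squarefreeExp (b.support \ σ)).support ∈
    allFaces Δ.toPreAbstractSimplicialComplex}

/-- A cell $x^a e_T$ of multidegree $b=a+1_T$ is indexed by $\sigma=\operatorname{supp} b\setminus
T$. Shrinking $\sigma$ enlarges $T$ and so shrinks the support of $a$, which remains a face. Passing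
to complements turns the Koszul differential, which removes an element of $T$, into a coboundary. -/
theorem isLowerSet_cellFamily (b : V →₀ ℕ) : IsLowerSet (cellFamily Δ b) := by
  rintro τ σ hle ⟨h1, h2⟩
  refine ⟨hle.trans h1, isLowerSet_allFaces _ ?_ h2⟩
  refine Finsupp.support_mono (tsub_le_tsub_left ?_ b)
  intro v
  rw [squarefreeExp_apply, squarefreeExp_apply]
  split_ifs with ha hb
  · exact le_rfl
  · exact absurd (Finset.sdiff_subset_sdiff subset_rfl hle ha) hb
  · exact Nat.zero_le _
  · exact le_rfl

/-- The sign comparing the Koszul differential with the coboundary. -/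
def koszulTwist (F : Type*) [Field F] (S σ : Finset V) : F := ∏ u ∈ σ, incidence F S u

theorem koszulTwist_mul_self (S σ : Finset V) : koszulTwist F S σ * koszulTwist F S σ = 1 := by
  unfold koszulTwist
  rw [← Finset.prod_mul_distrib]
  exact Finset.prod_eq_one fun u _ => incidence_mul_self S u

theorem koszulTwist_ne_zero (S σ : Finset V) : koszulTwist F S σ ≠ 0 := by
  intro h
  have := koszulTwist_mul_self (F := F) S σ
  simp [h] at this

/-- The elements of $S$ below $v$ split into those in $\sigma$ and those in $S\setminus\sigma$. So
the two sign conventions differ by `incidence F S v`, which is the factor by which the twists of `σ`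
and `σ.erase v` differ. -/
theorem koszulTwist_mul_koszulSign {S σ : Finset V} (hσ : σ ⊆ S) {v : V} (hv : v ∈ σ) :
    koszulTwist F S σ * koszulSign F (S \ σ) v =
      incidence F σ v * koszulTwist F S (σ.erase v) := by
  have h1 : koszulTwist F S σ = koszulTwist F S (σ.erase v) * incidence F S v :=
    (Finset.prod_erase_mul _ _ hv).symm
  have h2 : incidence F S v = incidence F σ v * koszulSign F (S \ σ) v := by
    unfold incidence koszulSign
    rw [← pow_add, ← Finset.card_union_of_disjoint, ← Finset.filter_union,
      Finset.union_sdiff_of_subset hσ]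
    exact Finset.disjoint_filter_filter Finset.disjoint_sdiff
  have h3 : koszulSign F (S \ σ) v * koszulSign F (S \ σ) v = 1 := by
    unfold koszulSign
    rw [← mul_pow]; simp
  rw [h1, h2]
  linear_combination koszulTwist F S (σ.erase v) * incidence F σ v * h3

/-- Extension by zero of a chain of length `p` to all index sets. -/
noncomputable def extendZero {M : Type*} [Zero M] {p : ℕ} (x : {T : Finset V // T.card = p} → M)
    (T : Finset V) : M :=
  if h : T.card = p then x ⟨T, h⟩ else 0

theorem extendZero_of_card {M : Type*} [Zero M] {p : ℕ}
    (x : {T : Finset V // T.card = p} → M) {T : Finset V} (h : T.card = p) :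
    extendZero x T = x ⟨T, h⟩ := by simp [extendZero, h]

theorem extendZero_of_card_ne {M : Type*} [Zero M] {p : ℕ}
    (x : {T : Finset V // T.card = p} → M) {T : Finset V} (h : T.card ≠ p) :
    extendZero x T = 0 := by simp [extendZero, h]

/-- The degree `k` component of the Koszul complex of the Stanley-Reisner ring. -/
noncomputable def koszulPiece (F : Type*) [Field F] (p k : ℕ) :
    Submodule F ({T : Finset V // T.card = p} → MvPolynomial V F ⧸ stanleyReisnerIdeal F Δ) :=
  chainPiece (koszulResolution V F) (stanleyReisnerIdeal F Δ) p k

/-- The differential of the Koszul complex of the Stanley-Reisner ring. -/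
noncomputable def koszulDifferential (F : Type*) [Field F] (p : ℕ) :
    ({T : Finset V // T.card = p + 1} → MvPolynomial V F ⧸ stanleyReisnerIdeal F Δ) →ₗ[F]
      ({T : Finset V // T.card = p} → MvPolynomial V F ⧸ stanleyReisnerIdeal F Δ) :=
  chainDifferential (koszulResolution V F) (stanleyReisnerIdeal F Δ) p

open Classical in
/-- The component of multidegree `b` of a chain of the Koszul complex of the Stanley-Reisner
ring, as a cochain of `cellFamily Δ b`. -/
noncomputable def toCochain (p : ℕ) (b : V →₀ ℕ) :
    ({T : Finset V // T.card = p} → MvPolynomial V F ⧸ stanleyReisnerIdeal F Δ) →ₗ[F]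
      (Finset V → F) where
  toFun x σ := if σ ⊆ b.support then koszulTwist F b.support σ *
    faceCoeff Δ (b - squarefreeExp (b.support \ σ)) (extendZero x (b.support \ σ)) else 0
  map_add' x y := by
    funext σ
    by_cases h1 : σ ⊆ b.support <;> by_cases h2 : (b.support \ σ).card = p <;>
      simp [extendZero, h1, h2, mul_add]
  map_smul' c x := by
    funext σ
    by_cases h1 : σ ⊆ b.support <;> by_cases h2 : (b.support \ σ).card = p <;>
      simp [extendZero, h1, h2, mul_left_comm]

variable {Δ}

theorem toCochain_apply {p : ℕ} {b : V →₀ ℕ} {σ : Finset V} (h : σ ⊆ b.support)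
    (x : {T : Finset V // T.card = p} → MvPolynomial V F ⧸ stanleyReisnerIdeal F Δ) :
    toCochain Δ p b x σ = koszulTwist F b.support σ *
      faceCoeff Δ (b - squarefreeExp (b.support \ σ)) (extendZero x (b.support \ σ)) := by
  simp [toCochain, h]

theorem toCochain_mem (p : ℕ) (b : V →₀ ℕ)
    (x : {T : Finset V // T.card = p} → MvPolynomial V F ⧸ stanleyReisnerIdeal F Δ) :
    toCochain Δ p b x ∈ cochains F (cellFamily Δ b) ((b.support.card : ℤ) - p) := by
  intro σ hσ
  have h1 : σ ⊆ b.support := by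
    by_contra h; exact hσ (by simp [toCochain, h])
  rw [toCochain_apply h1] at hσ
  have h2 := right_ne_zero_of_mul hσ
  have h3 : (b.support \ σ).card = p := by
    by_contra h; exact h2 (by rw [extendZero_of_card_ne x h, map_zero])
  refine ⟨⟨h1, ?_⟩, ?_⟩
  · by_contra h; exact h2 (faceCoeff_of_notMem Δ h _)
  · have := Finset.card_sdiff_add_card_eq_card h1
    omega

theorem mem_koszulPiece {p k : ℕ}
    {x : {T : Finset V // T.card = p} → MvPolynomial V F ⧸ stanleyReisnerIdeal F Δ} :
    x ∈ koszulPiece Δ F p k ↔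
      ∀ T a, faceCoeff Δ a (x T) ≠ 0 → a.degree + p = k := by
  have h : x ∈ koszulPiece Δ F p k ↔
      ∀ T, x T ∈ if p ≤ k then quotientPiece (stanleyReisnerIdeal F Δ) (k - p) else ⊥ := by
    exact Submodule.mem_pi.trans ⟨fun h T => h T trivial, fun h T _ => h T⟩
  rw [h]
  refine forall_congr' fun T => ?_
  split_ifs with hp
  · rw [mem_quotientPiece]
    refine forall₂_congr fun a _ => ?_
    omega
  · rw [Submodule.mem_bot]
    constructor
    · intro h a ha
      simp [h] at ha
    · intro h
      refine eq_zero_of_faceCoeff Δ fun a => ?_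
      by_contra h'
      have := h a h'
      omega

theorem support_add_squarefreeExp (a : V →₀ ℕ) (T : Finset V) :
    (a + squarefreeExp T).support = a.support ∪ T := by
  ext v
  by_cases h : v ∈ T <;> simp [squarefreeExp_apply, h]

theorem degree_squarefreeExp (T : Finset V) : (squarefreeExp T).degree = T.card := by
  rw [Finsupp.degree_eq_sum]
  simp [squarefreeExp_apply]

/-- Each coefficient of a chain occurs, up to sign, in the multidegree $a+1_T$. This yields joint
injectivity of the maps `toCochain`, and read backwards it dictates the preimage in
`exists_toCochain_eq`. -/
theorem faceCoeff_eq_toCochain {p : ℕ}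
    (x : {T : Finset V // T.card = p} → MvPolynomial V F ⧸ stanleyReisnerIdeal F Δ)
    (T : {T : Finset V // T.card = p}) (a : V →₀ ℕ) :
    toCochain Δ p (a + squarefreeExp T.1) x ((a + squarefreeExp T.1).support \ T.1) =
      koszulTwist F (a + squarefreeExp T.1).support ((a + squarefreeExp T.1).support \ T.1) *
        faceCoeff Δ a (x T) := by
  rw [toCochain_apply Finset.sdiff_subset, Finset.sdiff_sdiff_eq_self, add_tsub_cancel_right,
    extendZero_of_card x T.2]
  rw [support_add_squarefreeExp]
  exact Finset.subset_union_right

theorem eq_zero_of_toCochain {p k : ℕ}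
    {x : {T : Finset V // T.card = p} → MvPolynomial V F ⧸ stanleyReisnerIdeal F Δ}
    (hx : x ∈ koszulPiece Δ F p k)
    (h : ∀ b : V →₀ ℕ, b.degree = k → toCochain Δ p b x = 0) : x = 0 := by
  funext T
  refine eq_zero_of_faceCoeff Δ fun a => ?_
  by_contra hne
  have hdeg := mem_koszulPiece.1 hx T a hne
  have h1 := faceCoeff_eq_toCochain x T a
  rw [h _ (by rw [map_add, degree_squarefreeExp, T.2, hdeg]), Pi.zero_apply] at h1
  exact mul_ne_zero (koszulTwist_ne_zero _ _) hne h1.symm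

theorem exists_toCochain_eq (p k : ℕ) (y : (V →₀ ℕ) → Finset V → F)
    (hy : ∀ b : V →₀ ℕ, b.degree = k →
      y b ∈ cochains F (cellFamily Δ b) ((b.support.card : ℤ) - p)) :
    ∃ x ∈ koszulPiece Δ F p k,
      ∀ b : V →₀ ℕ, b.degree = k → toCochain Δ p b x = y b := by
  classical
  let c : {T : Finset V // T.card = p} → (V →₀ ℕ) → F := fun T a =>
    if a.degree + p = k then
      koszulTwist F (a + squarefreeExp T.1).support ((a + squarefreeExp T.1).support \ T.1) *
      y (a + squarefreeExp T.1) ((a + squarefreeExp T.1).support \ T.1) else 0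
  have hc : ∀ T a, c T a ≠ 0 → a.support ∈ allFaces Δ.toPreAbstractSimplicialComplex ∧
      a.degree = k - p := by
    intro T a ha
    have hk : a.degree + p = k := by
      by_contra h; exact ha (if_neg h)
    have hd : (a + squarefreeExp T.1).degree = k := by
      rw [map_add, degree_squarefreeExp, T.2, hk]
    simp only [c, if_pos hk] at ha
    have h1 := (hy _ hd _ (right_ne_zero_of_mul ha)).1.2
    rw [Finset.sdiff_sdiff_eq_self
      (by rw [support_add_squarefreeExp]; exact Finset.subset_union_right),
      add_tsub_cancel_right] at h1
    exact ⟨h1, by omega⟩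
  choose x hx1 hx2 using fun T => exists_faceCoeff_eq Δ (k - p) (c T) (hc T)
  refine ⟨x, mem_koszulPiece.2 fun T a ha => ?_, fun b hb => ?_⟩
  · rw [hx2] at ha
    by_contra h; exact ha (if_neg h)
  · funext σ
    by_cases hσ : σ ⊆ b.support
    swap
    · rw [cochains_eq_zero (toCochain_mem p b x) fun h => hσ h.1,
        cochains_eq_zero (hy b hb) fun h => hσ h.1]
    by_cases hcard : (b.support \ σ).card = p
    swap
    · have h' : (σ.card : ℤ) ≠ (b.support.card : ℤ) - p := by
        have := Finset.card_sdiff_add_card_eq_card hσ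
        omega
      have e1 : toCochain Δ p b x σ = 0 := by
        by_contra h; exact h' (toCochain_mem p b x σ h).2
      have e2 : y b σ = 0 := by
        by_contra h; exact h' (hy b hb σ h).2
      rw [e1, e2]
    · have hle : squarefreeExp (b.support \ σ) ≤ b := by
        intro v
        rw [squarefreeExp_apply]
        split_ifs with hv
        · exact Nat.one_le_iff_ne_zero.2 (by simpa using (Finset.mem_sdiff.1 hv).1)
        · exact Nat.zero_le _
      have hb' : b - squarefreeExp (b.support \ σ) + squarefreeExp (b.support \ σ) = b :=
        tsub_add_cancel_of_le hle
      rw [toCochain_apply hσ, extendZero_of_card x hcard, hx2]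
      simp only [c, hb']
      rw [if_pos, Finset.sdiff_sdiff_eq_self hσ, ← mul_assoc, koszulTwist_mul_self, one_mul]
      rw [← hb, ← hcard, ← degree_squarefreeExp (b.support \ σ), ← map_add, hb']

theorem koszulDifferential_apply (p : ℕ)
    (x : {T : Finset V // T.card = p + 1} → MvPolynomial V F ⧸ stanleyReisnerIdeal F Δ)
    (T : {T : Finset V // T.card = p}) :
    koszulDifferential Δ F p x T =
      ∑ v ∈ T.1ᶜ, Ideal.Quotient.mk (stanleyReisnerIdeal F Δ) (C (koszulSign F T.1 v) * X v) *
        extendZero x (insert v T.1) := by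
  have h : koszulDifferential Δ F p x T =
      ∑ U, Ideal.Quotient.mk (stanleyReisnerIdeal F Δ) (koszulMatrix V F p T U) * x U := rfl
  rw [h]
  simp only [koszulMatrix, map_sum, Finset.sum_mul]
  rw [Finset.sum_comm]
  refine Finset.sum_congr rfl fun v hv => ?_
  have hc : (insert v T.1).card = p + 1 := by
    rw [Finset.card_insert_of_notMem (by simpa using hv), T.2]
  rw [Finset.sum_eq_single ⟨insert v T.1, hc⟩]
  · rw [if_pos rfl, extendZero_of_card x hc]
  · intro U _ hU
    rw [if_neg, map_zero, zero_mul]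
    intro h
    exact hU (Subtype.ext h.symm)
  · simp

theorem faceCoeff_koszulDifferential (p : ℕ)
    (x : {T : Finset V // T.card = p + 1} → MvPolynomial V F ⧸ stanleyReisnerIdeal F Δ)
    (T : {T : Finset V // T.card = p}) {a : V →₀ ℕ}
    (ha : a.support ∈ allFaces Δ.toPreAbstractSimplicialComplex) :
    faceCoeff Δ a (koszulDifferential Δ F p x T) =
      ∑ v ∈ T.1ᶜ, koszulSign F T.1 v * if v ∈ a.support then
        faceCoeff Δ (a - Finsupp.single v 1) (extendZero x (insert v T.1)) else 0 := by
  rw [koszulDifferential_apply, map_sum]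
  exact Finset.sum_congr rfl fun v _ => faceCoeff_mul Δ a _ v _ ha

theorem koszulDifferential_mem {p k : ℕ}
    {x : {T : Finset V // T.card = p + 1} → MvPolynomial V F ⧸ stanleyReisnerIdeal F Δ}
    (hx : x ∈ koszulPiece Δ F (p + 1) k) :
    koszulDifferential Δ F p x ∈
      koszulPiece Δ F p k := by
  refine mem_koszulPiece.2 fun T a ha => ?_
  have hmem : a.support ∈ allFaces Δ.toPreAbstractSimplicialComplex := by
    by_contra h; exact ha (faceCoeff_of_notMem Δ h _)
  rw [faceCoeff_koszulDifferential p x T hmem] at ha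
  obtain ⟨v, hv, hne⟩ := Finset.exists_ne_zero_of_sum_ne_zero ha
  have h1 := right_ne_zero_of_mul hne
  have hva : v ∈ a.support := by
    by_contra h; exact h1 (if_neg h)
  have hc : (insert v T.1).card = p + 1 := by
    rw [Finset.card_insert_of_notMem (by simpa using hv), T.2]
  rw [if_pos hva, extendZero_of_card x hc] at h1
  have h2 := mem_koszulPiece.1 hx _ _ h1
  have h3 : a - Finsupp.single v 1 + Finsupp.single v 1 = a := by
    refine tsub_add_cancel_of_le ?_
    rw [Finsupp.single_le_iff]
    exact Nat.one_le_iff_ne_zero.2 (by simpa using hva)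
  have h4 := congrArg Finsupp.degree h3
  rw [map_add, Finsupp.degree_single] at h4
  omega

/-- Adding $v$ to $T=\operatorname{supp} b\setminus\sigma$ deletes $v$ from $\sigma$, and lowering
the exponent by $e_v$ compensates within multidegree $b$; the signs agree by
`koszulTwist_mul_koszulSign`. -/
theorem toCochain_koszulDifferential (p : ℕ) (b : V →₀ ℕ)
    (x : {T : Finset V // T.card = p + 1} → MvPolynomial V F ⧸ stanleyReisnerIdeal F Δ) :
    toCochain Δ p b (koszulDifferential Δ F p x) =
      coboundary F (cellFamily Δ b) (toCochain Δ (p + 1) b x) := by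
  funext σ
  by_cases hσ : σ ∈ cellFamily Δ b
  swap
  · rw [coboundary_of_notMem hσ, cochains_eq_zero (toCochain_mem p b _) hσ]
  have hT : ∀ v ∈ σ, b.support \ σ.erase v = insert v (b.support \ σ) := by
    intro v hv
    ext w
    simp only [Finset.mem_sdiff, Finset.mem_erase, Finset.mem_insert, not_and]
    by_cases hw : w = v
    · subst hw; simp [hσ.1 hv]
    · simp [hw]
  rw [coboundary_of_mem hσ, toCochain_apply hσ.1]
  by_cases hcard : (b.support \ σ).card = p
  swap
  · rw [extendZero_of_card_ne _ hcard, map_zero, mul_zero, Finset.sum_eq_zero]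
    intro v hv
    rw [toCochain_apply ((Finset.erase_subset _ _).trans hσ.1), hT v hv, extendZero_of_card_ne,
      map_zero, mul_zero, mul_zero]
    rw [Finset.card_insert_of_notMem (by simp [hv])]
    omega
  · rw [extendZero_of_card _ hcard, faceCoeff_koszulDifferential p x _ hσ.2, Finset.mul_sum]
    have hsub : σ ⊆ (b.support \ σ)ᶜ := fun v hv => by simp [hv]
    rw [← Finset.sum_subset hsub]
    · refine Finset.sum_congr rfl fun v hv => ?_
      have hvb := hσ.1 hv
      rw [if_pos, toCochain_apply ((Finset.erase_subset _ _).trans hσ.1), hT v hv, ← mul_assoc,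
        koszulTwist_mul_koszulSign hσ.1 hv, mul_assoc]
      · congr 3
        rw [tsub_tsub]
        congr 1
        ext w
        rw [Finsupp.tsub_apply, Finsupp.tsub_apply, Finsupp.add_apply, squarefreeExp_apply,
          squarefreeExp_apply, Finsupp.single_apply]
        by_cases hw : v = w
        · subst hw; simp [hv]
        · simp [hw, Ne.symm hw]
      · rw [Finsupp.mem_support_iff, Finsupp.tsub_apply, squarefreeExp_apply, if_neg (by simp [hv])]
        simpa using hvb
    -- The remaining `v` lie outside the support of `b`, so `X v` cannot divide the monomial in
    -- question.
    · intro v hv hvσ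
      rw [if_neg, mul_zero, mul_zero]
      rw [Finsupp.mem_support_iff, not_not, Finsupp.tsub_apply]
      have : v ∉ b.support := fun h => by simp [h, hvσ] at hv
      rw [Finsupp.notMem_support_iff.1 this, Nat.zero_sub]

end Hochster

/-! ### Hochster's formula for the graded Betti numbers. -/

section HochsterFormula

set_option linter.unusedSectionVars false

open MvPolynomial

theorem finrank_submodule_pi {F ι M : Type*} [Field F] [Fintype ι] [AddCommGroup M] [Module F M]
    [FiniteDimensional F M] (p : ι → Submodule F M) :
    Module.finrank F (Submodule.pi Set.univ p) = ∑ i, Module.finrank F (p i) := by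
  have hinj : Function.Injective
      (LinearMap.pi fun i => (p i).subtype ∘ₗ LinearMap.proj i : (∀ i, p i) →ₗ[F] ι → M) :=
    fun x y h => funext fun i => Subtype.ext (congrFun h i)
  have hrange : Submodule.pi Set.univ p = LinearMap.range
      (LinearMap.pi fun i => (p i).subtype ∘ₗ LinearMap.proj i : (∀ i, p i) →ₗ[F] ι → M) := by
    ext x
    simp only [Submodule.mem_pi, Set.mem_univ, true_imp_iff, LinearMap.mem_range]
    exact ⟨fun h => ⟨fun i => ⟨x i, h i⟩, rfl⟩, by rintro ⟨y, rfl⟩ i; exact (y i).2⟩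
  rw [← Module.finrank_pi_fintype, ← LinearMap.finrank_range_of_inj hinj, hrange]

/-- The subcomplex induced on the vertices in `W`. -/
def induced {V : Type*} (K : Set (Finset V)) (W : Finset V) : Set (Finset V) :=
  {σ | σ ∈ K ∧ σ ⊆ W}

variable {V F : Type*} [LinearOrder V] [Fintype V] [Field F] {Δ : AbstractSimplicialComplex V}

/-- The exponents of degree `k`. -/
abbrev ExponentOfDegree (V : Type*) [DecidableEq V] [Fintype V] (k : ℕ) : Type _ :=
  ↥(Finset.finsuppAntidiag (Finset.univ : Finset V) k)

theorem mem_finsuppAntidiag_univ {k : ℕ} {b : V →₀ ℕ} :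
    b ∈ Finset.finsuppAntidiag (Finset.univ : Finset V) k ↔ b.degree = k := by
  rw [Finset.mem_finsuppAntidiag, Finsupp.degree_eq_sum]
  exact and_iff_left (Finset.subset_univ _)

variable (Δ) in
/-- All multigraded components of degree `k` of a chain. -/
noncomputable def toCochains (F : Type*) [Field F] (p k : ℕ) :
    ({T : Finset V // T.card = p} → MvPolynomial V F ⧸ stanleyReisnerIdeal F Δ) →ₗ[F]
      (ExponentOfDegree V k → Finset V → F) :=
  LinearMap.pi fun b => toCochain Δ p b.1

theorem toCochains_injOn {p k : ℕ}
    {x : {T : Finset V // T.card = p} → MvPolynomial V F ⧸ stanleyReisnerIdeal F Δ}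
    (hx : x ∈ koszulPiece Δ F p k) (h : toCochains Δ F p k x = 0) : x = 0 :=
  eq_zero_of_toCochain hx fun b hb => congrFun h ⟨b, mem_finsuppAntidiag_univ.2 hb⟩

theorem exists_toCochains_eq (p k : ℕ) (y : ExponentOfDegree V k → Finset V → F)
    (hy : ∀ b, y b ∈ cochains F (cellFamily Δ b.1) ((b.1.support.card : ℤ) - p)) :
    ∃ x ∈ koszulPiece Δ F p k, toCochains Δ F p k x = y := by
  classical
  obtain ⟨x, hx, hxy⟩ := exists_toCochain_eq (Δ := Δ) p k
    (fun b => if h : b ∈ Finset.finsuppAntidiag (Finset.univ : Finset V) k then y ⟨b, h⟩ else 0)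
    (fun b hb => by
      have hb := mem_finsuppAntidiag_univ.2 hb
      simp only [dif_pos hb]
      exact hy ⟨b, hb⟩)
  refine ⟨x, hx, funext fun b => ?_⟩
  refine (hxy b.1 (mem_finsuppAntidiag_univ.1 b.2)).trans ?_
  simp only [dif_pos b.2]

variable (Δ) in
/-- Cycles of degree `k` of the Koszul complex of the Stanley-Reisner ring. -/
noncomputable def koszulCycles (F : Type*) [Field F] (p k : ℕ) :
    Submodule F ({T : Finset V // T.card = p} → MvPolynomial V F ⧸ stanleyReisnerIdeal F Δ) :=
  cyclePiece (koszulResolution V F) (stanleyReisnerIdeal F Δ) p k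

variable (Δ) in
/-- Boundaries of degree `k` of the Koszul complex of the Stanley-Reisner ring. -/
noncomputable def koszulBoundaries (F : Type*) [Field F] (p k : ℕ) :
    Submodule F ({T : Finset V // T.card = p} → MvPolynomial V F ⧸ stanleyReisnerIdeal F Δ) :=
  (koszulPiece Δ F (p + 1) k).map (koszulDifferential Δ F p)

theorem mem_koszulCycles {p k : ℕ}
    {x : {T : Finset V // T.card = p} → MvPolynomial V F ⧸ stanleyReisnerIdeal F Δ} :
    x ∈ koszulCycles Δ F p k ↔ x ∈ koszulPiece Δ F p k ∧
      ∀ b : V →₀ ℕ, b.degree = k → coboundary F (cellFamily Δ b) (toCochain Δ p b x) = 0 := by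
  cases p with
  | zero =>
    refine ⟨fun h => ⟨h, fun b _ => ?_⟩, fun h => h.1⟩
    -- In position 0 the cochain sits in cardinality `b.support.card`, and no cell is larger, so the
    -- cocycle condition is automatic.
    refine coboundary_eq_zero_of_card (fun σ hσ => ?_) (toCochain_mem 0 b x)
    have := Finset.card_le_card hσ.1
    push_cast
    omega
  | succ p =>
    have h : x ∈ koszulCycles Δ F (p + 1) k ↔ x ∈ koszulPiece Δ F (p + 1) k ∧
        koszulDifferential Δ F p x = 0 := Iff.rfl
    rw [h]
    refine and_congr_right fun hx => ?_
    constructor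
    · intro h b _
      rw [← toCochain_koszulDifferential, h, map_zero]
    · intro h
      refine eq_zero_of_toCochain (koszulDifferential_mem hx) fun b hb => ?_
      rw [toCochain_koszulDifferential, h b hb]

theorem convex_cellFamily (b : V →₀ ℕ) : (cellFamily Δ b).OrdConnected :=
  (isLowerSet_cellFamily Δ b).ordConnected

theorem koszulBoundaries_le (p k : ℕ) : koszulBoundaries Δ F p k ≤ koszulCycles Δ F p k := by
  rintro _ ⟨x, hx, rfl⟩
  refine mem_koszulCycles.2 ⟨koszulDifferential_mem hx, fun b _ => ?_⟩
  rw [toCochain_koszulDifferential,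
    coboundary_coboundary (convex_cellFamily b) (toCochain_mem (p + 1) b x)]

theorem koszulCycles_le (p k : ℕ) : koszulCycles Δ F p k ≤ koszulPiece Δ F p k :=
  fun _ hx => (mem_koszulCycles.1 hx).1

theorem map_koszulCycles (p k : ℕ) :
    (koszulCycles Δ F p k).map (toCochains Δ F p k) = Submodule.pi Set.univ
      fun b => cocycles F (cellFamily Δ b.1) ((b.1.support.card : ℤ) - p) := by
  ext y
  simp only [Submodule.mem_map, Submodule.mem_pi, Set.mem_univ, true_imp_iff]
  constructor
  · rintro ⟨x, hx, rfl⟩ b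
    exact ⟨toCochain_mem p b.1 x,
      (mem_koszulCycles.1 hx).2 b.1 (mem_finsuppAntidiag_univ.1 b.2)⟩
  · intro hy
    obtain ⟨x, hx, rfl⟩ := exists_toCochains_eq p k y fun b => (hy b).1
    exact ⟨x, mem_koszulCycles.2 ⟨hx, fun b hb =>
      (hy ⟨b, mem_finsuppAntidiag_univ.2 hb⟩).2⟩, rfl⟩

theorem map_koszulBoundaries (p k : ℕ) :
    (koszulBoundaries Δ F p k).map (toCochains Δ F p k) = Submodule.pi Set.univ
      fun b => coboundaries F (cellFamily Δ b.1) ((b.1.support.card : ℤ) - p) := by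
  ext y
  simp only [Submodule.mem_map, Submodule.mem_pi, Set.mem_univ, true_imp_iff]
  constructor
  · rintro ⟨_, ⟨x, hx, rfl⟩, rfl⟩ b
    refine ⟨toCochain Δ (p + 1) b.1 x, ?_, (toCochain_koszulDifferential p b.1 x).symm⟩
    have := toCochain_mem (p + 1) b.1 x
    rwa [Nat.cast_succ, ← sub_sub] at this
  · intro hy
    choose z hz hzy using hy
    obtain ⟨x, hx, hxz⟩ := exists_toCochains_eq (Δ := Δ) (p + 1) k z fun b => by
      rw [Nat.cast_succ, ← sub_sub]; exact hz b
    refine ⟨_, ⟨x, hx, rfl⟩, funext fun b => ?_⟩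
    refine (toCochain_koszulDifferential p b.1 x).trans ?_
    rw [← hzy b, ← hxz]
    rfl

theorem finrank_map_toCochains {p k : ℕ} {W : Submodule F
    ({T : Finset V // T.card = p} → MvPolynomial V F ⧸ stanleyReisnerIdeal F Δ)}
    (hW : W ≤ koszulPiece Δ F p k) :
    Module.finrank F W = Module.finrank F (W.map (toCochains Δ F p k)) := by
  have hinj : Function.Injective ((toCochains Δ F p k).domRestrict W) := by
    rw [injective_iff_map_eq_zero]
    exact fun x hx => Subtype.ext (toCochains_injOn (hW x.2) hx)
  rw [← LinearMap.finrank_range_of_inj hinj, LinearMap.range_domRestrict]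

/-- The graded Betti numbers as sums over multidegrees. -/
theorem gradedBetti_eq_sum_multidegree (p k : ℕ) :
    gradedBetti F Δ p k = ∑ b ∈ Finset.finsuppAntidiag (Finset.univ : Finset V) k,
      cohomDim F (cellFamily Δ b) ((b.support.card : ℤ) - p) := by
  -- The dimension formula for the quotient needs finiteness, which the ambient space of all chains
  -- does not supply; it comes from embedding one graded piece into finitely many cochain spaces.
  have hfin : FiniteDimensional F (koszulCycles Δ F p k) := by
    refine Module.Finite.of_injective ((toCochains Δ F p k).domRestrict (koszulCycles Δ F p k)) ?_
    rw [injective_iff_map_eq_zero]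
    exact fun x hx => Subtype.ext (toCochains_injOn (koszulCycles_le p k x.2) hx)
  have h : gradedBetti F Δ p k = Module.finrank F (koszulCycles Δ F p k ⧸
      (koszulBoundaries Δ F p k).submoduleOf (koszulCycles Δ F p k)) := rfl
  have h2 := Submodule.finrank_quotient_add_finrank
    ((koszulBoundaries Δ F p k).submoduleOf (koszulCycles Δ F p k))
  rw [LinearEquiv.finrank_eq (Submodule.submoduleOfEquivOfLe (koszulBoundaries_le p k)),
    finrank_map_toCochains (koszulCycles_le p k), map_koszulCycles, finrank_submodule_pi,
    finrank_map_toCochains ((koszulBoundaries_le p k).trans (koszulCycles_le p k)),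
    map_koszulBoundaries, finrank_submodule_pi, ← h] at h2
  rw [← Finset.sum_coe_sort, eq_tsub_of_add_eq h2, ← Finset.sum_tsub_distrib]
  · rfl
  · exact fun b _ => Submodule.finrank_mono (coboundaries_le_cocycles (convex_cellFamily b.1) _)

/-- If the exponent of `v` is at least 2, then `v` remains in the support of the monomial part
whether or not it lies in $T$, so toggling `v` preserves the cells. Hence only squarefree
multidegrees contribute. -/
theorem acyclic_cellFamily {b : V →₀ ℕ} {v : V} (hv : 2 ≤ b v) :
    Acyclic F (cellFamily Δ b) := by
  refine acyclic_of_toggle v fun σ _ => ?_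
  have hvb : v ∈ b.support := by simp; omega
  have h : (b - squarefreeExp (b.support \ insert v σ)).support =
      (b - squarefreeExp (b.support \ σ)).support := by
    ext w
    rw [Finsupp.mem_support_iff, Finsupp.mem_support_iff, Finsupp.tsub_apply, Finsupp.tsub_apply,
      squarefreeExp_apply, squarefreeExp_apply]
    by_cases hw : w = v
    · subst hw
      split_ifs <;> omega
    · simp [hw]
  simp only [cellFamily, Set.mem_ofPred_eq, h, Finset.insert_subset_iff, hvb, true_and]

theorem cellFamily_squarefreeExp (W : Finset V) :
    cellFamily Δ (squarefreeExp W) = induced (allFaces Δ.toPreAbstractSimplicialComplex) W := by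
  ext σ
  simp only [cellFamily, induced, Set.mem_ofPred_eq, support_squarefreeExp]
  rw [and_comm]
  refine and_congr_left fun hσ => ?_
  have : squarefreeExp W - squarefreeExp (W \ σ) = squarefreeExp σ := by
    ext v
    rw [Finsupp.tsub_apply, squarefreeExp_apply, squarefreeExp_apply, squarefreeExp_apply]
    by_cases h : v ∈ σ
    · simp [h, hσ h]
    · by_cases h' : v ∈ W <;> simp [h, h']
  rw [this, support_squarefreeExp]

/-- Hochster's formula. -/
theorem gradedBetti_eq_sum (p k : ℕ) :
    gradedBetti F Δ p k = ∑ W ∈ Finset.powersetCard k (Finset.univ : Finset V),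
      cohomDim F (induced (allFaces Δ.toPreAbstractSimplicialComplex) W) ((k : ℤ) - p) := by
  rw [gradedBetti_eq_sum_multidegree]
  symm
  refine Finset.sum_of_injOn squarefreeExp ?_ ?_ ?_ ?_
  · intro W _ W' _ h
    rw [← support_squarefreeExp W, ← support_squarefreeExp W']
    exact congrArg Finsupp.support h
  · intro W hW
    rw [Finset.mem_coe, mem_finsuppAntidiag_univ, degree_squarefreeExp]
    exact (Finset.mem_powersetCard.1 hW).2
  -- An exponent outside the image of `squarefreeExp` has an entry at least 2.
  · intro b hb hb'
    by_cases h : ∃ v, 2 ≤ b v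
    · obtain ⟨v, hv⟩ := h
      exact (acyclic_cellFamily hv).cohomDim_eq_zero _
    · push Not at h
      have hbs : squarefreeExp b.support = b := by
        ext v
        have := h v
        rw [squarefreeExp_apply]
        split_ifs with hv
        · have : b v ≠ 0 := by simpa using hv
          omega
        · exact (Finsupp.notMem_support_iff.1 hv).symm
      refine absurd ⟨b.support, ?_, hbs⟩ hb'
      rw [mem_finsuppAntidiag_univ, ← hbs, degree_squarefreeExp] at hb
      simpa using hb
  · intro W hW
    rw [cellFamily_squarefreeExp, support_squarefreeExp, (Finset.mem_powersetCard.1 hW).2]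

end HochsterFormula

/-! ### Induced subcomplexes of the cross-polytope. -/

section CrossPolytope

set_option linter.unusedSectionVars false

variable {V F : Type*} [LinearOrder V] [Fintype V] [Field F]

theorem isLowerSet_induced {K : Set (Finset V)} (hK : IsLowerSet K) (W : Finset V) :
    IsLowerSet (induced K W) := fun _ _ hle h => ⟨hK hle h.1, hle.trans h.2⟩

/-- Peeling off the sets which miss some `b i` by toggling `a i`. -/
theorem cohomDim_eq_of_peel {ι : Type*} [DecidableEq ι] {K : Set (Finset V)}
    (hK : K.OrdConnected) (a b : ι → V) (hab : ∀ i j, a i ≠ b j) (I : Finset ι)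
    (h : ∀ i ∈ I, ∀ σ, b i ∉ σ → a i ∉ σ → (insert (a i) σ ∈ K ↔ σ ∈ K)) (q : ℤ) :
    cohomDim F K q = cohomDim F {σ | σ ∈ K ∧ ∀ i ∈ I, b i ∈ σ} q := by
  induction I using Finset.induction_on with
  | empty => simp
  | insert i I hi ih =>
    rw [ih fun j hj => h j (Finset.mem_insert_of_mem hj)]
    have hsplit : LowerSplit {σ | σ ∈ K ∧ ∀ j ∈ I, b j ∈ σ}
        {σ | (σ ∈ K ∧ ∀ j ∈ I, b j ∈ σ) ∧ b i ∉ σ}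
        {σ | σ ∈ K ∧ ∀ j ∈ insert i I, b j ∈ σ} := by
      refine ⟨⟨fun σ hσ τ hτ ρ hρ => ⟨hK.out hσ.1 hτ.1 hρ, fun j hj => hρ.1 (hσ.2 j hj)⟩⟩,
        fun σ => ?_, fun σ hσ τ hτ hle => hτ.2 (hle (hσ.2 i (Finset.mem_insert_self i I)))⟩
      simp only [Set.mem_ofPred_eq, Finset.forall_mem_insert]
      tauto
    -- The sets missing `b i` form a lower part. Toggling `a i` does not affect the conditions on
    -- the other `b j`, since no `a i` equals a `b j`.
    refine hsplit.cohomDim_eq_of_acyclic (acyclic_of_toggle (a i) fun σ hσ => ?_) q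
    simp only [Set.mem_ofPred_eq, Finset.mem_insert, (hab i _).symm, false_or]
    refine and_congr_left fun hb => and_congr_left fun _ => ?_
    exact h i (Finset.mem_insert_self i I) σ hb hσ

variable {d : ℕ}

/-- The faces of the cross-polytope with vertices `e`, including the empty face. -/
def crossFaces (e : Fin d × Bool ↪ V) : Set (Finset V) :=
  {σ | (∀ v ∈ σ, v ∈ Set.range e) ∧ ∀ i, ¬ (e (i, true) ∈ σ ∧ e (i, false) ∈ σ)}

theorem isLowerSet_crossFaces (e : Fin d × Bool ↪ V) : IsLowerSet (crossFaces e) :=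
  fun _ _ hle h => ⟨fun v hv => h.1 v (hle hv), fun i hi => h.2 i ⟨hle hi.1, hle hi.2⟩⟩

theorem allFaces_map_crossPolytope (e : Fin d × Bool ↪ V) :
    allFaces ((crossPolytope d).toPreAbstractSimplicialComplex.map e) = crossFaces e := by
  ext σ
  constructor
  · rintro (rfl | ⟨T, ⟨_, hT⟩, rfl⟩)
    · exact ⟨by simp, by simp⟩
    · refine ⟨fun v hv => ?_, fun i => ?_⟩
      · obtain ⟨x, _, rfl⟩ := Finset.mem_image.1 hv
        exact ⟨x, rfl⟩
      · simpa using hT i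
  · rintro ⟨h1, h2⟩
    rcases σ.eq_empty_or_nonempty with rfl | hne
    · exact Or.inl rfl
    · refine Or.inr ⟨σ.preimage e e.injective.injOn, ⟨?_, fun i => ?_⟩, ?_⟩
      · obtain ⟨v, hv⟩ := hne
        obtain ⟨x, rfl⟩ := h1 v hv
        exact ⟨x, by simpa using hv⟩
      · simpa using h2 i
      · dsimp only
        rw [Finset.image_preimage, Finset.filter_true_of_mem h1]

/-- Exchanging the names of the two vertices of some pairs. -/
def flipPairs (t : Fin d → Bool) (e : Fin d × Bool ↪ V) : Fin d × Bool ↪ V where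
  toFun x := e (x.1, xor x.2 (t x.1))
  inj' x y h := by
    have := e.injective h
    obtain ⟨x1, x2⟩ := x
    obtain ⟨y1, y2⟩ := y
    simp only [Prod.mk.injEq] at this
    obtain ⟨rfl, h2⟩ := this
    simpa using h2

theorem flipPairs_apply (t : Fin d → Bool) (e : Fin d × Bool ↪ V) (i : Fin d) (β : Bool) :
    flipPairs t e (i, β) = e (i, xor β (t i)) := rfl

theorem range_flipPairs (t : Fin d → Bool) (e : Fin d × Bool ↪ V) :
    Set.range (flipPairs t e) = Set.range e := by
  ext v
  constructor
  · rintro ⟨x, rfl⟩; exact ⟨_, rfl⟩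
  · rintro ⟨⟨i, β⟩, rfl⟩
    exact ⟨(i, xor β (t i)), by simp [flipPairs_apply]⟩

theorem crossFaces_flipPairs (t : Fin d → Bool) (e : Fin d × Bool ↪ V) :
    crossFaces (flipPairs t e) = crossFaces e := by
  ext σ
  unfold crossFaces
  rw [Set.mem_ofPred_eq, Set.mem_ofPred_eq, range_flipPairs]
  refine and_congr_right fun _ => forall_congr' fun i => ?_
  rw [flipPairs_apply, flipPairs_apply]
  cases t i
  · simp
  · simp [and_comm]

/-- The vertices `e (i, β)` for `i ∈ I`. -/
def sideVertices (e : Fin d × Bool ↪ V) (β : Bool) (I : Finset (Fin d)) : Finset V :=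
  I.image fun i => e (i, β)

theorem mem_sideVertices {e : Fin d × Bool ↪ V} {β γ : Bool} {I : Finset (Fin d)} {i : Fin d} :
    e (i, γ) ∈ sideVertices e β I ↔ γ = β ∧ i ∈ I := by
  simp only [sideVertices, Finset.mem_image, e.injective.eq_iff, Prod.mk.injEq]
  constructor
  · rintro ⟨j, hj, rfl, rfl⟩; exact ⟨rfl, hj⟩
  · rintro ⟨rfl, hi⟩; exact ⟨i, hi, rfl, rfl⟩

theorem card_sideVertices (e : Fin d × Bool ↪ V) (β : Bool) (I : Finset (Fin d)) :
    (sideVertices e β I).card = I.card :=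
  Finset.card_image_of_injective _ fun _ _ h => (Prod.mk.inj (e.injective h)).1

theorem sideVertices_mem_crossFaces (e : Fin d × Bool ↪ V) (β : Bool) (I : Finset (Fin d)) :
    sideVertices e β I ∈ crossFaces e := by
  refine ⟨fun v hv => ?_, fun i hi => ?_⟩
  · obtain ⟨i, _, rfl⟩ := Finset.mem_image.1 hv
    exact ⟨_, rfl⟩
  · rw [mem_sideVertices, mem_sideVertices] at hi
    exact absurd (hi.1.1.trans hi.2.1.symm) (by simp)

theorem exists_flip_of_mem {e : Fin d × Bool ↪ V} {σ : Finset V} (hσ : σ ∈ crossFaces e)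
    (h : ∀ i, ∃ β, e (i, β) ∈ σ) :
    ∃ t : Fin d → Bool, σ = sideVertices (flipPairs t e) true Finset.univ := by
  choose s hs using h
  -- The flip is the negation because `xor true (!(s i)) = s i`.
  refine ⟨fun i => !(s i), ?_⟩
  ext v
  constructor
  · intro hv
    obtain ⟨⟨i, β⟩, rfl⟩ := hσ.1 v hv
    refine Finset.mem_image.2 ⟨i, Finset.mem_univ i, ?_⟩
    rw [flipPairs_apply]
    have := hσ.2 i
    have h2 := hs i
    cases hsi : s i <;> cases β <;> simp_all
  · intro hv
    obtain ⟨i, _, rfl⟩ := Finset.mem_image.1 hv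
    rw [flipPairs_apply]
    simpa using hs i

/-- A face has at most one vertex in each antipodal pair, so its vertices correspond to the pairs it
meets. -/
theorem crossFaces_card_image {e : Fin d × Bool ↪ V} {σ : Finset V} (hσ : σ ∈ crossFaces e) :
    (Finset.univ.filter fun i : Fin d => ∃ β, e (i, β) ∈ σ).card = σ.card := by
  have h : (Finset.univ.filter fun i : Fin d => ∃ β, e (i, β) ∈ σ).image
      (fun i => if e (i, true) ∈ σ then e (i, true) else e (i, false)) = σ := by
    ext v
    simp only [Finset.mem_image, Finset.mem_filter, Finset.mem_univ, true_and]
    constructor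
    · rintro ⟨i, ⟨β, hβ⟩, rfl⟩
      split_ifs with hi
      · exact hi
      · cases β
        · exact hβ
        · exact absurd hβ hi
    · intro hv
      obtain ⟨⟨i, β⟩, rfl⟩ := hσ.1 v hv
      refine ⟨i, ⟨β, hv⟩, ?_⟩
      cases β
      · rw [if_neg fun h => hσ.2 i ⟨h, hv⟩]
      · rw [if_pos hv]
  rw [← Finset.card_image_of_injective _ (f := fun i =>
    if e (i, true) ∈ σ then e (i, true) else e (i, false)), h]
  intro i j hij
  dsimp only at hij
  split_ifs at hij <;> exact (Prod.mk.inj (e.injective hij)).1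

theorem card_le_of_mem_crossFaces {e : Fin d × Bool ↪ V} {σ : Finset V}
    (hσ : σ ∈ crossFaces e) : σ.card ≤ d := by
  rw [← crossFaces_card_image hσ]
  exact (Finset.card_le_univ _).trans (Fintype.card_fin d).le

theorem exists_flip_of_card {e : Fin d × Bool ↪ V} {σ : Finset V} (hσ : σ ∈ crossFaces e)
    (h : σ.card = d) : ∃ t : Fin d → Bool, σ = sideVertices (flipPairs t e) true Finset.univ := by
  refine exists_flip_of_mem hσ fun i => ?_
  have h1 : (Finset.univ.filter fun i : Fin d => ∃ β, e (i, β) ∈ σ) = Finset.univ := by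
    rw [← Finset.card_eq_iff_eq_univ, crossFaces_card_image hσ, h, Fintype.card_fin]
  have h2 := Finset.mem_univ i
  rw [← h1] at h2
  exact (Finset.mem_filter.1 h2).2

theorem exists_flip_of_isFacet {e : Fin d × Bool ↪ V} {G : Finset V}
    (hG : IsFacet ((crossPolytope d).toPreAbstractSimplicialComplex.map e) G) :
    ∃ t : Fin d → Bool, G = sideVertices (flipPairs t e) true Finset.univ := by
  have hmem : G ∈ crossFaces e := by
    rw [← allFaces_map_crossPolytope]; exact Or.inr hG.1
  refine exists_flip_of_mem hmem fun i => ?_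
  by_contra! hi
  have h1 : insert (e (i, true)) G ∈ crossFaces e := by
    refine ⟨fun v hv => ?_, fun j hj => ?_⟩
    · rcases Finset.mem_insert.1 hv with rfl | hv
      · exact ⟨_, rfl⟩
      · exact hmem.1 v hv
    · simp only [Finset.mem_insert, e.injective.eq_iff, Prod.mk.injEq] at hj
      rcases hj.1 with ⟨rfl, _⟩ | h1
      · exact hi false (by simpa using hj.2)
      · exact hmem.2 j ⟨h1, by simpa using hj.2⟩
  rw [← allFaces_map_crossPolytope] at h1
  rcases h1 with h1 | h1
  · exact Finset.insert_ne_empty _ _ h1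
  · exact hi true (hG.2 h1 (Finset.subset_insert _ _) (Finset.mem_insert_self _ _))

/-- When `W` contains exactly one vertex of some pair, the induced complex is a cone with that
vertex as apex. -/
theorem acyclic_induced_crossFaces {e : Fin d × Bool ↪ V} {W : Finset V} {i : Fin d} {β : Bool}
    (h : e (i, β) ∈ W) (h' : e (i, !β) ∉ W) : Acyclic F (induced (crossFaces e) W) := by
  refine acyclic_of_toggle (e (i, β)) fun σ hσ => ⟨fun hm =>
    isLowerSet_induced (isLowerSet_crossFaces e) W (Finset.subset_insert _ _) hm, fun hm => ?_⟩
  refine ⟨⟨fun v hv => ?_, fun j hj => ?_⟩, Finset.insert_subset h hm.2⟩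
  · rcases Finset.mem_insert.1 hv with rfl | hv
    · exact ⟨_, rfl⟩
    · exact hm.1.1 v hv
  · simp only [Finset.mem_insert, e.injective.eq_iff, Prod.mk.injEq] at hj
    have hn : e (i, !β) ∉ σ := fun h => h' (hm.2 h)
    by_cases hji : j = i
    · subst hji
      cases β <;> simp_all
    · simp only [hji, false_and, false_or] at hj
      exact hm.1.2 j hj

/-- When `W` is a union of pairs, peeling with one vertex of each pair leaves the single cell of
their opposites: the induced complex is a smaller cross-polytopal sphere. -/
theorem cohomDim_induced_crossFaces {e : Fin d × Bool ↪ V} {W : Finset V}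
    (h : ∀ i, e (i, true) ∈ W ↔ e (i, false) ∈ W) (q : ℤ) :
    cohomDim F (induced (crossFaces e) W) q =
      if ((Finset.univ.filter fun i => e (i, true) ∈ W).card : ℤ) = q then 1 else 0 := by
  have hlow := isLowerSet_induced (isLowerSet_crossFaces e) W
  set I := Finset.univ.filter fun i => e (i, true) ∈ W with hI
  rw [cohomDim_eq_of_peel hlow.ordConnected (fun i => e (i, false)) (fun i => e (i, true))
    (fun i j hij => by simpa using e.injective hij) I]
  · have : {σ | σ ∈ induced (crossFaces e) W ∧ ∀ i ∈ I, e (i, true) ∈ σ} =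
        {sideVertices e true I} := by
      ext σ
      rw [Set.mem_ofPred_eq, Set.mem_singleton_iff]
      constructor
      · rintro ⟨⟨h1, h2⟩, h3⟩
        ext v
        constructor
        · intro hv
          obtain ⟨⟨i, β⟩, rfl⟩ := h1.1 v hv
          have hi : i ∈ I := by
            rw [hI, Finset.mem_filter]
            cases β
            · exact ⟨Finset.mem_univ i, (h i).2 (h2 hv)⟩
            · exact ⟨Finset.mem_univ i, h2 hv⟩
          cases β
          · exact absurd ⟨h3 i hi, hv⟩ (h1.2 i)
          · exact mem_sideVertices.2 ⟨rfl, hi⟩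
        · intro hv
          obtain ⟨i, hi, rfl⟩ := Finset.mem_image.1 hv
          exact h3 i hi
      · rintro rfl
        refine ⟨⟨sideVertices_mem_crossFaces e true I, fun v hv => ?_⟩, fun i hi =>
          mem_sideVertices.2 ⟨rfl, hi⟩⟩
        obtain ⟨i, hi, rfl⟩ := Finset.mem_image.1 hv
        exact (Finset.mem_filter.1 hi).2
    rw [this, cohomDim_singleton, card_sideVertices]
  · intro i hi σ h1 h2
    refine ⟨fun hm => hlow (Finset.subset_insert _ _) hm, fun hm => ⟨⟨fun v hv => ?_,
      fun j hj => ?_⟩, Finset.insert_subset ((h i).1 (Finset.mem_filter.1 hi).2) hm.2⟩⟩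
    · rcases Finset.mem_insert.1 hv with rfl | hv
      · exact ⟨_, rfl⟩
      · exact hm.1.1 v hv
    · simp only [Finset.mem_insert, e.injective.eq_iff, Prod.mk.injEq] at hj
      by_cases hji : j = i
      · subst hji; simp_all
      · simp only [hji, false_and, false_or] at hj
        exact hm.1.2 j hj

theorem isLowerSet_diff_top {K : Set (Finset V)} (hK : IsLowerSet K) {G : Finset V}
    (hmax : ∀ σ ∈ K, σ.card ≤ G.card) : IsLowerSet (K \ {G}) := by
  refine fun τ σ hle h => ⟨hK hle h.1, ?_⟩
  rintro rfl
  exact h.2 (Finset.eq_of_subset_of_card_le hle (hmax τ h.1)).symm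

/-- After a flip, `G` consists of the vertices `(i, true)`. Peeling by the opposite vertices leaves
only sets containing `G`, that is `G` itself, which has been removed; and toggling never produces
`G`, as it inserts vertices outside it. -/
theorem acyclic_crossFaces_diff {e : Fin d × Bool ↪ V} {G : Finset V}
    (hG : G ∈ crossFaces e) (hd : G.card = d) : Acyclic F (crossFaces e \ {G}) := by
  obtain ⟨t, ht⟩ := exists_flip_of_card hG hd
  rw [← crossFaces_flipPairs t e] at hG ⊢
  set f := flipPairs t e
  have hlow : IsLowerSet (crossFaces f \ {G}) := isLowerSet_diff_top (isLowerSet_crossFaces f)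
    fun σ hσ => by rw [hd]; exact card_le_of_mem_crossFaces hσ
  rw [acyclic_iff hlow.ordConnected]
  intro q
  rw [cohomDim_eq_of_peel hlow.ordConnected (fun i => f (i, false)) (fun i => f (i, true))
    (fun i j hij => by simpa using f.injective hij) Finset.univ]
  · convert cohomDim_empty (V := V) (F := F) q
    rw [Set.eq_empty_iff_forall_notMem]
    rintro σ ⟨⟨h1, h2⟩, h3⟩
    refine h2 (Finset.eq_of_subset_of_card_le (s := G) ?_ ?_).symm
    · rw [ht]
      intro v hv
      obtain ⟨i, hi, rfl⟩ := Finset.mem_image.1 hv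
      exact h3 i hi
    · rw [hd]; exact card_le_of_mem_crossFaces h1
  · intro i _ σ h1 h2
    refine ⟨fun hm => hlow (Finset.subset_insert _ _) hm, fun hm => ⟨⟨fun v hv => ?_,
      fun j hj => ?_⟩, ?_⟩⟩
    · rcases Finset.mem_insert.1 hv with rfl | hv
      · exact ⟨_, rfl⟩
      · exact hm.1.1 v hv
    · simp only [Finset.mem_insert, f.injective.eq_iff, Prod.mk.injEq] at hj
      by_cases hji : j = i
      · subst hji; simp_all
      · simp only [hji, false_and, false_or] at hj
        exact hm.1.2 j hj
    · rintro hins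
      have : f (i, false) ∈ G := hins ▸ Finset.mem_insert_self _ _
      rw [ht, mem_sideVertices] at this
      simp at this

end CrossPolytope

/-! ### Cohomology of connected sums of homology spheres and of their induced subcomplexes. -/

section ConnectedSum

set_option linter.unusedSectionVars false

variable {V F : Type*} [LinearOrder V] [Fintype V] [Field F]

/-- Removing the faces of a nonempty simplex does not change the cohomology. -/
theorem cohomDim_diff_Iic {P : Set (Finset V)} (hP : P.OrdConnected) {G : Finset V}
    (hG : G.Nonempty) (hsub : Set.Iic G ⊆ P) (q : ℤ) :
    cohomDim F (P \ Set.Iic G) q = cohomDim F P q := by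
  have hsplit : LowerSplit P (Set.Iic G) (P \ Set.Iic G) := by
    refine ⟨hP, fun σ => ?_, fun σ hσ τ hτ hle => hσ.2 (hle.trans hτ)⟩
    by_cases h : σ ∈ Set.Iic G
    · simp [h, hsub h]
    · simp [h]
  obtain ⟨v, hv⟩ := hG
  refine (hsplit.cohomDim_eq_of_acyclic (acyclic_of_toggle v fun σ _ => ?_) q).symm
  rw [Set.mem_Iic, Set.mem_Iic, Finset.insert_subset_iff]
  exact and_iff_right hv

/-- The cohomology of a union of two complexes intersecting in a nonempty simplex. -/
theorem cohomDim_union {A B : Set (Finset V)} (hA : IsLowerSet A) (hB : IsLowerSet B)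
    {S : Finset V} (hS : S.Nonempty) (h : A ∩ B = Set.Iic S) (q : ℤ) :
    cohomDim F (A ∪ B) q = cohomDim F A q + cohomDim F B q := by
  have hSA : Set.Iic S ⊆ A := h ▸ Set.inter_subset_left
  have hSB : Set.Iic S ⊆ B := h ▸ Set.inter_subset_right
  have hAB := hA.union hB
  have hconv : ((A ∪ B) \ Set.Iic S).OrdConnected :=
    ⟨fun σ hσ τ hτ ρ hρ => ⟨hAB hρ.2 hτ.1, fun hm => hσ.2 (hρ.1.trans hm)⟩⟩
  have hor : ∀ σ, σ ∈ (A ∪ B) \ Set.Iic S ↔ σ ∈ A \ Set.Iic S ∨ σ ∈ B \ Set.Iic S := by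
    intro σ
    simp only [Set.mem_sdiff, Set.mem_union]
    tauto
  have hsplit : LowerSplit ((A ∪ B) \ Set.Iic S) (A \ Set.Iic S) (B \ Set.Iic S) :=
    ⟨hconv, hor, fun σ hσ τ hτ hle => hσ.2 (h ▸ ⟨hA hle hτ.1, hσ.1⟩)⟩
  have hsplit' : LowerSplit ((A ∪ B) \ Set.Iic S) (B \ Set.Iic S) (A \ Set.Iic S) :=
    ⟨hconv, fun σ => (hor σ).trans or_comm,
      fun σ hσ τ hτ hle => hσ.2 (h ▸ ⟨hσ.1, hB hle hτ.1⟩)⟩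
  -- Once the faces of the acyclic simplex `S` are removed everywhere, no incidences remain between
  -- the two sides and the cohomology is additive.
  rw [← cohomDim_diff_Iic hAB.ordConnected hS (hSA.trans Set.subset_union_left),
    ← cohomDim_diff_Iic hA.ordConnected hS hSA, ← cohomDim_diff_Iic hB.ordConnected hS hSB,
    hsplit.cohomDim_eq_add hsplit']

/-- The cohomology of a disjoint union of two complexes, without the empty set. -/
theorem cohomDim_union_diff_empty {A B : Set (Finset V)} (hA : IsLowerSet A) (hB : IsLowerSet B)
    (h : A ∩ B ⊆ {∅}) (q : ℤ) :
    cohomDim F ((A ∪ B) \ {∅}) q = cohomDim F (A \ {∅}) q + cohomDim F (B \ {∅}) q := by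
  have hAB := hA.union hB
  have hconv : ((A ∪ B) \ {∅}).OrdConnected :=
    ⟨fun σ hσ τ hτ ρ hρ => ⟨hAB hρ.2 hτ.1, fun hm => hσ.2
      (Finset.subset_empty.1 (by rw [← (show ρ = ∅ from hm)]; exact hρ.1))⟩⟩
  have hor : ∀ σ, σ ∈ (A ∪ B) \ {∅} ↔ σ ∈ A \ {∅} ∨ σ ∈ B \ {∅} := by
    intro σ
    simp only [Set.mem_sdiff, Set.mem_union]
    tauto
  have hsplit : LowerSplit ((A ∪ B) \ {∅}) (A \ {∅}) (B \ {∅}) :=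
    ⟨hconv, hor, fun σ hσ τ hτ hle => hσ.2 (h ⟨hA hle hτ.1, hσ.1⟩)⟩
  have hsplit' : LowerSplit ((A ∪ B) \ {∅}) (B \ {∅}) (A \ {∅}) :=
    ⟨hconv, fun σ => (hor σ).trans or_comm,
      fun σ hσ τ hτ hle => hσ.2 (h ⟨hσ.1, hB hle hτ.1⟩)⟩
  exact hsplit.cohomDim_eq_add hsplit' q

/-- Gluing a family to an acyclic complex along the faces of a simplex. -/
theorem cohomDim_union_of_acyclic {P A R : Set (Finset V)} (hP : P.OrdConnected)
    (hA : Acyclic F A) {G : Finset V} (hG : G.Nonempty) (hR : R.OrdConnected)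
    (hGR : Set.Iic G ⊆ R) (hor : ∀ σ, σ ∈ P ↔ σ ∈ A ∨ σ ∈ R \ Set.Iic G)
    (hlow : ∀ σ ∈ R \ Set.Iic G, ∀ τ ∈ A, ¬ σ ⊆ τ) (q : ℤ) :
    cohomDim F P q = cohomDim F R q := by
  rw [← cohomDim_diff_Iic hR hG hGR]
  exact LowerSplit.cohomDim_eq_of_acyclic ⟨hP, hor, hlow⟩ hA q

/-- The homological properties of spheres of dimension `d - 1` with vertex set `X` which are
used for connected sums. -/
structure IsHomologySphere (F : Type*) [Field F] (d : ℕ) (K : Set (Finset V)) (X : Finset V) :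
    Prop where
  isLowerSet : IsLowerSet K
  empty_mem : ∅ ∈ K
  subset : ∀ σ ∈ K, σ ⊆ X
  vertex : ∀ v ∈ X, {v} ∈ K
  card_le : ∀ σ ∈ K, σ.card ≤ d
  cohomDim_eq : ∀ q : ℤ, cohomDim F K q = if (d : ℤ) = q then 1 else 0
  acyclic_diff : ∀ G ∈ K, G.card = d → Acyclic F (K \ {G})
  cohomDim_induced_top : ∀ W, ¬ X ⊆ W → cohomDim F (induced K W) d = 0

theorem induced_eq_self {K : Set (Finset V)} {X W : Finset V} (h : ∀ σ ∈ K, σ ⊆ X)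
    (hW : X ⊆ W) : induced K W = K :=
  Set.ext fun _ => ⟨fun hσ => hσ.1, fun hσ => ⟨hσ, (h _ hσ).trans hW⟩⟩

theorem induced_eq_singleton_empty {K : Set (Finset V)} {X W : Finset V} (h : ∀ σ ∈ K, σ ⊆ X)
    (h0 : ∅ ∈ K) (hW : Disjoint X W) : induced K W = {∅} := by
  ext σ
  constructor
  · rintro ⟨h1, h2⟩
    exact Finset.subset_empty.1 ((Finset.disjoint_iff_inter_eq_empty.1 hW) ▸
      Finset.subset_inter (h σ h1) h2)
  · rintro rfl
    exact ⟨h0, Finset.empty_subset _⟩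

theorem induced_union_diff {A B : Set (Finset V)} {G W : Finset V} (h : ¬ G ⊆ W) :
    induced ((A ∪ B) \ {G}) W = induced A W ∪ induced B W := by
  ext σ
  constructor
  · rintro ⟨⟨h1 | h1, _⟩, h2⟩
    · exact Or.inl ⟨h1, h2⟩
    · exact Or.inr ⟨h1, h2⟩
  · rintro (⟨h1, h2⟩ | ⟨h1, h2⟩)
    · exact ⟨⟨Or.inl h1, fun e => h ((show σ = G from e) ▸ h2)⟩, h2⟩
    · exact ⟨⟨Or.inr h1, fun e => h ((show σ = G from e) ▸ h2)⟩, h2⟩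

theorem induced_union_diff_of_subset {A B : Set (Finset V)} {G W : Finset V} :
    induced ((A ∪ B) \ {G}) W = (induced A W ∪ induced B W) \ {G} := by
  ext σ
  simp only [induced, Set.mem_ofPred_eq, Set.mem_sdiff, Set.mem_union]
  tauto

/-- The complexes `A` and `B` intersect in the common facet `G`. -/
structure Gluing (F : Type*) [Field F] (d : ℕ) (A B : Set (Finset V)) (X Y G : Finset V) :
    Prop where
  left : IsHomologySphere F d A X
  right : IsHomologySphere F d B Y
  mem_left : G ∈ A
  mem_right : G ∈ B
  card_eq : G.card = d
  inter_subset : X ∩ Y ⊆ G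

namespace Gluing

variable {d : ℕ} {A B : Set (Finset V)} {X Y G : Finset V}

theorem symm (h : Gluing F d A B X Y G) : Gluing F d B A Y X G :=
  ⟨h.right, h.left, h.mem_right, h.mem_left, h.card_eq, by
    rw [Finset.inter_comm]; exact h.inter_subset⟩

theorem inter_eq (h : Gluing F d A B X Y G) : A ∩ B = Set.Iic G := by
  ext σ
  constructor
  · rintro ⟨h1, h2⟩
    exact (Finset.subset_inter (h.left.subset σ h1) (h.right.subset σ h2)).trans h.inter_subset
  · intro hσ
    exact ⟨h.left.isLowerSet hσ h.mem_left, h.right.isLowerSet hσ h.mem_right⟩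

theorem induced_inter (h : Gluing F d A B X Y G) (W : Finset V) :
    induced A W ∩ induced B W = Set.Iic (W ∩ G) := by
  have e := h.inter_eq
  ext σ
  have : σ ∈ A ∩ B ↔ σ ∈ Set.Iic G := by rw [e]
  simp only [Set.mem_inter_iff, Set.mem_Iic] at this
  simp only [induced, Set.mem_inter_iff, Set.mem_ofPred_eq, Set.mem_Iic,
    Finset.subset_inter_iff]
  tauto

theorem isLowerSet_union_diff (h : Gluing F d A B X Y G) : IsLowerSet ((A ∪ B) \ {G}) := by
  refine isLowerSet_diff_top (h.left.isLowerSet.union h.right.isLowerSet) ?_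
  rintro σ (hσ | hσ)
  · rw [h.card_eq]; exact h.left.card_le σ hσ
  · rw [h.card_eq]; exact h.right.card_le σ hσ

theorem subset_union (h : Gluing F d A B X Y G) : ∀ σ ∈ (A ∪ B) \ {G}, σ ⊆ X ∪ Y := by
  rintro σ ⟨hσ | hσ, _⟩
  · exact (h.left.subset σ hσ).trans Finset.subset_union_left
  · exact (h.right.subset σ hσ).trans Finset.subset_union_right

theorem subset_left (h : Gluing F d A B X Y G) : G ⊆ X := h.left.subset G h.mem_left

theorem nonempty (h : Gluing F d A B X Y G) (hd : 0 < d) : G.Nonempty := by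
  rw [← Finset.card_pos, h.card_eq]; exact hd

/-- If `W` contains all vertices of `A`, then the restriction of the connected sum to `W` looks
like the restriction of `B`. -/
theorem cohomDim_of_subset (h : Gluing F d A B X Y G) (hd : 0 < d) {W : Finset V} (hW : X ⊆ W)
    (q : ℤ) : cohomDim F (induced ((A ∪ B) \ {G}) W) q = cohomDim F (induced B W) q := by
  have hGW := h.subset_left.trans hW
  -- The acyclic lower part is `A \ {G}`, a sphere minus a facet. What lies above it is the part of
  -- `B` induced on `W`, minus the faces of `G`.
  refine cohomDim_union_of_acyclic
    (isLowerSet_induced h.isLowerSet_union_diff W).ordConnected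
    (h.left.acyclic_diff G h.mem_left h.card_eq) (h.nonempty hd)
    (isLowerSet_induced h.right.isLowerSet W).ordConnected ?_ ?_ ?_ q
  · exact fun σ hσ => ⟨h.right.isLowerSet hσ h.mem_right, le_trans hσ hGW⟩
  · intro σ
    constructor
    · rintro ⟨⟨h1 | h1, h2⟩, h3⟩
      · exact Or.inl ⟨h1, h2⟩
      · by_cases hσ : σ ∈ Set.Iic G
        · exact Or.inl ⟨h.left.isLowerSet hσ h.mem_left, h2⟩
        · exact Or.inr ⟨⟨h1, h3⟩, hσ⟩
    · rintro (⟨h1, h2⟩ | ⟨⟨h1, h3⟩, h2⟩)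
      · exact ⟨⟨Or.inl h1, h2⟩, (h.left.subset σ h1).trans hW⟩
      · exact ⟨⟨Or.inr h1, fun e => h2 (le_of_eq e)⟩, h3⟩
  · intro σ hσ τ hτ hle
    exact hσ.2 (h.inter_eq ▸ ⟨h.left.isLowerSet hle hτ.1, hσ.1.1⟩)

theorem cohomDim_induced_of_meets (h : Gluing F d A B X Y G) {W : Finset V}
    (hW : (W ∩ G).Nonempty) (q : ℤ) : cohomDim F (induced A W ∪ induced B W) q =
      cohomDim F (induced A W) q + cohomDim F (induced B W) q :=
  cohomDim_union (isLowerSet_induced h.left.isLowerSet W)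
    (isLowerSet_induced h.right.isLowerSet W) hW (h.induced_inter W) q

theorem induced_inter_subset (h : Gluing F d A B X Y G) {W : Finset V} (hW : W ∩ G = ∅) :
    induced A W ∩ induced B W ⊆ {∅} := by
  rw [h.induced_inter W, hW]
  exact fun σ hσ => Finset.subset_empty.1 hσ

/-- If `W` misses `G`, the two restrictions share only the empty set, whose removal is invisible in
cardinality at least 2; otherwise they meet in a nonempty simplex. -/
theorem cohomDim_induced_of_two_le (h : Gluing F d A B X Y G) (W : Finset V) {q : ℤ}
    (hq : 2 ≤ q) : cohomDim F (induced A W ∪ induced B W) q =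
      cohomDim F (induced A W) q + cohomDim F (induced B W) q := by
  rcases (W ∩ G).eq_empty_or_nonempty with hW | hW
  · rw [← cohomDim_diff_empty_of_ne (by omega) (by omega),
      ← cohomDim_diff_empty_of_ne (P := induced A W) (by omega) (by omega),
      ← cohomDim_diff_empty_of_ne (P := induced B W) (by omega) (by omega)]
    exact cohomDim_union_diff_empty (isLowerSet_induced h.left.isLowerSet W)
      (isLowerSet_induced h.right.isLowerSet W) (h.induced_inter_subset hW) q
  · exact h.cohomDim_induced_of_meets hW q

/-- Unreduced cohomology is additive for disjoint unions. Passing to reduced cohomology subtracts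
one on the left and two on the right, whence the extra class. -/
theorem cohomDim_induced_one (h : Gluing F d A B X Y G) {W : Finset V} (hW : W ∩ G = ∅)
    (hX : (W ∩ X).Nonempty) (hY : (W ∩ Y).Nonempty) :
    cohomDim F (induced A W ∪ induced B W) 1 =
      cohomDim F (induced A W) 1 + cohomDim F (induced B W) 1 + 1 := by
  obtain ⟨x, hx⟩ := hX
  obtain ⟨y, hy⟩ := hY
  rw [Finset.mem_inter] at hx hy
  have hA := isLowerSet_induced h.left.isLowerSet W
  have hB := isLowerSet_induced h.right.isLowerSet W
  have hxA : {x} ∈ induced A W := ⟨h.left.vertex x hx.2, by simpa using hx.1⟩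
  have hyB : {y} ∈ induced B W := ⟨h.right.vertex y hy.2, by simpa using hy.1⟩
  have e := cohomDim_union_diff_empty (F := F) hA hB (h.induced_inter_subset hW) 1
  rw [cohomDim_diff_empty (hA.union hB).ordConnected
      (Or.inl (hA (Finset.empty_subset _) hxA)) (Or.inl hxA),
    cohomDim_diff_empty hA.ordConnected (hA (Finset.empty_subset _) hxA) hxA,
    cohomDim_diff_empty hB.ordConnected (hB (Finset.empty_subset _) hyB) hyB] at e
  omega

theorem cohomDim_induced_of_disjoint (h : Gluing F d A B X Y G) {W : Finset V}
    (hY : W ∩ Y = ∅) {q : ℤ} (hq : 1 ≤ q) : cohomDim F (induced A W ∪ induced B W) q =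
      cohomDim F (induced A W) q + cohomDim F (induced B W) q := by
  have hB : induced B W = {∅} := induced_eq_singleton_empty h.right.subset h.right.empty_mem
    (by rw [Finset.disjoint_iff_inter_eq_empty, Finset.inter_comm]; exact hY)
  have hu : induced A W ∪ {∅} = induced A W := by
    refine Set.union_eq_left.2 ?_
    rintro σ rfl
    exact ⟨h.left.empty_mem, Finset.empty_subset _⟩
  rw [hB, hu, cohomDim_singleton, if_neg (by simp; omega), add_zero]

/-- The cohomology of the restrictions of the union of `A` and `B`. -/
theorem cohomDim_induced_union (h : Gluing F d A B X Y G) (W : Finset V) {q : ℤ} (hq : 1 ≤ q) :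
    cohomDim F (induced A W ∪ induced B W) q =
      cohomDim F (induced A W) q + cohomDim F (induced B W) q +
        if q = 1 ∧ W ∩ G = ∅ ∧ (W ∩ X).Nonempty ∧ (W ∩ Y).Nonempty then 1 else 0 := by
  split_ifs with hc
  · obtain ⟨rfl, h1, h2, h3⟩ := hc
    exact h.cohomDim_induced_one h1 h2 h3
  · rw [add_zero]
    by_cases hq2 : 2 ≤ q
    · exact h.cohomDim_induced_of_two_le W hq2
    · obtain rfl : q = 1 := by omega
      rcases (W ∩ G).eq_empty_or_nonempty with hW | hW
      swap
      · exact h.cohomDim_induced_of_meets hW 1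
      rcases (W ∩ Y).eq_empty_or_nonempty with hY | hY
      · exact h.cohomDim_induced_of_disjoint hY le_rfl
      rcases (W ∩ X).eq_empty_or_nonempty with hX | hX
      · rw [Set.union_comm, h.symm.cohomDim_induced_of_disjoint hX le_rfl, add_comm]
      · exact absurd ⟨rfl, hW, hX, hY⟩ hc

theorem cohomDim_induced_union_top (h : Gluing F d A B X Y G) (hd : 2 ≤ d) {W : Finset V}
    (hX : ¬ X ⊆ W) (hY : ¬ Y ⊆ W) : cohomDim F (induced A W ∪ induced B W) d = 0 := by
  rw [h.cohomDim_induced_of_two_le W (by exact_mod_cast hd), h.left.cohomDim_induced_top W hX,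
    h.right.cohomDim_induced_top W hY]

theorem card_le_union (h : Gluing F d A B X Y G) (W : Finset V) :
    ∀ σ ∈ induced A W ∪ induced B W, σ.card ≤ G.card := by
  rw [h.card_eq]
  rintro σ (hσ | hσ)
  · exact h.left.card_le σ hσ.1
  · exact h.right.card_le σ hσ.1

/-- The cohomology below the top dimension of the restrictions of a connected sum. -/
theorem cohomDim_induced (h : Gluing F d A B X Y G) (hd : 3 ≤ d) (W : Finset V) {q : ℤ}
    (hq : 1 ≤ q) (hqd : q < d) :
    cohomDim F (induced ((A ∪ B) \ {G}) W) q =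
      cohomDim F (induced A W) q + cohomDim F (induced B W) q +
        (if q = 1 ∧ W ∩ G = ∅ ∧ (W ∩ X).Nonempty ∧ (W ∩ Y).Nonempty then 1 else 0) +
        if q = d - 1 ∧ G ⊆ W ∧ ¬ X ⊆ W ∧ ¬ Y ⊆ W then 1 else 0 := by
  by_cases hGW : G ⊆ W
  swap
  · rw [induced_union_diff hGW, h.cohomDim_induced_union W hq]
    simp [hGW]
  have hne : W ∩ G ≠ ∅ := by
    rw [Finset.inter_eq_right.2 hGW]
    exact (h.nonempty (by omega)).ne_empty
  by_cases hX : X ⊆ W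
  -- Here the restriction of `A` is the whole sphere, with cohomology only in cardinality `d`, so it
  -- contributes nothing below `d` and both corrections vanish.
  · rw [h.cohomDim_of_subset (by omega) hX, induced_eq_self h.left.subset hX,
      h.left.cohomDim_eq, if_neg hqd.ne', if_neg fun hc => hne hc.2.1,
      if_neg fun hc => hc.2.2.1 hX]
    omega
  by_cases hY : Y ⊆ W
  · rw [Set.union_comm, h.symm.cohomDim_of_subset (by omega) hY, induced_eq_self h.right.subset hY,
      h.right.cohomDim_eq, if_neg hqd.ne', if_neg fun hc => hne hc.2.1,
      if_neg fun hc => hc.2.2.2 hY]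
    omega
  have hlow := ((isLowerSet_induced h.left.isLowerSet W).union
    (isLowerSet_induced h.right.isLowerSet W)).ordConnected
  have hmem : G ∈ induced A W ∪ induced B W := Or.inl ⟨h.mem_left, hGW⟩
  have htop := h.cohomDim_induced_union_top (by omega) hX hY
  have hu := h.cohomDim_induced_union W hq
  rw [induced_union_diff_of_subset, ← hu]
  by_cases hq1 : q = d - 1
  -- Neither summand is contained in `W`, so the union has no top cohomology and removing the cell
  -- `G` creates one class in cardinality `d - 1`.
  · rw [if_pos ⟨hq1, hGW, hX, hY⟩, hq1, ← h.card_eq]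
    exact cohomDim_diff_top hlow hmem (h.card_le_union W) (by rw [h.card_eq]; exact htop)
  · rw [if_neg fun hc => hq1 hc.1, add_zero]
    exact cohomDim_diff_top_of_lt hlow hmem (h.card_le_union W) (by rw [h.card_eq]; omega)

/-- Discarding the acyclic lower part `B \ {G}` and restoring the faces of `G` reduces the claim to
the acyclicity of `A \ {G'}`. -/
theorem acyclic_diff_of_mem_left (h : Gluing F d A B X Y G) (hd : 0 < d) {G' : Finset V}
    (hG' : G' ∈ A) (hne : G' ≠ G) (hcard : G'.card = d) :
    Acyclic F (((A ∪ B) \ {G}) \ {G'}) := by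
  have hlow : IsLowerSet (((A ∪ B) \ {G}) \ {G'}) := by
    refine isLowerSet_diff_top h.isLowerSet_union_diff ?_
    rintro σ ⟨hσ | hσ, _⟩
    · rw [hcard]; exact h.left.card_le σ hσ
    · rw [hcard]; exact h.right.card_le σ hσ
  have hlow' : IsLowerSet (A \ {G'}) :=
    isLowerSet_diff_top h.left.isLowerSet (by rw [hcard]; exact h.left.card_le)
  have hG'G : ¬ G' ⊆ G := fun hle =>
    hne (Finset.eq_of_subset_of_card_le hle (by rw [hcard, h.card_eq]))
  rw [acyclic_iff hlow.ordConnected]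
  intro q
  rw [cohomDim_union_of_acyclic (R := A \ {G'}) hlow.ordConnected
    (h.right.acyclic_diff G h.mem_right h.card_eq) (h.nonempty hd) hlow'.ordConnected]
  · exact (h.left.acyclic_diff G' hG' hcard).cohomDim_eq_zero q
  · refine fun σ hσ => ⟨h.left.isLowerSet hσ h.mem_left, ?_⟩
    rintro rfl
    exact hG'G hσ
  · intro σ
    constructor
    · rintro ⟨⟨h1 | h1, h2⟩, h3⟩
      · by_cases hσ : σ ∈ Set.Iic G
        · exact Or.inl ⟨h.right.isLowerSet hσ h.mem_right, h2⟩
        · exact Or.inr ⟨⟨h1, h3⟩, hσ⟩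
      · exact Or.inl ⟨h1, h2⟩
    · rintro (⟨h1, h2⟩ | ⟨⟨h1, h3⟩, h2⟩)
      · refine ⟨⟨Or.inr h1, h2⟩, ?_⟩
        rintro rfl
        exact hG'G (h.inter_eq ▸ ⟨hG', h1⟩ : σ ∈ Set.Iic G)
      · exact ⟨⟨Or.inl h1, fun e => h2 (le_of_eq e)⟩, h3⟩
  · intro σ hσ τ hτ hle
    exact hσ.2 (h.inter_eq ▸ ⟨hσ.1.1, h.right.isLowerSet hle hτ.1⟩)

/-- Connected sums of spheres are spheres. -/
theorem isHomologySphere (h : Gluing F d A B X Y G) (hd : 2 ≤ d) :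
    IsHomologySphere F d ((A ∪ B) \ {G}) (X ∪ Y) where
  isLowerSet := h.isLowerSet_union_diff
  empty_mem := ⟨Or.inl h.left.empty_mem, fun e =>
    (h.nonempty (by omega)).ne_empty (show ∅ = G from e).symm⟩
  subset := h.subset_union
  vertex v hv := by
    refine ⟨(Finset.mem_union.1 hv).imp (h.left.vertex v) (h.right.vertex v), fun e => ?_⟩
    have := h.card_eq
    rw [← (show {v} = G from e), Finset.card_singleton] at this
    omega
  card_le := by
    rintro σ ⟨hσ | hσ, _⟩
    · exact h.left.card_le σ hσ
    · exact h.right.card_le σ hσ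
  cohomDim_eq q := by
    have e := h.cohomDim_of_subset (by omega) (W := X ∪ Y) Finset.subset_union_left q
    rw [induced_eq_self h.right.subset Finset.subset_union_right,
      induced_eq_self h.subset_union subset_rfl] at e
    rw [e, h.right.cohomDim_eq]
  acyclic_diff G' hG' hcard := by
    obtain ⟨hG' | hG', hne⟩ := hG'
    · exact h.acyclic_diff_of_mem_left (by omega) hG' hne hcard
    · rw [Set.union_comm]
      exact h.symm.acyclic_diff_of_mem_left (by omega) hG' hne hcard
  cohomDim_induced_top W hW := by
    by_cases hX : X ⊆ W
    · rw [h.cohomDim_of_subset (by omega) hX]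
      exact h.right.cohomDim_induced_top W fun hY => hW (Finset.union_subset hX hY)
    by_cases hY : Y ⊆ W
    · rw [Set.union_comm, h.symm.cohomDim_of_subset (by omega) hY]
      exact h.left.cohomDim_induced_top W hX
    have htop := h.cohomDim_induced_union_top hd hX hY
    by_cases hGW : G ⊆ W
    · rw [induced_union_diff_of_subset]
      rw [← h.card_eq] at htop ⊢
      exact cohomDim_diff_top_eq_zero ((isLowerSet_induced h.left.isLowerSet W).union
        (isLowerSet_induced h.right.isLowerSet W)).ordConnected (Or.inl ⟨h.mem_left, hGW⟩)
        (h.card_le_union W) htop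
    · rw [induced_union_diff hGW, htop]

end Gluing

/-- The vertices of the cross-polytope. -/
def crossVertices {d : ℕ} (e : Fin d × Bool ↪ V) : Finset V := Finset.univ.map e

theorem isHomologySphere_crossFaces {d : ℕ} (e : Fin d × Bool ↪ V) :
    IsHomologySphere F d (crossFaces e) (crossVertices e) where
  isLowerSet := isLowerSet_crossFaces e
  empty_mem := ⟨by simp, by simp⟩
  subset σ hσ v hv := by simpa [crossVertices] using hσ.1 v hv
  vertex v hv := by
    obtain ⟨x, _, rfl⟩ := Finset.mem_map.1 hv
    refine ⟨fun w hw => ⟨x, (Finset.mem_singleton.1 hw).symm⟩, fun i hi => ?_⟩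
    simp only [Finset.mem_singleton] at hi
    exact absurd (e.injective (hi.1.trans hi.2.symm)) (by simp)
  card_le _ := card_le_of_mem_crossFaces
  cohomDim_eq q := by
    have h := cohomDim_induced_crossFaces (F := F) (e := e) (W := Finset.univ) (by simp) q
    rw [induced_eq_self (X := Finset.univ) (fun _ _ => Finset.subset_univ _) subset_rfl] at h
    simpa using h
  acyclic_diff _ := acyclic_crossFaces_diff
  cohomDim_induced_top W hW := by
    by_cases h : ∀ i, e (i, true) ∈ W ↔ e (i, false) ∈ W
    · rw [cohomDim_induced_crossFaces h, if_neg]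
      intro hcard
      refine hW fun v hv => ?_
      obtain ⟨⟨i, β⟩, _, rfl⟩ := Finset.mem_map.1 hv
      have h1 : (Finset.univ.filter fun i => e (i, true) ∈ W) = Finset.univ := by
        rw [← Finset.card_eq_iff_eq_univ, Fintype.card_fin]
        exact_mod_cast hcard
      have h2 : e (i, true) ∈ W := by
        have h3 := Finset.mem_univ i
        rw [← h1] at h3
        exact (Finset.mem_filter.1 h3).2
      cases β
      · exact (h i).1 h2
      · exact h2
    · push Not at h
      obtain ⟨i, ⟨h1, h2⟩ | ⟨h1, h2⟩⟩ := h
      · exact (acyclic_induced_crossFaces (β := true) h1 h2).cohomDim_eq_zero _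
      · exact (acyclic_induced_crossFaces (β := false) h2 h1).cohomDim_eq_zero _

end ConnectedSum

/-! ### Summing the cohomology over all vertex sets of a given size. -/

section Counting

set_option linter.unusedSectionVars false

theorem sum_powerset_union {α M : Type*} [DecidableEq α] [AddCommMonoid M] {S T : Finset α}
    (h : Disjoint S T) (f : Finset α → M) :
    ∑ W ∈ (S ∪ T).powerset, f W = ∑ A ∈ T.powerset, ∑ U ∈ S.powerset, f (U ∪ A) := by
  rw [← Finset.sum_product']
  symm
  have hd : ∀ {A U : Finset α}, A ⊆ T → U ⊆ S → (U ∪ A) ∩ T = A ∧ (U ∪ A) ∩ S = U := by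
    intro A U hA hU
    have h1 : U ∩ T = ∅ :=
      Finset.disjoint_iff_inter_eq_empty.1 (Finset.disjoint_of_subset_left hU h)
    have h2 : A ∩ S = ∅ :=
      Finset.disjoint_iff_inter_eq_empty.1 (Finset.disjoint_of_subset_left hA h.symm)
    rw [Finset.union_inter_distrib_right, Finset.union_inter_distrib_right, h1, h2,
      Finset.inter_eq_left.2 hA, Finset.inter_eq_left.2 hU]
    simp
  refine Finset.sum_nbij' (fun x => x.2 ∪ x.1) (fun W => (W ∩ T, W ∩ S)) ?_ ?_ ?_ ?_ ?_
  · rintro ⟨A, U⟩ hx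
    simp only [Finset.mem_product, Finset.mem_powerset] at hx ⊢
    exact Finset.union_subset_union hx.2 hx.1
  · intro W _
    simp
  · rintro ⟨A, U⟩ hx
    simp only [Finset.mem_product, Finset.mem_powerset] at hx
    exact Prod.ext (hd hx.1 hx.2).1 (hd hx.1 hx.2).2
  · intro W hW
    rw [Finset.mem_powerset] at hW
    dsimp only
    rw [← Finset.inter_union_distrib_left, Finset.inter_eq_left.2 hW]
  · intros; rfl

theorem sum_powerset_ite_card {α : Type*} [DecidableEq α] (R : Finset α) (g : ℕ → ℕ) (m k : ℕ) :
    ∑ U ∈ R.powerset, (if U.card + m = k then g U.card else 0) =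
      if m ≤ k then R.card.choose (k - m) * g (k - m) else 0 := by
  rw [Finset.sum_powerset_apply_card (fun c => if c + m = k then g c else 0)]
  split_ifs with h
  · have h1 : ∀ c ∈ Finset.range (R.card + 1),
        R.card.choose c • (if c + m = k then g c else 0) =
          if c = k - m then R.card.choose c * g c else 0 := by
      intro c _
      by_cases hc : c = k - m
      · rw [if_pos hc, if_pos (by omega), smul_eq_mul]
      · rw [if_neg hc, if_neg (by omega), smul_zero]
    rw [Finset.sum_congr rfl h1, Finset.sum_ite_eq']
    split_ifs with h2
    · rfl
    · rw [Finset.mem_range] at h2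
      rw [Nat.choose_eq_zero_of_lt (by omega), zero_mul]
  · refine Finset.sum_eq_zero fun c _ => ?_
    rw [if_neg (by omega), smul_zero]

variable {V F : Type*} [LinearOrder V] [Fintype V] [Field F]

/-- The sum of the dimensions of the cohomology of the restrictions to `k` vertices. -/
noncomputable def bettiSum (F : Type*) [Field F] (K : Set (Finset V)) (X : Finset V)
    (k : ℕ) (q : ℤ) : ℕ :=
  ∑ W ∈ Finset.powersetCard k X, cohomDim F (induced K W) q

theorem sum_powersetCard_eq {α : Type*} (X : Finset α) (k : ℕ) (f : Finset α → ℕ) :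
    ∑ W ∈ Finset.powersetCard k X, f W = ∑ W ∈ X.powerset, if W.card = k then f W else 0 := by
  rw [Finset.powersetCard_eq_filter, Finset.sum_filter]

variable {d : ℕ}

/-- Both vertices of the pairs in `I`. -/
def bothSides (e : Fin d × Bool ↪ V) (I : Finset (Fin d)) : Finset V :=
  (I ×ˢ Finset.univ).map e

theorem mem_bothSides {e : Fin d × Bool ↪ V} {I : Finset (Fin d)} {i : Fin d} {β : Bool} :
    e (i, β) ∈ bothSides e I ↔ i ∈ I := by
  simp [bothSides]

theorem card_bothSides (e : Fin d × Bool ↪ V) (I : Finset (Fin d)) :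
    (bothSides e I).card = 2 * I.card := by
  rw [bothSides, Finset.card_map, Finset.card_product]
  simp [mul_comm]

theorem bothSides_subset (e : Fin d × Bool ↪ V) (I : Finset (Fin d)) :
    bothSides e I ⊆ crossVertices e := Finset.map_subset_map.2 (Finset.subset_univ _)

theorem cohomDim_bothSides (e : Fin d × Bool ↪ V) (I : Finset (Fin d)) (j : ℕ) :
    cohomDim F (induced (crossFaces e) (bothSides e I)) j = if I.card = j then 1 else 0 := by
  rw [cohomDim_induced_crossFaces fun i => by rw [mem_bothSides, mem_bothSides]]
  simp [mem_bothSides]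

/-- Sums over the restrictions of the cross-polytope with nonvanishing cohomology. -/
theorem sum_powerset_crossVertices (e : Fin d × Bool ↪ V) (j : ℕ) (g : ℕ → ℕ) :
    ∑ Z ∈ (crossVertices e).powerset, g Z.card * cohomDim F (induced (crossFaces e) Z) j =
      d.choose j * g (2 * j) := by
  have h : ∑ I ∈ Finset.powersetCard j (Finset.univ : Finset (Fin d)), g (2 * j) =
      ∑ Z ∈ (crossVertices e).powerset,
        g Z.card * cohomDim F (induced (crossFaces e) Z) j := by
    refine Finset.sum_of_injOn (bothSides e) ?_ ?_ ?_ ?_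
    · intro I _ J _ h
      ext i
      rw [← mem_bothSides (e := e) (β := true), h, mem_bothSides]
    · intro I _
      exact Finset.mem_coe.2 (Finset.mem_powerset.2 (bothSides_subset e I))
    -- A set not of the form `bothSides e I` with `I.card = j` contributes zero: either it splits
    -- some pair and is acyclic, or its cohomology is in another cardinality.
    · intro Z hZ hZ'
      by_cases hs : ∀ i, e (i, true) ∈ Z ↔ e (i, false) ∈ Z
      · have hZI : bothSides e (Finset.univ.filter fun i => e (i, true) ∈ Z) = Z := by
          ext v
          constructor
          · intro hv
            obtain ⟨⟨i, β⟩, _, rfl⟩ := Finset.mem_map.1 (bothSides_subset e _ hv)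
            have := (Finset.mem_filter.1 (mem_bothSides.1 hv)).2
            cases β
            · exact (hs i).1 this
            · exact this
          · intro hv
            obtain ⟨⟨i, β⟩, _, rfl⟩ := Finset.mem_map.1 (Finset.mem_powerset.1 hZ hv)
            refine mem_bothSides.2 (Finset.mem_filter.2 ⟨Finset.mem_univ i, ?_⟩)
            cases β
            · exact (hs i).2 hv
            · exact hv
        rw [← hZI, cohomDim_bothSides, if_neg, mul_zero]
        intro hc
        exact hZ' ⟨_, Finset.mem_coe.2 (Finset.mem_powersetCard.2 ⟨Finset.subset_univ _, hc⟩), hZI⟩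
      · push Not at hs
        obtain ⟨i, ⟨h1, h2⟩ | ⟨h1, h2⟩⟩ := hs
        · rw [(acyclic_induced_crossFaces (β := true) h1 h2).cohomDim_eq_zero, mul_zero]
        · rw [(acyclic_induced_crossFaces (β := false) h2 h1).cohomDim_eq_zero, mul_zero]
    · intro I hI
      have hc := (Finset.mem_powersetCard.1 hI).2
      rw [cohomDim_bothSides, if_pos hc, card_bothSides, hc, mul_one]
  rw [← h, Finset.sum_const, Finset.card_powersetCard, Finset.card_univ, Fintype.card_fin,
    smul_eq_mul]

theorem crossVertices_eq (e : Fin d × Bool ↪ V) : crossVertices e =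
    sideVertices e true Finset.univ ∪ sideVertices e false Finset.univ := by
  ext v
  constructor
  · intro hv
    obtain ⟨⟨i, β⟩, _, rfl⟩ := Finset.mem_map.1 hv
    rw [Finset.mem_union, mem_sideVertices, mem_sideVertices]
    cases β <;> simp
  · intro hv
    rcases Finset.mem_union.1 hv with h | h <;>
    · obtain ⟨i, _, rfl⟩ := Finset.mem_image.1 h
      simp [crossVertices]

theorem disjoint_sideVertices (e : Fin d × Bool ↪ V) (I J : Finset (Fin d)) :
    Disjoint (sideVertices e true I) (sideVertices e false J) := by
  rw [Finset.disjoint_left]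
  intro v h1 h2
  obtain ⟨i, _, rfl⟩ := Finset.mem_image.1 h1
  rw [mem_sideVertices] at h2
  exact absurd h2.1 (by simp)

theorem card_crossVertices (e : Fin d × Bool ↪ V) : (crossVertices e).card = 2 * d := by
  simp [crossVertices, mul_comm]

theorem induced_eq_of_inter {K : Set (Finset V)} {X W W' : Finset V} (h : ∀ σ ∈ K, σ ⊆ X)
    (hW : W ∩ X = W' ∩ X) : induced K W = induced K W' := by
  ext σ
  refine and_congr_right fun hσ => ?_
  have hX := h σ hσ
  constructor <;> intro h' v hv
  · exact (Finset.mem_inter.1 (hW ▸ Finset.mem_inter.2 ⟨h' hv, hX hv⟩)).1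
  · exact (Finset.mem_inter.1 (hW.symm ▸ Finset.mem_inter.2 ⟨h' hv, hX hv⟩)).1

/-- The contribution of the restrictions which meet both summands outside the common facet. -/
def disconnectedTerm (d r k : ℕ) : ℕ :=
  ∑ ℓ ∈ Finset.range (d + 1), d.choose ℓ * if ℓ = 0 then 0 else
    if ℓ ≤ k then r.choose (k - ℓ) * (if k - ℓ = 0 then 0 else 1) else 0

/-- The contribution of the restrictions which contain the common facet, but neither of the
summands. -/
def facetTerm (d r k : ℕ) : ℕ :=
  ∑ ℓ ∈ Finset.range (d + 1), d.choose ℓ * if ℓ = d then 0 else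
    if d + ℓ ≤ k then r.choose (k - (d + ℓ)) * (if k - (d + ℓ) = r then 0 else 1) else 0

/-- The contribution of the new cross-polytope. -/
def crossTerm (d r k j : ℕ) : ℕ :=
  d.choose j * if 2 * j ≤ k then r.choose (k - 2 * j) else 0

section Glued

variable {A : Set (Finset V)} {X : Finset V} {e : Fin d × Bool ↪ V}
  (h : Gluing F d A (crossFaces e) X (crossVertices e) (sideVertices e true Finset.univ))
include h

local notation "GG" => sideVertices e true Finset.univ
local notation "NN" => sideVertices e false Finset.univ
local notation "RR" => X \ sideVertices e true Finset.univ

theorem Gluing.union_eq : X ∪ crossVertices e = X ∪ NN := by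
  rw [crossVertices_eq, ← Finset.union_assoc, Finset.union_eq_left.2 h.subset_left]

theorem Gluing.disjoint_new : Disjoint X NN := by
  rw [Finset.disjoint_left]
  intro v hX hN
  have hG : v ∈ GG := h.inter_subset (Finset.mem_inter.2 ⟨hX, by
    rw [crossVertices_eq]; exact Finset.mem_union_right _ hN⟩)
  exact Finset.disjoint_left.1 (disjoint_sideVertices e _ _) hG hN

omit h in
theorem sum_powerset_sideVertices (g : ℕ → ℕ) :
    ∑ T ∈ (NN).powerset, g T.card = ∑ ℓ ∈ Finset.range (d + 1), d.choose ℓ * g ℓ := by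
  rw [Finset.sum_powerset_apply_card g, card_sideVertices, Finset.card_univ, Fintype.card_fin]
  simp

theorem Gluing.card_union_of_subset {U T : Finset V} (hU : U ⊆ X) (hT : T ⊆ NN) :
    (U ∪ T).card = U.card + T.card :=
  Finset.card_union_of_disjoint
    (Finset.disjoint_of_subset_left hU (Finset.disjoint_of_subset_right hT h.disjoint_new))

/-- New vertices do not affect the restriction of `A`. Grouping by their number `ℓ` produces the
weights `d.choose ℓ` of the recursion. -/
theorem Gluing.sum_left (k : ℕ) (q : ℤ) :
    ∑ W ∈ (X ∪ NN).powerset, (if W.card = k then cohomDim F (induced A W) q else 0) =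
      ∑ ℓ ∈ Finset.range (d + 1), d.choose ℓ * if ℓ ≤ k then bettiSum F A X (k - ℓ) q else 0 := by
  rw [sum_powerset_union h.disjoint_new,
    ← sum_powerset_sideVertices (e := e) fun ℓ => if ℓ ≤ k then bettiSum F A X (k - ℓ) q else 0]
  refine Finset.sum_congr rfl fun T hT => ?_
  rw [Finset.mem_powerset] at hT
  have hU : ∀ U ∈ X.powerset, (if (U ∪ T).card = k then cohomDim F (induced A (U ∪ T)) q else 0) =
      if U.card + T.card = k then cohomDim F (induced A U) q else 0 := by
    intro U hU
    rw [Finset.mem_powerset] at hU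
    rw [h.card_union_of_subset hU hT, induced_eq_of_inter (W := U ∪ T) (W' := U) h.left.subset]
    rw [Finset.union_inter_distrib_right, Finset.inter_comm T X,
      Finset.disjoint_iff_inter_eq_empty.1 (Finset.disjoint_of_subset_right hT h.disjoint_new),
      Finset.union_empty]
  rw [Finset.sum_congr rfl hU]
  split_ifs with hk
  · rw [bettiSum, sum_powersetCard_eq]
    refine Finset.sum_congr rfl fun U _ => ?_
    have : U.card + T.card = k ↔ U.card = k - T.card := by omega
    simp only [this]
  · exact Finset.sum_eq_zero fun U _ => if_neg (by omega)

/-- The restriction of the cross-polytope only sees its own vertices, so the old vertices outside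
the facet are chosen freely. -/
theorem Gluing.sum_right (k j : ℕ) :
    ∑ W ∈ (X ∪ crossVertices e).powerset,
      (if W.card = k then cohomDim F (induced (crossFaces e) W) j else 0) =
      crossTerm d (RR).card k j := by
  have hdisj : Disjoint (RR) (crossVertices e) := by
    rw [Finset.disjoint_left]
    intro v hv hY
    rw [Finset.mem_sdiff] at hv
    exact hv.2 (h.inter_subset (Finset.mem_inter.2 ⟨hv.1, hY⟩))
  have hun : X ∪ crossVertices e = RR ∪ crossVertices e := by
    have : GG ⊆ crossVertices e := by
      rw [crossVertices_eq]; exact Finset.subset_union_left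
    ext v
    simp only [Finset.mem_union, Finset.mem_sdiff]
    have := @this v
    tauto
  rw [hun, sum_powerset_union hdisj, crossTerm, ← sum_powerset_crossVertices (F := F) e j
    fun m => if m ≤ k then (RR).card.choose (k - m) else 0]
  refine Finset.sum_congr rfl fun Z hZ => ?_
  rw [Finset.mem_powerset] at hZ
  have hU : ∀ U ∈ (RR).powerset,
      (if (U ∪ Z).card = k then cohomDim F (induced (crossFaces e) (U ∪ Z)) j else 0) =
      (if U.card + Z.card = k then 1 else 0) * cohomDim F (induced (crossFaces e) Z) j := by
    intro U hU
    rw [Finset.mem_powerset] at hU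
    have hUY := Finset.disjoint_of_subset_left hU hdisj
    rw [Finset.card_union_of_disjoint (Finset.disjoint_of_subset_right hZ hUY),
      induced_eq_of_inter (W := U ∪ Z) (W' := Z) h.right.subset]
    · simp
    · rw [Finset.union_inter_distrib_right, Finset.disjoint_iff_inter_eq_empty.1 hUY,
        Finset.empty_union]
  rw [Finset.sum_congr rfl hU, ← Finset.sum_mul, sum_powerset_ite_card (RR) (fun _ => 1)]
  simp

theorem Gluing.sum_powerset (f : Finset V → ℕ) :
    ∑ W ∈ (X ∪ NN).powerset, f W = ∑ T ∈ (NN).powerset, ∑ B ∈ (GG).powerset,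
      ∑ U ∈ (RR).powerset, f (U ∪ B ∪ T) := by
  rw [sum_powerset_union h.disjoint_new]
  refine Finset.sum_congr rfl fun T _ => ?_
  rw [← sum_powerset_union Finset.sdiff_disjoint fun W => f (W ∪ T),
    Finset.sdiff_union_of_subset h.subset_left]

theorem Gluing.inter_eq_of_subset {U B T : Finset V} (hU : U ⊆ RR) (hB : B ⊆ GG) (hT : T ⊆ NN) :
    (U ∪ B ∪ T) ∩ GG = B ∧ (U ∪ B ∪ T) ∩ X = U ∪ B ∧
      (U ∪ B ∪ T) ∩ crossVertices e = B ∪ T := by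
  have h1 := h.subset_left
  have h2 := Finset.disjoint_left.1 h.disjoint_new
  have h3 := crossVertices_eq e
  refine ⟨?_, ?_, ?_⟩ <;> ext v <;> have hU := @hU v <;> have hB := @hB v <;>
    have hT := @hT v <;> have h1 := @h1 v <;> have h2 := @h2 v <;>
    simp only [h3, Finset.mem_union, Finset.mem_inter, Finset.mem_sdiff] at * <;> tauto

theorem Gluing.sum_disconnected (k : ℕ) :
    ∑ W ∈ (X ∪ NN).powerset, (if W.card = k then
      if W ∩ GG = ∅ ∧ (W ∩ X).Nonempty ∧ (W ∩ crossVertices e).Nonempty then 1 else 0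
      else 0) = disconnectedTerm d (RR).card k := by
  rw [h.sum_powerset, disconnectedTerm, ← sum_powerset_sideVertices (e := e) fun ℓ =>
    if ℓ = 0 then 0 else if ℓ ≤ k then
      (RR).card.choose (k - ℓ) * (if k - ℓ = 0 then 0 else 1) else 0]
  refine Finset.sum_congr rfl fun T hT => ?_
  rw [Finset.mem_powerset] at hT
  -- Only sets disjoint from the facet count; they are pairs of a nonempty set of new vertices and a
  -- nonempty set of old ones off the facet.
  rw [Finset.sum_eq_single ∅]
  · rw [← sum_powerset_ite_card (RR) (fun c => if c = 0 then 0 else 1)]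
    by_cases hT0 : T.card = 0
    · rw [if_pos hT0]
      rw [Finset.card_eq_zero] at hT0
      subst hT0
      refine Finset.sum_eq_zero fun U hU => ?_
      rw [Finset.mem_powerset] at hU
      have e := (h.inter_eq_of_subset hU (Finset.empty_subset _) hT).2.2
      rw [e]
      simp
    · rw [if_neg hT0]
      refine Finset.sum_congr rfl fun U hU => ?_
      rw [Finset.mem_powerset] at hU
      obtain ⟨e1, e2, e3⟩ := h.inter_eq_of_subset hU (Finset.empty_subset _) hT
      rw [e1, e2, e3, Finset.union_empty, Finset.empty_union,
        h.card_union_of_subset (hU.trans Finset.sdiff_subset) hT]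
      have hTne : T.Nonempty := Finset.card_ne_zero.1 hT0
      by_cases hU0 : U.card = 0
      · rw [Finset.card_eq_zero] at hU0
        subst hU0
        simp
      · have hUne : U.Nonempty := Finset.card_ne_zero.1 hU0
        simp [hTne, hUne, hUne.ne_empty]
  · intro B hB hB0
    rw [Finset.mem_powerset] at hB
    refine Finset.sum_eq_zero fun U hU => ?_
    rw [Finset.mem_powerset] at hU
    rw [(h.inter_eq_of_subset hU hB hT).1]
    simp [hB0]
  · simp

theorem Gluing.sum_facet (k : ℕ) :
    ∑ W ∈ (X ∪ NN).powerset, (if W.card = k then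
      if GG ⊆ W ∧ ¬ X ⊆ W ∧ ¬ crossVertices e ⊆ W then 1 else 0 else 0) =
      facetTerm d (RR).card k := by
  have hGc : (GG).card = d := h.card_eq
  have hNc : (NN).card = d := by
    rw [card_sideVertices, Finset.card_univ, Fintype.card_fin]
  rw [h.sum_powerset, facetTerm, ← sum_powerset_sideVertices (e := e) fun ℓ =>
    if ℓ = d then 0 else if d + ℓ ≤ k then (RR).card.choose (k - (d + ℓ)) *
      (if k - (d + ℓ) = (RR).card then 0 else 1) else 0]
  refine Finset.sum_congr rfl fun T hT => ?_
  rw [Finset.mem_powerset] at hT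
  -- Only sets containing the facet count. Given that, containing a summand means containing all of
  -- the other old vertices, respectively all new vertices, which become conditions on
  -- cardinalities.
  rw [Finset.sum_eq_single (GG)]
  · rw [← sum_powerset_ite_card (RR) (fun c => if c = (RR).card then 0 else 1)]
    have hW : ∀ U ∈ (RR).powerset, (GG ⊆ U ∪ GG ∪ T) ∧ (X ⊆ U ∪ GG ∪ T ↔ U.card = (RR).card) ∧
        (crossVertices e ⊆ U ∪ GG ∪ T ↔ T.card = d) := by
      intro U hU
      rw [Finset.mem_powerset] at hU
      obtain ⟨e1, e2, e3⟩ := h.inter_eq_of_subset hU subset_rfl hT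
      refine ⟨Finset.subset_union_right.trans Finset.subset_union_left, ?_, ?_⟩
      · rw [← Finset.inter_eq_right, e2]
        constructor
        · intro hX
          have := congrArg Finset.card hX
          rw [Finset.card_union_of_disjoint
            (Finset.disjoint_of_subset_left hU Finset.sdiff_disjoint)] at this
          have h2 := Finset.card_sdiff_add_card_eq_card h.subset_left
          omega
        · intro hc
          rw [Finset.eq_of_subset_of_card_le hU hc.ge]
          exact Finset.sdiff_union_of_subset h.subset_left
      · rw [← Finset.inter_eq_right, e3]
        constructor
        · intro hY
          have := congrArg Finset.card hY
          rw [Finset.card_union_of_disjoint (Finset.disjoint_of_subset_right hT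
            (disjoint_sideVertices e _ _)), card_crossVertices] at this
          omega
        · intro hc
          rw [Finset.eq_of_subset_of_card_le hT (by rw [hc, hNc]), crossVertices_eq]
    by_cases hTd : T.card = d
    · rw [if_pos hTd]
      refine Finset.sum_eq_zero fun U hU => ?_
      rw [if_neg fun hc : _ ∧ _ => hc.2.2 ((hW U hU).2.2.2 hTd), ite_self]
    · rw [if_neg hTd]
      refine Finset.sum_congr rfl fun U hU => ?_
      obtain ⟨w1, w2, w3⟩ := hW U hU
      rw [Finset.mem_powerset] at hU
      have hcard : (U ∪ GG ∪ T).card = U.card + (d + T.card) := by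
        rw [h.card_union_of_subset (Finset.union_subset (hU.trans Finset.sdiff_subset)
          h.subset_left) hT, Finset.card_union_of_disjoint
          (Finset.disjoint_of_subset_left hU Finset.sdiff_disjoint), hGc, add_assoc]
      rw [hcard]
      refine if_congr Iff.rfl ?_ rfl
      by_cases hUc : U.card = (RR).card
      · rw [if_pos hUc, if_neg fun hc : _ ∧ _ => hc.2.1 (w2.2 hUc)]
      · rw [if_neg hUc, if_pos ⟨w1, fun hc => hUc (w2.1 hc), fun hc => hTd (w3.1 hc)⟩]
  · intro B hB hB0
    rw [Finset.mem_powerset] at hB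
    refine Finset.sum_eq_zero fun U hU => ?_
    rw [Finset.mem_powerset] at hU
    have e1 := (h.inter_eq_of_subset hU hB hT).1
    rw [if_neg (c := _ ∧ _), ite_self]
    rintro ⟨hG, _⟩
    rw [Finset.inter_eq_right.2 hG] at e1
    exact hB0 e1.symm
  · simp

/-- The recursion for the Betti numbers of a connected sum with a cross-polytope. -/
theorem Gluing.bettiSum_eq (hd : 3 ≤ d) (k : ℕ) {j : ℕ} (hj : 1 ≤ j) (hjd : j < d) :
    bettiSum F ((A ∪ crossFaces e) \ {GG}) (X ∪ crossVertices e) k j =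
      (∑ ℓ ∈ Finset.range (d + 1),
        d.choose ℓ * if ℓ ≤ k then bettiSum F A X (k - ℓ) j else 0) +
      crossTerm d (RR).card k j + (if j = 1 then disconnectedTerm d (RR).card k else 0) +
      if j = d - 1 then facetTerm d (RR).card k else 0 := by
  rw [← h.sum_left, ← h.sum_right, ← h.sum_disconnected, ← h.sum_facet, h.union_eq, bettiSum,
    sum_powersetCard_eq]
  have hs : ∀ (p : Prop) [Decidable p] (g : Finset V → ℕ) (S : Finset (Finset V)),
      (if p then ∑ W ∈ S, g W else 0) = ∑ W ∈ S, if p then g W else 0 := by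
    intro p _ g S
    split_ifs <;> simp
  rw [hs, hs, ← Finset.sum_add_distrib, ← Finset.sum_add_distrib, ← Finset.sum_add_distrib]
  refine Finset.sum_congr rfl fun W _ => ?_
  by_cases hW : W.card = k
  swap
  · simp [hW]
  have a1 : (j : ℤ) = 1 ↔ j = 1 := by omega
  have a2 : (j : ℤ) = d - 1 ↔ j = d - 1 := by omega
  rw [if_pos hW, if_pos hW, if_pos hW, if_pos hW, if_pos hW,
    h.cohomDim_induced hd W (by omega) (by omega)]
  simp only [a1, a2, ite_and]

end Glued

end Counting

/-! ### Induction on the number of copies, and the Betti table. -/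

section StackedSpheres

set_option linter.unusedSectionVars false

/-- The sums of the dimensions of the cohomology of the restrictions to `k` vertices of a connected
sum of `m` cross-polytopes, in cardinality `1 ≤ j < d`. -/
def stackedBetti (d : ℕ) : ℕ → ℕ → ℕ → ℕ
  -- A junk value: a stacked sum has at least one copy (`IsStackedSum.one_le`).
  | 0, _, _ => 0
  | 1, k, j => d.choose j * if 2 * j = k then 1 else 0
  | m + 2, k, j =>
    (∑ ℓ ∈ Finset.range (d + 1), d.choose ℓ * if ℓ ≤ k then stackedBetti d (m + 1) (k - ℓ) j else 0)
    + crossTerm d ((m + 1) * d) k j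
    + (if j = 1 then disconnectedTerm d ((m + 1) * d) k else 0)
    + if j = d - 1 then facetTerm d ((m + 1) * d) k else 0

/-- Needed because the recursion by total degree runs over `ℓ ≤ i + j`, whereas the one by
homological position runs over `ℓ ≤ i`. -/
theorem stackedBetti_eq_zero {d m k j : ℕ} (h : k < j) : stackedBetti d m k j = 0 := by
  induction m generalizing k with
  | zero => rfl
  | succ m ih =>
    cases m with
    | zero => rw [stackedBetti, if_neg (by omega), mul_zero]
    | succ m =>
      rw [stackedBetti, crossTerm, if_neg (by omega), Finset.sum_eq_zero]
      · have h1 : (if j = 1 then disconnectedTerm d ((m + 1) * d) k else 0) = 0 := by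
          split_ifs with hj
          · refine Finset.sum_eq_zero fun ℓ _ => ?_
            split_ifs <;> omega
          · rfl
        have h2 : (if j = d - 1 then facetTerm d ((m + 1) * d) k else 0) = 0 := by
          split_ifs with hj
          · refine Finset.sum_eq_zero fun ℓ _ => ?_
            rw [if_neg (by omega : ¬ d + ℓ ≤ k), ite_self, mul_zero]
          · rfl
        rw [h1, h2]
        rfl
      · intro ℓ _
        split_ifs
        · rw [ih (by omega), mul_zero]
        · rfl

variable {V F : Type*} [LinearOrder V] [Fintype V] [Field F]

theorem IsStackedSum.one_le {d m : ℕ} {Δ : PreAbstractSimplicialComplex V}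
    (h : IsStackedSum d m Δ) : 1 ≤ m := by
  cases h <;> omega

theorem allFaces_of_connectedSum {Δ K L : PreAbstractSimplicialComplex V} {G : Finset V}
    (hG : G ∈ K.faces) (h : Δ.faces = (K.faces \ {G}) ∪ (L.faces \ {G})) :
    allFaces Δ = (allFaces K ∪ allFaces L) \ {G} := by
  have hne := (K.isRelLowerSet_faces hG).1
  ext σ
  simp only [allFaces, h, Set.mem_ofPred_eq, Set.mem_union, Set.mem_sdiff, Set.mem_singleton_iff]
  by_cases hσ : σ = ∅
  · subst hσ
    simp [hne.ne_empty.symm]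
  · tauto

/-- Stacked cross-polytopal spheres are spheres, and the Betti numbers of their restrictions do
not depend on the choices. -/
theorem IsStackedSum.exists_isHomologySphere (F : Type*) [Field F] {d m : ℕ} (hd : 3 ≤ d)
    {Δ : PreAbstractSimplicialComplex V} (h : IsStackedSum d m Δ) :
    ∃ X, IsHomologySphere F d (allFaces Δ) X ∧ X.card = (m + 1) * d ∧
      ∀ k j : ℕ, 1 ≤ j → j < d → bettiSum F (allFaces Δ) X k j = stackedBetti d m k j := by
  induction h with
  | single e =>
    rw [allFaces_map_crossPolytope]
    refine ⟨crossVertices e, isHomologySphere_crossFaces e, card_crossVertices e,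
      fun k j _ _ => ?_⟩
    rw [bettiSum, sum_powersetCard_eq, stackedBetti,
      ← sum_powerset_crossVertices (F := F) e j fun c => if c = k then 1 else 0]
    exact Finset.sum_congr rfl fun Z _ => by simp
  | @sum m Γ Δ e hΓ hΔ ih =>
    obtain ⟨X, hX, hcard, hB⟩ := ih
    obtain ⟨G, hGΓ, hGe, hv, hfaces⟩ := hΔ
    -- Renaming within pairs makes the glued facet the side `true`, so that all gluings take one
    -- standard form.
    obtain ⟨t, rfl⟩ := exists_flip_of_isFacet hGe
    have hall := allFaces_of_connectedSum hGΓ.1 hfaces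
    rw [allFaces_map_crossPolytope, ← crossFaces_flipPairs t e] at hall
    have hmem : ∀ {v : V} {K : PreAbstractSimplicialComplex V}, {v} ∈ allFaces K →
        {v} ∈ K.faces := fun hv => hv.resolve_left (Finset.singleton_ne_empty _)
    have hglue : Gluing F d (allFaces Γ) (crossFaces (flipPairs t e)) X
        (crossVertices (flipPairs t e)) (sideVertices (flipPairs t e) true Finset.univ) := by
      refine ⟨hX, isHomologySphere_crossFaces _, Or.inr hGΓ.1, sideVertices_mem_crossFaces _ _ _,
        by rw [card_sideVertices, Finset.card_univ, Fintype.card_fin], fun v hvXY => ?_⟩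
      rw [Finset.mem_inter] at hvXY
      refine hv v (hmem (hX.vertex v hvXY.1)) (hmem ?_)
      rw [allFaces_map_crossPolytope, ← crossFaces_flipPairs t e]
      exact (isHomologySphere_crossFaces (F := F) (flipPairs t e)).vertex v hvXY.2
    have hr : (X \ sideVertices (flipPairs t e) true Finset.univ).card = m * d := by
      rw [Finset.card_sdiff_of_subset hglue.subset_left, hglue.card_eq, hcard, Nat.succ_mul,
        Nat.add_sub_cancel]
    refine ⟨X ∪ crossVertices (flipPairs t e), ?_, ?_, fun k j hj hjd => ?_⟩
    · rw [hall]
      exact hglue.isHomologySphere (by omega)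
    · rw [hglue.union_eq, Finset.card_union_of_disjoint hglue.disjoint_new, hcard,
        card_sideVertices, Finset.card_univ, Fintype.card_fin]
      ring
    -- Having at least one copy in `Γ` selects the recursive clause of `stackedBetti`.
    · obtain ⟨m, rfl⟩ : ∃ m', m = m' + 1 := ⟨m - 1, by have := hΓ.one_le; omega⟩
      rw [hall, hglue.bettiSum_eq hd k hj hjd, hr, stackedBetti]
      congr 3
      refine Finset.sum_congr rfl fun ℓ _ => ?_
      split_ifs
      · rw [hB _ _ hj hjd]
      · rfl

/-- All graded Betti numbers of a stacked cross-polytopal sphere. -/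
theorem gradedBetti_eq_of_isStackedSum {n d m : ℕ} (hd : 3 ≤ d)
    {Δ : AbstractSimplicialComplex (Fin n)}
    (h : IsStackedSum d m Δ.toPreAbstractSimplicialComplex) (i k : ℕ) :
    gradedBetti F Δ i k = if k < i then 0 else if k = i then (if k = 0 then 1 else 0) else
      if k - i < d then stackedBetti d m k (k - i) else
      if k - i = d then (if k = n then 1 else 0) else 0 := by
  obtain ⟨X, hX, _, hB⟩ := h.exists_isHomologySphere F hd
  have hXu : X = Finset.univ := by
    refine Finset.eq_univ_iff_forall.2 fun v => ?_
    simpa using hX.subset {v} (Or.inr (Δ.singleton_mem v))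
  subst hXu
  rw [gradedBetti_eq_sum]
  split_ifs with h1 h2 h3 h4 h5 h6
  · exact Finset.sum_eq_zero fun W _ => cohomDim_eq_zero_of_card_ne fun σ _ => by omega
  · subst h2 h3
    rw [Finset.powersetCard_zero, Finset.sum_singleton,
      induced_eq_singleton_empty hX.subset hX.empty_mem (Finset.disjoint_empty_right _),
      cohomDim_singleton]
    simp
  · subst h2
    refine Finset.sum_eq_zero fun W hW => ?_
    have hc := (Finset.mem_powersetCard.1 hW).2
    obtain ⟨v, hv⟩ : W.Nonempty := by
      rw [← Finset.card_pos]; omega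
    rw [sub_self]
    exact cohomDim_zero_eq_zero (v := v) ⟨hX.empty_mem, Finset.empty_subset _⟩
      ⟨hX.vertex v (Finset.mem_univ v), by simpa using hv⟩
  · rw [← hB k (k - i) (by omega) h4, bettiSum, Nat.cast_sub (by omega)]
  · have : Finset.powersetCard k (Finset.univ : Finset (Fin n)) = {Finset.univ} := by
      rw [h6]
      have hn := Finset.powersetCard_self (Finset.univ : Finset (Fin n))
      rwa [Finset.card_univ, Fintype.card_fin] at hn
    rw [this, Finset.sum_singleton, induced_eq_self hX.subset subset_rfl, hX.cohomDim_eq,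
      if_pos (by omega)]
  · refine Finset.sum_eq_zero fun W hW => ?_
    have hc := (Finset.mem_powersetCard.1 hW).2
    have hkd : (k : ℤ) - i = d := by omega
    rw [hkd]
    refine hX.cohomDim_induced_top W fun hW' => h6 ?_
    rw [← hc, Finset.univ_subset_iff.1 hW', Finset.card_univ, Fintype.card_fin]
  · refine Finset.sum_eq_zero fun W _ => cohomDim_eq_zero_of_card_ne fun σ hσ => ?_
    have := hX.card_le σ hσ.1
    omega

theorem gradedBetti_row {n d m : ℕ} (hd : 3 ≤ d) {Δ : AbstractSimplicialComplex (Fin n)}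
    (h : IsStackedSum d m Δ.toPreAbstractSimplicialComplex) (i : ℕ) {j : ℕ} (hj : 1 ≤ j)
    (hjd : j < d) : gradedBetti F Δ i (i + j) = stackedBetti d m (i + j) j := by
  rw [gradedBetti_eq_of_isStackedSum hd h, if_neg (by omega), if_neg (by omega),
    Nat.add_sub_cancel_left, if_pos hjd]

theorem crossTerm_add (d r i j : ℕ) :
    crossTerm d r (i + j) j = d.choose j * if j ≤ i then r.choose (i - j) else 0 := by
  unfold crossTerm
  by_cases h : j ≤ i
  · rw [if_pos h, if_pos (by omega), show i + j - 2 * j = i - j by omega]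
  · rw [if_neg h, if_neg (by omega)]

/-- The upper bound `i` is the condition that at least one of the `i + 1` vertices is an old one. -/
theorem disconnectedTerm_succ (d r i : ℕ) : disconnectedTerm d r (i + 1) =
    ∑ ℓ ∈ Finset.Icc 1 (min i d), d.choose ℓ * r.choose (i + 1 - ℓ) := by
  unfold disconnectedTerm
  symm
  have hsub : Finset.Icc 1 (min i d) ⊆ Finset.range (d + 1) := by
    intro ℓ hℓ
    rw [Finset.mem_Icc] at hℓ
    rw [Finset.mem_range]
    omega
  refine Finset.sum_subset_zero_on_sdiff hsub ?_ ?_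
  · intro ℓ hℓ
    rw [Finset.mem_sdiff, Finset.mem_Icc, Finset.mem_range] at hℓ
    split_ifs <;> omega
  · intro ℓ hℓ
    rw [Finset.mem_Icc] at hℓ
    rw [if_neg (by omega), if_pos (by omega), if_neg (by omega), mul_one]

theorem exists_isStackedSum_of_mem_ST {d m n : ℕ} (hd : 0 < d) (hn : n = (m + 1) * d)
    {Δ : AbstractSimplicialComplex (Fin n)} (h : Δ ∈ ST n d) :
    IsStackedSum d m Δ.toPreAbstractSimplicialComplex := by
  obtain ⟨k, _, hk, hs⟩ := h
  have : k = m + 1 := Nat.eq_of_mul_eq_mul_right hd (hk.symm.trans hn)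
  subst this
  exact hs

/-- The recursion for the rows of the Betti table of a stacked cross-polytopal sphere. -/
theorem gradedBetti_recursion {d m n n' : ℕ} (hd : 3 ≤ d) {Δ : AbstractSimplicialComplex (Fin n)}
    {Γ : AbstractSimplicialComplex (Fin n')}
    (hΔ : IsStackedSum d (m + 2) Δ.toPreAbstractSimplicialComplex)
    (hΓ : IsStackedSum d (m + 1) Γ.toPreAbstractSimplicialComplex) (i : ℕ) {j : ℕ} (hj : 1 ≤ j)
    (hjd : j < d - 1) : gradedBetti F Δ i (i + j) =
      (∑ ℓ ∈ Finset.range (d + 1),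
        d.choose ℓ * (if ℓ ≤ i then gradedBetti F Γ (i - ℓ) (i - ℓ + j) else 0)) +
      d.choose j * (if j ≤ i then ((m + 1) * d).choose (i - j) else 0) +
      if j = 1 then disconnectedTerm d ((m + 1) * d) (i + j) else 0 := by
  rw [gradedBetti_row hd hΔ i hj (by omega), stackedBetti, crossTerm_add,
    if_neg (by omega : ¬ j = d - 1), add_zero]
  congr 2
  refine Finset.sum_congr rfl fun ℓ _ => ?_
  congr 1
  -- For `i < ℓ ≤ i + j` the term of total degree `i + j - ℓ < j` vanishes, matching the convention
  -- of zero Betti numbers in negative positions.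
  by_cases h : ℓ ≤ i
  · rw [if_pos h, if_pos (by omega), gradedBetti_row hd hΓ _ hj (by omega),
      show i + j - ℓ = i - ℓ + j by omega]
  · rw [if_neg h]
    split_ifs
    · exact stackedBetti_eq_zero (by omega)
    · rfl

end StackedSpheres
end Betti

/-! ### The main theorem. -/

theorem mainTheorem8 (F : Type*) [Field F] (n d : ℕ) (hd : 3 ≤ d) (hn : 3 * d ≤ n)
    (Δ : AbstractSimplicialComplex (Fin n)) (hΔ : Δ ∈ Betti.ST n d) :
    (∀ Γ ∈ Betti.ST (n - d) d,
      -- the row `j = 1`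
      (∀ i : ℕ, Betti.gradedBetti F Δ i (i + 1) =
        (∑ ℓ ∈ Finset.range (d + 1),
          d.choose ℓ * (if ℓ ≤ i then Betti.gradedBetti F Γ (i - ℓ) (i - ℓ + 1) else 0))
        + d * (if 1 ≤ i then (n - 2 * d).choose (i - 1) else 0)
        + ∑ ℓ ∈ Finset.Icc 1 (min i d), d.choose ℓ * (n - 2 * d).choose (i + 1 - ℓ)) ∧
      -- the rows `2 ≤ j ≤ d - 2`
      (∀ i j : ℕ, 2 ≤ j → j ≤ d - 2 → Betti.gradedBetti F Δ i (i + j) =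
        (∑ ℓ ∈ Finset.range (d + 1),
          d.choose ℓ * (if ℓ ≤ i then Betti.gradedBetti F Γ (i - ℓ) (i - ℓ + j) else 0))
        + d.choose j * (if j ≤ i then (n - 2 * d).choose (i - j) else 0))) ∧
    -- all graded Betti numbers depend only on `n` and `d`
    (∀ (K : Type*) [Field K], ∀ Δ' ∈ Betti.ST n d, ∀ i k : ℕ,
      Betti.gradedBetti F Δ i k = Betti.gradedBetti K Δ' i k) := by
  -- Thus `Δ` has `m + 2` copies and `Γ` has `m + 1`, and `n - 2 * d = (m + 1) * d` counts the
  -- vertices of the smaller sphere outside the glued facet.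
  obtain ⟨m, hm⟩ : ∃ m, n = (m + 3) * d := by
    obtain ⟨k, _, hk, _⟩ := hΔ
    have : 3 ≤ k := Nat.le_of_mul_le_mul_right (hk ▸ hn) (by omega)
    exact ⟨k - 3, by rw [Nat.sub_add_cancel this]; exact hk⟩
  have h2 : n - 2 * d = (m + 1) * d := by
    rw [hm, ← Nat.sub_mul]; rfl
  have h1 : n - d = (m + 2) * d := by
    rw [hm]; nth_rw 2 [← one_mul d]; rw [← Nat.sub_mul]; rfl
  have hΔs := Betti.exists_isStackedSum_of_mem_ST (m := m + 2) (by omega) hm hΔ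
  rw [h2]
  refine ⟨fun Γ hΓ => ?_, fun K _ Δ' hΔ' i k => ?_⟩
  · have hΓs := Betti.exists_isStackedSum_of_mem_ST (m := m + 1) (by omega) h1 hΓ
    refine ⟨fun i => ?_, fun i j hj hjd => ?_⟩
    -- The inequality `1 < d - 1`, that is `3 ≤ d`, keeps the facet correction out of this row.
    · rw [Betti.gradedBetti_recursion hd hΔs hΓs i le_rfl (by omega), if_pos rfl,
        Betti.disconnectedTerm_succ, Nat.choose_one_right]
    · rw [Betti.gradedBetti_recursion hd hΔs hΓs i (by omega) (by omega),
        if_neg (by omega : ¬ j = 1), add_zero]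
  · have hΔs' := Betti.exists_isStackedSum_of_mem_ST (m := m + 2) (by omega) hm hΔ'
    -- Both sides become the same expression in `n`, `d`, `m`, `i` and `k`, in which neither the
    -- complex nor the field occurs.
    rw [Betti.gradedBetti_eq_of_isStackedSum hd hΔs, Betti.gradedBetti_eq_of_isStackedSum hd hΔs']
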